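/- Write $\mathbb{N}=\{1,2,\dots\}$, $\mathbb{N}_0=\{0,1,\dots\}$, and let algorithms be deterministic multitape Turing machines, with integers written in binary and time counted in machine steps. For a set $X\subset\mathbb{N}$ and a function $f:X\to\mathbb{Z}$ put $$m_f(n)=\log(1+n)+\log(2+|f(n)|).$$ A PIO algorithm for $f$ is an algorithm that, for some constants $c,d\in\mathbb{N}$ and for every input $n\in X$, computes $f(n)$ in at most $c\cdot m_f(n)^d$ steps; $f$ is a PIO function if it has a PIO algorithm. Let $g(n,i,j)\in\{0,1\}$ be a function defined for $n,i\in\mathbb{N}$ and $j\in\mathbb{N}_0$ with $i,j\le n$. For $n\in\mathbb{N}$ let $f(n)\in\mathbb{N}_0$ be the number of partitions $\lambda=1^{j_1}2^{j_2}\dots n^{j_n}$ of $n$ (where $j_i\ge 0$ is the multiplicity of the part $i$) such that $g(n,i,j_i)=1$ for every $i\in\{1,\dots,n\}$. Then for every $n\in\mathbb{N}$ $$f(n)=[q^n]\prod_{i=1}^n\sum_{j=0}^n g(n,i,j)\,q^{ij}.$$ Suppose that $g(n,i,j)$ is computable in $\mathrm{poly}(n)$ steps, that $X\subset\mathbb{N}$,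 and that $f(n)\gg\exp(n^c)$ for $n\in X$ with a constant $c>0$ (that is, $\exp(n^c)=O(f(n))$ for $n\in X$, $n\to\infty$). Then the restriction $f:X\to\mathbb{N}_0$ is a PIO function. Moreover, a PIO algorithm for this restriction is obtained constructively from an algorithm for $g$: there is a computable map $\Phi$ from machines to machines, not depending on $g$, $X$ and $c$, such that for all $g$, $X$, $c$ as above and for every machine $M$ computing $g(n,i,j)$ in $\mathrm{poly}(n)$ steps, $\Phi(M)$ is a PIO algorithm for $f:X\to\mathbb{N}_0$. -/

import Mathlib

namespace EffectiveCount

/-! ### Deterministic multitape Turing machines as finite instruction tables -/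

instance : Primcodable Turing.Dir :=
  Primcodable.ofEquiv Bool
    { toFun := fun d => match d with
        | .left => false
        | .right => true
      invFun := fun b => match b with
        | false => .left
        | true => .right
      left_inv := fun d => by cases d <;> rfl
      right_inv := fun b => by cases b <;> rfl }

/-- An instruction of a multitape Turing machine whose states, symbols and tapes are numbered
`0, 1, 2, …`; the symbol `0` is the blank. It may be executed in the state `state` if, for each
entry `some a` at a position `t` of `read`, the head of tape `t` scans `a` (an entry `none` means
that any symbol will do). When it is executed, the machine goes to the state `next`, and for each
entry `(w, d)` at a position `t` of `act` it prints the symbol `w` on tape `t` (leaves the symbol as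
it is if `w = none`) and then moves that head one cell in the direction `d` (does not move it if
`d = none`). Tapes beyond the ends of the two lists are neither inspected nor changed. -/
structure Instruction where
  state : ℕ
  read : List (Option ℕ)
  next : ℕ
  act : List (Option ℕ × Option Turing.Dir)

/-- An instruction is the quadruple of its fields. -/
def Instruction.equivProd :
    Instruction ≃ ℕ × List (Option ℕ) × ℕ × List (Option ℕ × Option Turing.Dir) where
  toFun I := (I.state, I.read, I.next, I.act)
  invFun p := ⟨p.1, p.2.1, p.2.2.1, p.2.2.2⟩
  left_inv _ := rfl
  right_inv _ := rfl

instance : Primcodable Instruction :=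
  Primcodable.ofEquiv _ Instruction.equivProd

/-- A (deterministic) multitape Turing machine: a finite list of instructions. The list mentions
finitely many states, symbols and tapes only. In each step the first executable instruction of the
list is executed, and the machine halts when there is none. -/
abbrev Machine : Type := List Instruction

/-- A configuration: the current state and the tapes (with their heads), almost all of which are
never used. -/
structure Config where
  state : ℕ
  tape : ℕ → Turing.Tape ℕ

/-- The instruction can be executed in the given configuration. -/
def Instruction.Applies (I : Instruction) (c : Config) : Prop :=
  I.state = c.state ∧
    ∀ t : Fin I.read.length, ∀ a ∈ I.read[t], (c.tape t).head = a

instance (I : Instruction) (c : Config) : Decidable (I.Applies c) := by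
  unfold Instruction.Applies
  infer_instance

/-- What one entry of `Instruction.act` does with its tape. -/
def actOnTape (a : Option ℕ × Option Turing.Dir) (T : Turing.Tape ℕ) : Turing.Tape ℕ :=
  let T' := match a.1 with
    | none => T
    | some w => T.write w
  match a.2 with
  | none => T'
  | some d => T'.move d

/-- The configuration that results from executing the instruction. -/
def Instruction.exec (I : Instruction) (c : Config) : Config where
  state := I.next
  tape t := match I.act[t]? with
    | none => c.tape t
    | some a => actOnTape a (c.tape t)

/-- One step of the machine; `none` means that the machine has halted. -/
def Machine.step (M : Machine) (c : Config) : Option Config :=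
  (M.find? fun I => decide (I.Applies c)).map fun I => I.exec c

/-- The initial configuration: state `0`, the input word on tape `0` with the head on its first
symbol, and all other tapes blank. -/
def Config.init (w : List ℕ) : Config where
  state := 0
  tape t := if t = 0 then Turing.Tape.mk₁ w else Turing.Tape.mk₁ []

/-- The machine, started on the input word `w`, halts after at most `T` steps; tape `1` then holds
exactly the word `v`, with the head on its first symbol. -/
def Machine.OutputsWithin (M : Machine) (w v : List ℕ) (T : ℝ) : Prop :=
  ∃ (c : Config) (run : StateTransition.EvalsTo M.step (Config.init w) (some c)),
    (run.steps : ℝ) ≤ T ∧ M.step c = none ∧ c.tape 1 = Turing.Tape.mk₁ v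

/-! ### Binary codes -/

/-- The binary code of a natural number, least significant digit first; the symbols `1` and `2`
stand for the digits `0` and `1` (the symbol `0` is the blank). -/
def natWord (n : ℕ) : List ℕ :=
  (Nat.digits 2 n).map (· + 1)

/-- The binary code of an integer: its absolute value, preceded by the minus sign `3` if it is
negative. -/
def intWord (z : ℤ) : List ℕ :=
  if z < 0 then 3 :: natWord z.natAbs else natWord z.natAbs

/-- The code of a triple: the three binary codes, separated by the symbol `3`. -/
def tripleWord (n i j : ℕ) : List ℕ :=
  natWord n ++ 3 :: (natWord i ++ 3 :: natWord j)

/-! ### PIO functions -/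

/-- The combined complexity `m_f(n) = log (1 + n) + log (2 + |f(n)|)` of input and output. -/
noncomputable def complexity (f : ℕ → ℤ) (n : ℕ) : ℝ :=
  Real.log (1 + n) + Real.log (2 + |(f n : ℝ)|)

/-- `M` is a PIO algorithm for the restriction of `f` to `X`. -/
def IsPIOAlgorithmOn (M : Machine) (f : ℕ → ℤ) (X : Set ℕ) : Prop :=
  ∃ c d : ℕ, 0 < c ∧ 0 < d ∧
    ∀ n ∈ X, M.OutputsWithin (natWord n) (intWord (f n)) (c * complexity f n ^ d)

/-- The restriction of `f` to `X` is a PIO function. -/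
def IsPIOFunctionOn (f : ℕ → ℤ) (X : Set ℕ) : Prop :=
  ∃ M : Machine, IsPIOAlgorithmOn M f X

/-- `M` computes `g(n, i, j)`, for `1 ≤ i ≤ n` and `0 ≤ j ≤ n`, in `poly(n)` steps. -/
def ComputesInPolySteps (M : Machine) (g : ℕ → ℕ → ℕ → ℕ) : Prop :=
  ∃ c d : ℕ, ∀ n i j : ℕ, 1 ≤ i → i ≤ n → j ≤ n →
    M.OutputsWithin (tripleWord n i j) (natWord (g n i j)) (c * (1 + n : ℝ) ^ d)

/-! ### Partitions with prescribed parts and multiplicities -/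

/-- The number of partitions of `n` in which every `i ∈ {1, …, n}` has a multiplicity `j` (possibly
`0`) such that `g(n, i, j) = 1`. -/
noncomputable def partitionCount (g : ℕ → ℕ → ℕ → ℕ) (n : ℕ) : ℕ :=
  Nat.card {p : n.Partition // ∀ i ∈ Finset.Icc 1 n, g n i (p.parts.count i) = 1}

end EffectiveCount

/-! The generating function identity comes from expanding the coefficient of `q^n`. A nonzero term
picks from the factor of each `i` an exponent `i * j_i`, so it is given by the multiplicities of a
partition of `n`. Since `g` takes only the values `0` and `1`, its product over the parts is the
indicator of being permitted (`coeff_prod_multiplicitySeries`, `partitionCount_eq_coeff`).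

The coefficient is computed by Kronecker substitution. The product `P` has natural coefficients,
each at most `P(1) ≤ (n + 1)^n < 2^W` with `W = n (n + 1)`. Hence the coefficients are the digits of
the integer `P(2^W)` in base `2^W`, and the count is its digit number `n` (`eval_div_pow_mod`,
`kronecker_digit`). Evaluating `P` at a power of two needs shifts and additions only: multiplying
`x` by the factor of `i` means adding those `x * 2^(W i j)` for which `g(n, i, j) = 1`. All words
have length polynomial in `n`, and `g` is evaluated `n (n + 1)` times, so the whole computation
takes `poly(n)` steps (`runs_program`, `PolyBounded.programTime`).

Growth enters only at the end. From `exp(n^c) = O(f(n))` it follows that `n^c = O(m_f(n))`, so a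
polynomial bound in `n` is also one in `m_f(n)`, with an exponent depending on `c`
(`exists_succ_le_mul_complexity_pow`).

For uniformity, the program is one fixed text into which the instruction table of `M` is inserted as
a subroutine; the running time of `M`, the set `X` and the constant `c` are not needed to write it
down. So `countingMachine` is a primitive recursive function of the table (`primrecFrag_program`). A
simulated machine may leave arbitrary symbols, even blanks between nonblanks, on its tapes. Each
simulated tape therefore has a companion tape marking the visited cells, by which it is wiped before
the next call (`Marks`, `exists_run_simulate`). Correctness and time are proved together, fragment
by fragment, through `Frag.Runs`. -/

namespace EffectiveCount
open Turing

/-! ### Tapes as zippers -/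

/-- The tape with the word `l` (read from right to left) to the left of the head and the word `r`
from the head on. -/
def zip (l r : List ℕ) : Tape ℕ := Tape.mk₂ l r

/-- The blank tape. -/
abbrev blank : Tape ℕ := zip [] []

theorem mk₁_eq_zip (w : List ℕ) : (Tape.mk₁ w : Tape ℕ) = zip [] w := rfl

@[simp] theorem zip_head_nil (l : List ℕ) : (zip l []).head = 0 := rfl
@[simp] theorem zip_head_cons (l r : List ℕ) (a : ℕ) : (zip l (a :: r)).head = a := rfl

@[simp] theorem zip_move_right_cons (l r : List ℕ) (a : ℕ) :
    (zip l (a :: r)).move Dir.right = zip (a :: l) r := by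
  simp [zip, Tape.mk₂, Tape.move_right_mk']

@[simp] theorem zip_move_right_nil (l : List ℕ) :
    (zip l []).move Dir.right = zip (0 :: l) [] := by
  simp [zip, Tape.mk₂, Tape.move_right_mk']

@[simp] theorem zip_move_left_cons (l r : List ℕ) (a : ℕ) :
    (zip (a :: l) r).move Dir.left = zip l (a :: r) := by
  simp [zip, Tape.mk₂, Tape.move_left_mk']

@[simp] theorem zip_move_left_nil (r : List ℕ) :
    (zip [] r).move Dir.left = zip [] (0 :: r) := by
  simp [zip, Tape.mk₂, Tape.move_left_mk']

@[simp] theorem zip_write_cons (l r : List ℕ) (a b : ℕ) :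
    (zip l (a :: r)).write b = zip l (b :: r) := by
  simp [zip, Tape.mk₂, Tape.write_mk']

@[simp] theorem zip_write_nil (l : List ℕ) (b : ℕ) :
    (zip l []).write b = zip l [b] := by
  simp [zip, Tape.mk₂, Tape.write_mk']

theorem listBlank_mk_append_zeros (r : List ℕ) (k : ℕ) :
    (ListBlank.mk (r ++ List.replicate k 0) : ListBlank ℕ) = ListBlank.mk r :=
  Quotient.sound (Or.inr ⟨k, rfl⟩)

theorem zip_append_zeros (l r : List ℕ) (k : ℕ) : zip l (r ++ List.replicate k 0) = zip l r := by
  simp only [zip, Tape.mk₂, listBlank_mk_append_zeros]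

theorem zip_append_zeros_left (l r : List ℕ) (k : ℕ) :
    zip (l ++ List.replicate k 0) r = zip l r := by
  simp only [zip, Tape.mk₂, listBlank_mk_append_zeros]

-- A head that steps off a word and returns leaves an explicit blank in the list; this lemma and the
-- next one absorb it.
@[simp] theorem zip_zero_left (r : List ℕ) : zip [0] r = zip [] r :=
  zip_append_zeros_left [] r 1

@[simp] theorem zip_zero_right (l : List ℕ) : zip l [0] = zip l [] :=
  zip_append_zeros l [] 1

/-! ### Runs of machines -/

/-- The contents of all tapes. -/
abbrev Tapes := ℕ → Tape ℕ

/-- The configuration after `t` steps. -/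
def Machine.run (M : Machine) : ℕ → Config → Option Config
  | 0, c => some c
  | t + 1, c => (M.step c).bind (M.run t)

theorem Machine.run_add (M : Machine) (s t : ℕ) (c : Config) :
    M.run (s + t) c = (M.run s c).bind (M.run t) := by
  induction s generalizing c with
  | zero => simp [Machine.run]
  | succ s ih =>
    rw [Nat.succ_add]
    simp only [Machine.run]
    cases M.step c <;> simp [ih]

theorem Machine.iterate_none (M : Machine) (t : ℕ) :
    (flip bind M.step)^[t] none = none := by
  induction t with
  | zero => rfl
  | succ t ih => rw [Function.iterate_succ_apply]; exact ih

/-- Bridge between `StateTransition.EvalsTo`, which `Machine.OutputsWithin` uses, and the recursion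
used for all run time proofs. -/
theorem Machine.iterate_eq_run (M : Machine) (t : ℕ) (c : Config) :
    (flip bind M.step)^[t] (some c) = M.run t c := by
  induction t generalizing c with
  | zero => rfl
  | succ t ih =>
    rw [Function.iterate_succ_apply]
    simp only [Machine.run]
    change (flip bind M.step)^[t] (M.step c) = _
    cases h : M.step c with
    | none => exact M.iterate_none t
    | some c' => exact ih c'

/-- An instruction for another state is never executable, so blocks of code with disjoint state
ranges do not disturb each other, in spite of the first-match rule. -/
theorem Machine.step_append_of_left (A B : Machine) (c : Config)
    (h : ∀ I ∈ B, I.state ≠ c.state) : Machine.step (A ++ B) c = A.step c := by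
  have hB : B.find? (fun I => decide (I.Applies c)) = none := by
    rw [List.find?_eq_none]
    intro I hI
    simpa using fun hc : I.Applies c => h I hI hc.1
  simp [Machine.step, List.find?_append, hB]

theorem Machine.step_append_of_right (A B : Machine) (c : Config)
    (h : ∀ I ∈ A, I.state ≠ c.state) : Machine.step (A ++ B) c = B.step c := by
  have hA : A.find? (fun I => decide (I.Applies c)) = none := by
    rw [List.find?_eq_none]
    intro I hI
    simpa using fun hc : I.Applies c => h I hI hc.1
  simp [Machine.step, List.find?_append, hA]

/-! ### Machine fragments -/

/-- A program fragment: a list of instructions, depending on the number `b` of its first state,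
whose states are `b, …, b + size - 1`. It is entered at the state `b` and left at `b + size`. -/
structure Frag where
  size : ℕ
  code : ℕ → Machine
  mem_range : ∀ b, ∀ I ∈ code b, b ≤ I.state ∧ I.state < b + size

/-- In the states of the fragment the machine `L` behaves as the fragment does. -/
def Frag.Embeds (F : Frag) (b : ℕ) (L : Machine) : Prop :=
  ∀ c : Config, b ≤ c.state → c.state < b + F.size → L.step c = (F.code b).step c

/-- The fragment turns the tapes `σ` into the tapes `σ'` within `T` steps. -/
def Frag.Runs (F : Frag) (σ σ' : Tapes) (T : ℕ) : Prop :=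
  ∀ (b : ℕ) (L : Machine), F.Embeds b L →
    ∃ t ≤ T, L.run t ⟨b, σ⟩ = some ⟨b + F.size, σ'⟩

theorem Frag.Runs.mono {F : Frag} {σ σ' : Tapes} {T T' : ℕ} (h : F.Runs σ σ' T) (hT : T ≤ T') :
    F.Runs σ σ' T' := fun b L hL =>
  let ⟨t, ht, hr⟩ := h b L hL
  ⟨t, ht.trans hT, hr⟩

/-- First `F`, then `G`. -/
def Frag.seq (F G : Frag) : Frag where
  size := F.size + G.size
  code b := F.code b ++ G.code (b + F.size)
  mem_range b I hI := by
    rcases List.mem_append.1 hI with h | h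
    · have := F.mem_range _ _ h; omega
    · have := G.mem_range _ _ h; omega

theorem Frag.Embeds.seq_left {F G : Frag} {b : ℕ} {L : Machine} (h : (F.seq G).Embeds b L) :
    F.Embeds b L := fun c h1 h2 => by
  rw [h c h1 (by simp only [Frag.seq]; omega)]
  refine Machine.step_append_of_left _ _ _ fun I hI => ?_
  have := G.mem_range _ _ hI
  omega

theorem Frag.Embeds.seq_right {F G : Frag} {b : ℕ} {L : Machine} (h : (F.seq G).Embeds b L) :
    G.Embeds (b + F.size) L := fun c h1 h2 => by
  rw [h c (by omega) (by simp only [Frag.seq]; omega)]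
  refine Machine.step_append_of_right _ _ _ fun I hI => ?_
  have := F.mem_range _ _ hI
  omega

/-- Composition works because `Frag.Runs` quantifies over every surrounding machine that embeds the
fragment, and the exit state of `F` is the entry state of `G`. -/
theorem Frag.Runs.seq {F G : Frag} {σ σ' σ'' : Tapes} {T T' : ℕ} (hF : F.Runs σ σ' T)
    (hG : G.Runs σ' σ'' T') : (F.seq G).Runs σ σ'' (T + T') := fun b L hL => by
  obtain ⟨t, ht, h⟩ := hF b L hL.seq_left
  obtain ⟨t', ht', h'⟩ := hG _ L hL.seq_right
  refine ⟨t + t', by omega, ?_⟩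
  rw [Machine.run_add, h, Option.bind_some, h', Frag.seq, Nat.add_assoc]

infixr:60 " ⨟ " => Frag.seq

/-! ### Sparse conditions and actions -/

/-- What to write on a tape, and where to move its head. -/
abbrev Act := Option ℕ × Option Dir

/-- A bound for the keys of an association list. -/
def keyBound {α : Type} (l : List (ℕ × α)) : ℕ := l.foldr (fun p s => p.1 + s + 1) 0

theorem lookup_eq_none_of_keyBound_le {α : Type} (l : List (ℕ × α)) (t : ℕ) (h : keyBound l ≤ t) :
    l.lookup t = none := by
  induction l with
  | nil => rfl
  | cons p l ih =>
    simp only [keyBound, List.foldr_cons] at h ih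
    rw [List.lookup_cons, ih (by omega)]
    have : (t == p.1) = false := by simp; omega
    simp [this]

/-- The positional form of a list of pairs (tape, symbol). -/
def reads (l : List (ℕ × ℕ)) : List (Option ℕ) :=
  (List.range (keyBound l)).map fun t => l.lookup t

/-- The positional form of a list of pairs (tape, action). -/
def acts (l : List (ℕ × Act)) : List Act :=
  (List.range (keyBound l)).map fun t => (l.lookup t).getD (none, none)

theorem Instruction.applies_iff (I : Instruction) (c : Config) :
    I.Applies c ↔ I.state = c.state ∧ ∀ t a, I.read[t]? = some (some a) → (c.tape t).head = a := by
  unfold Instruction.Applies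
  refine and_congr_right fun _ => ⟨fun h t a ht => ?_, fun h t a ha => ?_⟩
  · obtain ⟨hlt, he⟩ := List.getElem?_eq_some_iff.1 ht
    exact h ⟨t, hlt⟩ a (by simp [he])
  · refine h t a ?_
    rw [List.getElem?_eq_getElem t.2]
    exact congrArg some ha

theorem reads_getElem?_eq_some (l : List (ℕ × ℕ)) (t a : ℕ) :
    (reads l)[t]? = some (some a) ↔ l.lookup t = some a := by
  unfold reads
  by_cases h : t < keyBound l
  · simp [List.getElem?_map, List.getElem?_range h]
  · rw [lookup_eq_none_of_keyBound_le l t (by omega)]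
    simp [List.getElem?_map]
    intro x hx
    have := List.getElem?_eq_some_iff.1 hx
    simp at this
    omega

theorem lookup_eq_some_iff_mem {l : List (ℕ × ℕ)} (hl : (l.map Prod.fst).Nodup) (t a : ℕ) :
    l.lookup t = some a ↔ (t, a) ∈ l := by
  induction l with
  | nil => simp
  | cons p l ih =>
    obtain ⟨k, x⟩ := p
    simp only [List.map_cons, List.nodup_cons] at hl
    rw [List.lookup_cons]
    by_cases h : t = k
    · subst h
      have : (t, a) ∉ l := fun hm => hl.1 (List.mem_map.2 ⟨_, hm, rfl⟩)
      simp [this, eq_comm]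
    · have hb : (t == k) = false := by simpa using h
      simp [hb, ih hl.2, h]

/-- Without `Nodup` only the first entry for a tape would survive in `reads`, since `List.lookup`
ignores later ones. -/
theorem applies_reads {r : List (ℕ × ℕ)} (hr : (r.map Prod.fst).Nodup) (s nx : ℕ) (a : List Act)
    (c : Config) : (Instruction.mk s (reads r) nx a).Applies c ↔
      s = c.state ∧ ∀ p ∈ r, (c.tape p.1).head = p.2 := by
  rw [Instruction.applies_iff]
  refine and_congr_right fun _ => ⟨fun h p hp => ?_, fun h t a ht => ?_⟩
  · refine h p.1 p.2 ?_
    rw [reads_getElem?_eq_some]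
    exact (lookup_eq_some_iff_mem hr _ _).2 hp
  · rw [reads_getElem?_eq_some, lookup_eq_some_iff_mem hr] at ht
    exact h _ ht

/-- The effect of a list of actions. -/
def app (l : List (ℕ × Act)) (σ : Tapes) : Tapes := fun t =>
  match l.lookup t with
  | none => σ t
  | some a => actOnTape a (σ t)

@[simp] theorem app_nil (σ : Tapes) : app [] σ = σ := rfl

@[simp] theorem app_cons (t : ℕ) (a : Act) (l : List (ℕ × Act)) (σ : Tapes) :
    app ((t, a) :: l) σ = Function.update (app l σ) t (actOnTape a (σ t)) := by
  funext u
  by_cases h : u = t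
  · subst h; simp [app]
  · have hb : (u == t) = false := by simpa using h
    simp [app, List.lookup_cons, hb, Function.update_of_ne h]

theorem exec_acts (s nx : ℕ) (r : List (Option ℕ)) (l : List (ℕ × Act)) (c : Config) :
    (Instruction.mk s r nx (acts l)).exec c = ⟨nx, app l c.tape⟩ := by
  simp only [Instruction.exec, Config.mk.injEq, true_and]
  funext t
  unfold acts app
  by_cases h : t < keyBound l
  · simp only [List.getElem?_map, List.getElem?_range h, Option.map_some]
    cases l.lookup t <;> rfl
  · rw [lookup_eq_none_of_keyBound_le l t (by omega)]
    rw [List.getElem?_eq_none (by simpa using h)]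

theorem applies_nil (s nx : ℕ) (a : List Act) (c : Config) :
    (Instruction.mk s [] nx a).Applies c ↔ s = c.state := by
  rw [Instruction.applies_iff]; simp

theorem exec_nil (s nx : ℕ) (r : List (Option ℕ)) (c : Config) :
    (Instruction.mk s r nx []).exec c = ⟨nx, c.tape⟩ := by
  simp [Instruction.exec]

/-! ### The basic fragments -/

/-- A single unconditional instruction. -/
def act (l : List (ℕ × Act)) : Frag where
  size := 1
  code b := [⟨b, [], b + 1, acts l⟩]
  mem_range b I hI := by
    rw [List.mem_singleton] at hI
    subst hI; simp

theorem runs_act (l : List (ℕ × Act)) (σ : Tapes) : (act l).Runs σ (app l σ) 1 := fun b L hL => by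
  refine ⟨1, le_rfl, ?_⟩
  have h := hL ⟨b, σ⟩ le_rfl (by simp [act])
  rw [Machine.run, h]
  simp [Machine.run, Machine.step, act, applies_nil, exec_acts]

/-- A condition on the scanned symbols, and what to do if it holds. -/
abbrev Rule := List (ℕ × ℕ) × List (ℕ × Act)

/-- The result of the first applicable rule. -/
def fire : List Rule → Tapes → Option Tapes
  | [], _ => none
  | r :: rs, σ => if ∀ p ∈ r.1, (σ p.1).head = p.2 then some (app r.2 σ) else fire rs σ

/-- As long as some rule is applicable, execute the first such rule. -/
def loop (rs : List Rule) : Frag where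
  size := 1
  code b := rs.map (fun r => ⟨b, reads r.1, b, acts r.2⟩) ++ [⟨b, [], b + 1, []⟩]
  mem_range b I hI := by
    rcases List.mem_append.1 hI with h | h
    · obtain ⟨r, -, rfl⟩ := List.mem_map.1 h
      simp
    · rw [List.mem_singleton] at h
      subst h; simp

/-- No condition of a rule mentions a tape twice. -/
def ProperRules (rs : List Rule) : Prop := ∀ r ∈ rs, (r.1.map Prod.fst).Nodup

/-- The first-match search runs through the rules in the same order as `fire`; the unconditional
exit comes last and is reached only if every rule fails. -/
theorem loop_step {rs : List Rule} (hrs : ProperRules rs) (b : ℕ) (σ : Tapes) :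
    ((loop rs).code b).step ⟨b, σ⟩ =
      match fire rs σ with
      | none => some ⟨b + 1, σ⟩
      | some σ' => some ⟨b, σ'⟩ := by
  simp only [loop]
  induction rs with
  | nil => simp [Machine.step, fire, applies_nil, exec_nil]
  | cons r rs ih =>
    have ih := ih fun r hr => hrs r (List.mem_cons_of_mem _ hr)
    have h1 := applies_reads (hrs r List.mem_cons_self) b b (acts r.2) ⟨b, σ⟩
    simp only [true_and] at h1
    simp only [fire, Machine.step, List.map_cons, List.cons_append, List.find?_cons] at ih ⊢
    by_cases h : ∀ p ∈ r.1, (σ p.1).head = p.2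
    · simp only [if_pos h, decide_eq_true (h1.2 h), Option.map_some, exec_acts]
    · rw [if_neg h, ← ih, decide_eq_false (fun hc => h (h1.1 hc))]

theorem runs_loop_none {rs : List Rule} (hrs : ProperRules rs) {σ : Tapes} (h : fire rs σ = none) :
    (loop rs).Runs σ σ 1 := fun b L hL => by
  refine ⟨1, le_rfl, ?_⟩
  have h1 := hL ⟨b, σ⟩ le_rfl (by simp [loop])
  rw [loop_step hrs, h] at h1
  simp [Machine.run, h1, loop]

theorem runs_loop_some {rs : List Rule} (hrs : ProperRules rs) {σ σ' σ'' : Tapes} {T : ℕ}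
    (h : fire rs σ = some σ') (hr : (loop rs).Runs σ' σ'' T) :
    (loop rs).Runs σ σ'' (T + 1) := fun b L hL => by
  obtain ⟨t, ht, hr⟩ := hr b L hL
  refine ⟨t + 1, by omega, ?_⟩
  have h1 := hL ⟨b, σ⟩ le_rfl (by simp [loop])
  rw [loop_step hrs, h] at h1
  simp [Machine.run, h1, hr]

/-- If the head of tape `t` scans `a`, then `F`, else nothing. -/
def when (t a : ℕ) (F : Frag) : Frag where
  size := F.size + 1
  code b := [⟨b, reads [(t, a)], b + 1, []⟩, ⟨b, [], b + 1 + F.size, []⟩] ++ F.code (b + 1)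
  mem_range b I hI := by
    rcases List.mem_append.1 hI with h | h
    · simp only [List.mem_cons, List.not_mem_nil, or_false] at h
      rcases h with rfl | rfl <;> simp
    · have := F.mem_range _ _ h; omega

theorem branch_step (t a b x y : ℕ) (σ : Tapes) :
    Machine.step [⟨b, reads [(t, a)], x, []⟩, ⟨b, [], y, []⟩] ⟨b, σ⟩ =
      some ⟨if (σ t).head = a then x else y, σ⟩ := by
  have h1 := applies_reads (r := [(t, a)]) (by simp) b x [] ⟨b, σ⟩
  simp only [true_and, List.mem_singleton, forall_eq] at h1
  by_cases h : (σ t).head = a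
  · simp [Machine.step, h1, h, exec_nil]
  · simp [Machine.step, h1, h, exec_nil, applies_nil]

theorem when_step {t a b : ℕ} {F : Frag} {L : Machine} (hL : (when t a F).Embeds b L) (σ : Tapes) :
    L.step ⟨b, σ⟩ = some ⟨if (σ t).head = a then b + 1 else b + 1 + F.size, σ⟩ := by
  rw [hL ⟨b, σ⟩ le_rfl (by simp [when]), when, Machine.step_append_of_left, branch_step]
  intro I hI
  have := F.mem_range _ _ hI
  simp only; omega

theorem Frag.Embeds.when {t a b : ℕ} {F : Frag} {L : Machine} (hL : (when t a F).Embeds b L) :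
    F.Embeds (b + 1) L := fun c h1 h2 => by
  rw [hL c (by omega) (by simp only [EffectiveCount.when]; omega)]
  refine Machine.step_append_of_right _ _ _ fun I hI => ?_
  simp only [List.mem_cons, List.not_mem_nil, or_false] at hI
  rcases hI with rfl | rfl <;> simp only <;> omega

theorem runs_when_pos {t a : ℕ} {F : Frag} {σ σ' : Tapes} {T : ℕ} (h : (σ t).head = a)
    (hF : F.Runs σ σ' T) : (when t a F).Runs σ σ' (T + 1) := fun b L hL => by
  obtain ⟨s, hs, hr⟩ := hF _ _ hL.when
  refine ⟨s + 1, by omega, ?_⟩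
  simp only [Machine.run, when_step hL, if_pos h, Option.bind_some, hr, when, Nat.add_assoc,
    Nat.add_comm F.size 1]

theorem runs_when_neg {t a : ℕ} {F : Frag} {σ : Tapes} (h : (σ t).head ≠ a) :
    (when t a F).Runs σ σ 1 := fun b L hL => by
  refine ⟨1, le_rfl, ?_⟩
  simp only [Machine.run, when_step hL, if_neg h, Option.bind_some, when, Nat.add_assoc,
    Nat.add_comm F.size 1]

/-- While the head of tape `t` scans `a`, do `F`. -/
def while_ (t a : ℕ) (F : Frag) : Frag where
  size := F.size + 2
  code b := [⟨b, reads [(t, a)], b + 1, []⟩, ⟨b, [], b + (F.size + 2), []⟩] ++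
    (F.code (b + 1) ++ [⟨b + 1 + F.size, [], b, []⟩])
  mem_range b I hI := by
    rcases List.mem_append.1 hI with h | h
    · simp only [List.mem_cons, List.not_mem_nil, or_false] at h
      rcases h with rfl | rfl <;> simp
    · rcases List.mem_append.1 h with h | h
      · have := F.mem_range _ _ h; omega
      · rw [List.mem_singleton] at h
        subst h; simp only; omega

theorem while_step {t a b : ℕ} {F : Frag} {L : Machine} (hL : (while_ t a F).Embeds b L)
    (σ : Tapes) :
    L.step ⟨b, σ⟩ = some ⟨if (σ t).head = a then b + 1 else b + (F.size + 2), σ⟩ := by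
  rw [hL ⟨b, σ⟩ le_rfl (by simp [while_]), while_, Machine.step_append_of_left, branch_step]
  intro I hI
  rcases List.mem_append.1 hI with h | h
  · have := F.mem_range _ _ h
    simp only; omega
  · rw [List.mem_singleton] at h
    subst h; simp only; omega

theorem while_step_back {t a b : ℕ} {F : Frag} {L : Machine} (hL : (while_ t a F).Embeds b L)
    (σ : Tapes) : L.step ⟨b + 1 + F.size, σ⟩ = some ⟨b, σ⟩ := by
  rw [hL _ (by simp only; omega) (by simp only [while_]; omega), while_,
    Machine.step_append_of_right, Machine.step_append_of_right]
  · simp [Machine.step, applies_nil, exec_nil]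
  · intro I hI
    have := F.mem_range _ _ hI
    simp only; omega
  · intro I hI
    simp only [List.mem_cons, List.not_mem_nil, or_false] at hI
    rcases hI with rfl | rfl <;> simp only <;> omega

theorem Frag.Embeds.while {t a b : ℕ} {F : Frag} {L : Machine} (hL : (while_ t a F).Embeds b L) :
    F.Embeds (b + 1) L := fun c h1 h2 => by
  rw [hL c (by omega) (by simp only [while_]; omega), while_, Machine.step_append_of_right,
    Machine.step_append_of_left]
  · intro I hI
    rw [List.mem_singleton] at hI
    subst hI; simp only; omega
  · intro I hI
    simp only [List.mem_cons, List.not_mem_nil, or_false] at hI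
    rcases hI with rfl | rfl <;> simp only <;> omega

theorem runs_while_neg {t a : ℕ} {F : Frag} {σ : Tapes} (h : (σ t).head ≠ a) :
    (while_ t a F).Runs σ σ 1 := fun b L hL => by
  refine ⟨1, le_rfl, ?_⟩
  simp only [Machine.run, while_step hL, if_neg h, Option.bind_some, while_]

theorem runs_while_pos {t a : ℕ} {F : Frag} {σ σ' σ'' : Tapes} {T T' : ℕ} (h : (σ t).head = a)
    (hF : F.Runs σ σ' T) (hr : (while_ t a F).Runs σ' σ'' T') :
    (while_ t a F).Runs σ σ'' (T + 2 + T') := fun b L hL => by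
  obtain ⟨s, hs, hr1⟩ := hF _ _ hL.while
  obtain ⟨s', hs', hr2⟩ := hr _ _ hL
  refine ⟨1 + s + 1 + s', by omega, ?_⟩
  rw [Machine.run_add, Machine.run_add, Machine.run_add]
  simp only [Machine.run, while_step hL, if_pos h, Option.bind_some, hr1, while_step_back hL, hr2]

/-- A loop with `N` rounds and an invariant. -/
theorem runs_while_invariant {t a N T : ℕ} {F : Frag} (I : ℕ → Tapes → Prop)
    (hstep : ∀ k < N, ∀ σ, I k σ → (σ t).head = a ∧ ∃ σ', F.Runs σ σ' T ∧ I (k + 1) σ')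
    (hexit : ∀ σ, I N σ → (σ t).head ≠ a) {σ : Tapes} (h0 : I 0 σ) :
    ∃ σ', (while_ t a F).Runs σ σ' (N * (T + 2) + 1) ∧ I N σ' := by
  -- Induction on the number `m` of rounds still to come. Each round costs two steps beyond the
  -- body: the test and the jump back.
  suffices H : ∀ m k, k + m = N → ∀ σ, I k σ →
      ∃ σ', (while_ t a F).Runs σ σ' (m * (T + 2) + 1) ∧ I N σ' from H N 0 (by omega) σ h0
  intro m
  induction m with
  | zero =>
    intro k hk σ hσ
    obtain rfl : k = N := by omega
    exact ⟨σ, (runs_while_neg (hexit σ hσ)).mono (by omega), hσ⟩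
  | succ m ih =>
    intro k hk σ hσ
    obtain ⟨hh, σ', hr, hI⟩ := hstep k (by omega) σ hσ
    obtain ⟨σ'', hr', hI'⟩ := ih (k + 1) (by omega) σ' hI
    refine ⟨σ'', (runs_while_pos hh hr hr').mono ?_, hI'⟩
    rw [Nat.succ_mul]; omega

/-- A loop with `N` rounds and prescribed intermediate tapes. -/
theorem runs_while_family {t a N T : ℕ} {F : Frag} (s : ℕ → Tapes)
    (hhead : ∀ k < N, (s k t).head = a) (hstep : ∀ k < N, F.Runs (s k) (s (k + 1)) T)
    (hexit : (s N t).head ≠ a) : (while_ t a F).Runs (s 0) (s N) (N * (T + 2) + 1) := by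
  obtain ⟨σ', h, rfl⟩ := runs_while_invariant (t := t) (a := a) (N := N) (T := T) (F := F)
    (fun k σ => σ = s k) (fun k hk σ hσ => by subst hσ; exact ⟨hhead k hk, _, hstep k hk, rfl⟩)
    (fun σ hσ => by subst hσ; exact hexit) rfl
  exact h

/-! ### Tapes with numbered entries -/

/-- The tapes `a`, `σ 0`, `σ 1`, … -/
def tcons (a : Tape ℕ) (σ : Tapes) : Tapes
  | 0 => a
  | t + 1 => σ t

infixr:55 " ◁ " => tcons

@[simp] theorem tcons_zero (a : Tape ℕ) (σ : Tapes) : (a ◁ σ) 0 = a := rfl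

@[simp] theorem tcons_succ (a : Tape ℕ) (σ : Tapes) (t : ℕ) : (a ◁ σ) (t + 1) = σ t := rfl

@[simp] theorem update_tcons_zero (a x : Tape ℕ) (σ : Tapes) :
    Function.update (a ◁ σ) 0 x = x ◁ σ := by
  funext t; cases t <;> simp

@[simp] theorem update_tcons_succ (a x : Tape ℕ) (σ : Tapes) (t : ℕ) :
    Function.update (a ◁ σ) (t + 1) x = a ◁ Function.update σ t x := by
  funext u
  cases u with
  | zero => simp
  | succ u =>
    by_cases h : u = t
    · subst h; simp
    · simp [Function.update_of_ne h, Function.update_of_ne (show u + 1 ≠ t + 1 by omega)]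

/-! ### Actions on a single tape -/

/-- Move right. -/
def stepR : Act := (none, some Dir.right)
/-- Move left. -/
def stepL : Act := (none, some Dir.left)
/-- Write a symbol. -/
def put (a : ℕ) : Act := (some a, none)
/-- Write a symbol and move right. -/
def putR (a : ℕ) : Act := (some a, some Dir.right)
/-- Write a symbol and move left. -/
def putL (a : ℕ) : Act := (some a, some Dir.left)

@[simp] theorem act_stepR (T : Tape ℕ) : actOnTape stepR T = T.move Dir.right := rfl
@[simp] theorem act_stepL (T : Tape ℕ) : actOnTape stepL T = T.move Dir.left := rfl
@[simp] theorem act_put (a : ℕ) (T : Tape ℕ) : actOnTape (put a) T = T.write a := rfl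
@[simp] theorem act_putR (a : ℕ) (T : Tape ℕ) :
    actOnTape (putR a) T = (T.write a).move Dir.right := rfl
@[simp] theorem act_putL (a : ℕ) (T : Tape ℕ) :
    actOnTape (putL a) T = (T.write a).move Dir.left := rfl

theorem app_update_pair {s t : ℕ} (h : s ≠ t) (x y : Act) (σ : Tapes) (A B : Tape ℕ) :
    app [(s, x), (t, y)] (Function.update (Function.update σ s A) t B) =
      Function.update (Function.update σ s (actOnTape x A)) t (actOnTape y B) := by
  funext u
  by_cases h1 : u = s
  · subst h1; simp [Function.update_of_ne h]
  · by_cases h2 : u = t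
    · subst h2; simp [Function.update_of_ne h1]
    · simp [Function.update_of_ne h1, Function.update_of_ne h2]

theorem app_update_triple {s t v : ℕ} (h : s ≠ t) (h' : s ≠ v) (h'' : t ≠ v) (x y z : Act)
    (σ : Tapes) (A B C : Tape ℕ) :
    app [(s, x), (t, y), (v, z)]
      (Function.update (Function.update (Function.update σ s A) t B) v C) =
      Function.update (Function.update (Function.update σ s (actOnTape x A)) t (actOnTape y B)) v
        (actOnTape z C) := by
  funext u
  by_cases h1 : u = s
  · subst h1; simp [Function.update_of_ne h, Function.update_of_ne h']
  · by_cases h2 : u = t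
    · subst h2; simp [Function.update_of_ne h1, Function.update_of_ne h'']
    · by_cases h3 : u = v
      · subst h3; simp [Function.update_of_ne h1, Function.update_of_ne h2]
      · simp [Function.update_of_ne h1, Function.update_of_ne h2, Function.update_of_ne h3]

/-! ### Words -/

/-- A word in the symbols `1` and `2`. -/
def IsWord (w : List ℕ) : Prop := ∀ x ∈ w, x = 1 ∨ x = 2

@[simp] theorem isWord_nil : IsWord [] := by simp [IsWord]

@[simp] theorem isWord_cons {a : ℕ} {w : List ℕ} :
    IsWord (a :: w) ↔ (a = 1 ∨ a = 2) ∧ IsWord w := by simp [IsWord]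

@[simp] theorem isWord_reverse {w : List ℕ} : IsWord w.reverse ↔ IsWord w := by simp [IsWord]

theorem isWord_replicate {a : ℕ} (ha : a = 1 ∨ a = 2) (k : ℕ) : IsWord (List.replicate k a) := by
  intro x hx
  rw [List.eq_of_mem_replicate hx]; exact ha

@[simp] theorem isWord_ones (k : ℕ) : IsWord (List.replicate k 1) := isWord_replicate (Or.inl rfl) k
@[simp] theorem isWord_twos (k : ℕ) : IsWord (List.replicate k 2) := isWord_replicate (Or.inr rfl) k

theorem replicate_append_cons (k a : ℕ) (l : List ℕ) :
    List.replicate k a ++ a :: l = List.replicate (k + 1) a ++ l := by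
  rw [List.replicate_succ', List.append_assoc]; rfl

@[simp] theorem natWord_zero : natWord 0 = [] := rfl

theorem natWord_of_pos {k : ℕ} (hk : 0 < k) : natWord k = (k % 2 + 1) :: natWord (k / 2) := by
  unfold natWord
  rw [Nat.digits_def' one_lt_two hk]; rfl

theorem isWord_natWord (k : ℕ) : IsWord (natWord k) := by
  induction k using Nat.strong_induction_on with
  | _ k ih =>
    rcases Nat.eq_zero_or_pos k with rfl | hk
    · simp
    · rw [natWord_of_pos hk, isWord_cons]
      exact ⟨by omega, ih _ (by omega)⟩

theorem length_natWord_le (k : ℕ) : (natWord k).length ≤ k := by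
  induction k using Nat.strong_induction_on with
  | _ k ih =>
    rcases Nat.eq_zero_or_pos k with rfl | hk
    · simp
    · rw [natWord_of_pos hk, List.length_cons]
      have := ih (k / 2) (by omega)
      omega

/-- The `p` lowest binary digits of `x`, as a word. -/
def bits : ℕ → ℕ → List ℕ
  | 0, _ => []
  | p + 1, x => (x % 2 + 1) :: bits p (x / 2)

theorem isWord_bits (p x : ℕ) : IsWord (bits p x) := by
  induction p generalizing x with
  | zero => simp [bits]
  | succ p ih => simp only [bits, isWord_cons]; exact ⟨by omega, ih _⟩

@[simp] theorem length_bits (p x : ℕ) : (bits p x).length = p := by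
  induction p generalizing x with
  | zero => rfl
  | succ p ih => simp [bits, ih]

theorem bits_zero_right (p : ℕ) : bits p 0 = List.replicate p 1 := by
  induction p with
  | zero => rfl
  | succ p ih => simp [bits, ih, List.replicate_succ]

theorem bits_mul_two_pow (s p x : ℕ) :
    bits (s + p) (x * 2 ^ s) = List.replicate s 1 ++ bits p x := by
  induction s with
  | zero => simp
  | succ s ih =>
    rw [Nat.succ_add, bits, pow_succ, ← mul_assoc, Nat.mul_mod_left, Nat.mul_div_cancel _ two_pos,
      ih, List.replicate_succ]
    rfl

theorem bits_eq_natWord_append (p x : ℕ) (hx : x < 2 ^ p) :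
    ∃ k, bits p x = natWord x ++ List.replicate k 1 := by
  induction p generalizing x with
  | zero =>
    obtain rfl : x = 0 := by simpa using hx
    exact ⟨0, rfl⟩
  | succ p ih =>
    rcases Nat.eq_zero_or_pos x with rfl | h
    · exact ⟨p + 1, by rw [bits_zero_right]; rfl⟩
    · obtain ⟨k, hk⟩ := ih (x / 2) (by rw [pow_succ] at hx; omega)
      exact ⟨k, by rw [bits, hk, natWord_of_pos h]; rfl⟩

theorem natWord_eq_bits (x : ℕ) : ∃ p, natWord x = bits p x ∧ x < 2 ^ p ∧ p ≤ x := by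
  induction x using Nat.strong_induction_on with
  | _ x ih =>
    rcases Nat.eq_zero_or_pos x with rfl | h
    · exact ⟨0, rfl, by simp, le_rfl⟩
    · obtain ⟨p, hp, hx, hle⟩ := ih (x / 2) (by omega)
      exact ⟨p + 1, by rw [bits, ← hp, natWord_of_pos h], by rw [pow_succ]; omega, by omega⟩

theorem natWord_eq_append_two {x : ℕ} (hx : 0 < x) : ∃ u, natWord x = u ++ [2] := by
  induction x using Nat.strong_induction_on with
  | _ x ih =>
    rw [natWord_of_pos hx]
    rcases Nat.eq_zero_or_pos (x / 2) with h | h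
    · obtain rfl : x = 1 := by omega
      exact ⟨[], rfl⟩
    · obtain ⟨u, hu⟩ := ih _ (by omega) h
      exact ⟨(x % 2 + 1) :: u, by rw [hu]; rfl⟩

/-! ### Moving heads back to the start -/

/-- Moves the head of tape `t` to the first symbol of a word. -/
def rewind (t : ℕ) : Frag :=
  act [(t, stepL)] ⨟ loop [([(t, 1)], [(t, stepL)]), ([(t, 2)], [(t, stepL)])] ⨟ act [(t, stepR)]

theorem runs_loop_left (t : ℕ) (u : List ℕ) (hu : IsWord u) (a : ℕ) (ha : a = 1 ∨ a = 2)
    (r : List ℕ) (σ : Tapes) :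
    (loop [([(t, 1)], [(t, stepL)]), ([(t, 2)], [(t, stepL)])]).Runs
      (Function.update σ t (zip u (a :: r)))
      (Function.update σ t (zip [] (0 :: (u.reverse ++ a :: r)))) (u.length + 2) := by
  have hp : ProperRules [([(t, 1)], [(t, stepL)]), ([(t, 2)], [(t, stepL)])] := by
    simp [ProperRules]
  induction u generalizing a r with
  | nil =>
    refine runs_loop_some hp (σ' := Function.update σ t (zip [] (0 :: a :: r))) ?_
      (runs_loop_none hp ?_)
    · rcases ha with rfl | rfl <;> simp [fire]
    · simp [fire]
  | cons b u ih =>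
    rw [isWord_cons] at hu
    have h := ih hu.2 b hu.1 (a :: r)
    rw [List.reverse_cons, List.append_assoc]
    refine runs_loop_some hp ?_ h
    rcases ha with rfl | rfl <;> simp [fire]

/-- The head stops on the blank to the left of the word and then steps right once. Only the symbols
`1` and `2` are passed, so the part `u` left of the head must be free of blanks and separators; `r`
is arbitrary. -/
theorem runs_rewind (t : ℕ) (u r : List ℕ) (hu : IsWord u) (σ : Tapes) (h : σ t = zip u r) :
    (rewind t).Runs σ (Function.update σ t (zip [] (u.reverse ++ r))) (u.length + 3) := by
  have h1 := runs_act [(t, stepL)] σ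
  cases u with
  | nil =>
    simp only [app_cons, app_nil, h, act_stepL, zip_move_left_nil] at h1
    have h2 : (loop [([(t, 1)], [(t, stepL)]), ([(t, 2)], [(t, stepL)])]).Runs _ _ 1 :=
      runs_loop_none (by simp [ProperRules])
        (σ := Function.update σ t (zip [] (0 :: r))) (by simp [fire])
    have h3 := runs_act [(t, stepR)] (Function.update σ t (zip [] (0 :: r)))
    simp only [app_cons, app_nil, Function.update_self, act_stepR, zip_move_right_cons,
      Function.update_idem, zip_zero_left] at h3
    exact (h1.seq (h2.seq h3)).mono (by simp)
  | cons a u =>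
    rw [isWord_cons] at hu
    simp only [app_cons, app_nil, h, act_stepL, zip_move_left_cons] at h1
    have h2 := runs_loop_left t u hu.2 a hu.1 r σ
    have h3 := runs_act [(t, stepR)]
      (Function.update σ t (zip [] (0 :: (u.reverse ++ a :: r))))
    simp only [app_cons, app_nil, Function.update_self, act_stepR, zip_move_right_cons,
      Function.update_idem, zip_zero_left] at h3
    have h := (h1.seq (h2.seq h3)).mono (T' := (a :: u).length + 3) (by simp; omega)
    simpa [rewind] using h

/-- Moves the heads of the tapes `s` and `t` to the left end of a block of `1`s on `t`. -/
def rewindPair (s t : ℕ) : Frag :=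
  act [(s, stepL), (t, stepL)] ⨟ loop [([(t, 1)], [(s, stepL), (t, stepL)])] ⨟
    act [(s, stepR), (t, stepR)]

theorem runs_loop_left_pair {s t : ℕ} (hst : s ≠ t) (l : List ℕ) (a : ℕ) (r : List ℕ) (k : ℕ)
    (σ : Tapes) :
    (loop [([(t, 1)], [(s, stepL), (t, stepL)])]).Runs
      (Function.update (Function.update σ s (zip l (a :: r))) t
        (zip (List.replicate l.length 1) (1 :: List.replicate k 1)))
      (Function.update (Function.update σ s (zip [] (0 :: (l.reverse ++ a :: r)))) t
        (zip [] (0 :: List.replicate (l.length + 1 + k) 1))) (l.length + 2) := by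
  have hp : ProperRules [([(t, 1)], [(s, stepL), (t, stepL)])] := by simp [ProperRules]
  induction l generalizing a r k with
  | nil =>
    refine runs_loop_some hp (σ' := Function.update (Function.update σ s (zip [] (0 :: a :: r))) t
        (zip [] (0 :: List.replicate (0 + 1 + k) 1))) ?_ (runs_loop_none hp ?_)
    · simp only [fire, List.mem_singleton, forall_eq, Function.update_self, List.length_nil,
        zip_head_cons, if_true, app_update_pair hst, act_stepL, List.replicate_zero,
        zip_move_left_nil, Nat.zero_add, Nat.add_comm 1 k, List.replicate_succ]
    · simp [fire]
  | cons b l ih =>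
    have h := ih b (a :: r) (k + 1)
    rw [show l.length + 1 + (k + 1) = (b :: l).length + 1 + k by simp; omega] at h
    rw [List.reverse_cons, List.append_assoc]
    refine runs_loop_some hp ?_ h
    simp only [fire, List.mem_singleton, forall_eq, Function.update_self, List.length_cons,
        zip_head_cons, if_true, app_update_pair hst, act_stepL, List.replicate_succ,
        zip_move_left_cons]

/-- Only the marks on `t` are inspected, so the word on `s` may contain any symbols, including
blanks and separators. -/
theorem runs_rewindPair {s t : ℕ} (hst : s ≠ t) (l r : List ℕ) (σ : Tapes) (hs : σ s = zip l r)
    (ht : σ t = zip (List.replicate l.length 1) (List.replicate r.length 1)) :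
    (rewindPair s t).Runs σ (Function.update (Function.update σ s (zip [] (l.reverse ++ r))) t
      (zip [] (List.replicate (l.length + r.length) 1))) (l.length + 3) := by
  have h1 := runs_act [(s, stepL), (t, stepL)] σ
  have hσ : σ = Function.update (Function.update σ s (zip l r)) t
      (zip (List.replicate l.length 1) (List.replicate r.length 1)) := by
    rw [← ht, ← hs, Function.update_eq_self, Function.update_eq_self]
  rw [show app [(s, stepL), (t, stepL)] σ = app [(s, stepL), (t, stepL)] (Function.update
    (Function.update σ s (zip l r)) t
      (zip (List.replicate l.length 1) (List.replicate r.length 1))) by rw [← hσ],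
    app_update_pair hst] at h1
  cases l with
  | nil =>
    simp only [act_stepL, List.length_nil, List.replicate_zero, zip_move_left_nil] at h1
    have h2 : (loop [([(t, 1)], [(s, stepL), (t, stepL)])]).Runs _ _ 1 :=
      runs_loop_none (by simp [ProperRules]) (σ := Function.update (Function.update σ s
        (zip [] (0 :: r))) t (zip [] (0 :: List.replicate r.length 1))) (by simp [fire])
    have h3 := runs_act [(s, stepR), (t, stepR)] (Function.update (Function.update σ s
        (zip [] (0 :: r))) t (zip [] (0 :: List.replicate r.length 1)))
    rw [app_update_pair hst] at h3
    simp only [act_stepR, zip_move_right_cons, zip_zero_left] at h3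
    simpa [rewindPair] using h1.seq (h2.seq h3)
  | cons a l =>
    simp only [act_stepL, List.length_cons, List.replicate_succ, zip_move_left_cons] at h1
    have h2 := runs_loop_left_pair hst l a r r.length σ
    have h3 := runs_act [(s, stepR), (t, stepR)] (Function.update (Function.update σ s
        (zip [] (0 :: (l.reverse ++ a :: r)))) t
        (zip [] (0 :: List.replicate (l.length + 1 + r.length) 1)))
    rw [app_update_pair hst] at h3
    simp only [act_stepR, zip_move_right_cons, zip_zero_left] at h3
    have h := (h1.seq (h2.seq h3)).mono (T' := (a :: l).length + 3) (by simp; omega)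
    simpa [rewindPair] using h

/-! ### Binary counters -/

/-- Adds one to the number on tape `t`. -/
def inc (t : ℕ) : Frag :=
  loop [([(t, 2)], [(t, putR 1)])] ⨟ act [(t, put 2)] ⨟ rewind t

/-- The carry turns the initial digits one into zeros and stops at a digit zero or at the blank
behind the word. Both cases are covered by fixing only `r.tail`: the cell under the head is
overwritten next. -/
theorem runs_loop_inc (t k : ℕ) (l : List ℕ) (σ : Tapes) :
    ∃ s w, natWord (k + 1) = List.replicate s 1 ++ 2 :: w ∧
      ∃ r, r.tail = w ∧ (loop [([(t, 2)], [(t, putR 1)])]).Runs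
        (Function.update σ t (zip l (natWord k)))
        (Function.update σ t (zip (List.replicate s 1 ++ l) r)) (s + 1) := by
  have hp : ProperRules [([(t, 2)], [(t, putR 1)])] := by simp [ProperRules]
  induction k using Nat.strong_induction_on generalizing l with
  | _ k ih =>
    rcases Nat.eq_zero_or_pos k with rfl | hk
    · exact ⟨0, [], rfl, [], rfl, runs_loop_none hp (by simp [fire])⟩
    · rcases Nat.mod_two_eq_zero_or_one k with h | h
      · refine ⟨0, natWord (k / 2), ?_, natWord k, ?_, runs_loop_none hp ?_⟩
        · rw [natWord_of_pos (Nat.succ_pos k), show (k + 1) % 2 = 1 by omega,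
            show (k + 1) / 2 = k / 2 by omega]
          rfl
        · rw [natWord_of_pos hk]; rfl
        · simp [fire, natWord_of_pos hk, h]
      · obtain ⟨s, w, hw, r, hr, hrun⟩ := ih (k / 2) (by omega) (1 :: l)
        refine ⟨s + 1, w, ?_, r, hr, ?_⟩
        · rw [natWord_of_pos (Nat.succ_pos k), show (k + 1) % 2 = 0 by omega,
            show (k + 1) / 2 = k / 2 + 1 by omega, hw]
          rfl
        · rw [replicate_append_cons] at hrun
          refine runs_loop_some hp ?_ hrun
          simp [fire, natWord_of_pos hk, h]

theorem zip_write (l r : List ℕ) (a : ℕ) : (zip l r).write a = zip l (a :: r.tail) := by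
  cases r <;> simp

theorem runs_inc (t k : ℕ) (σ : Tapes) (h : σ t = zip [] (natWord k)) :
    (inc t).Runs σ (Function.update σ t (zip [] (natWord (k + 1)))) (2 * k + 8) := by
  obtain ⟨s, w, hw, r, hr, h1⟩ := runs_loop_inc t k [] σ
  rw [← h, Function.update_eq_self] at h1
  have h2 := runs_act [(t, put 2)] (Function.update σ t (zip (List.replicate s 1 ++ []) r))
  simp only [List.append_nil, app_cons, app_nil, Function.update_self, act_put, zip_write, hr,
    Function.update_idem] at h1 h2
  have h3 := runs_rewind t _ (2 :: w) (isWord_ones s)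
    (Function.update σ t (zip (List.replicate s 1) (2 :: w))) (by simp)
  rw [Function.update_idem, List.reverse_replicate, ← hw] at h3
  have hl := length_natWord_le (k + 1)
  rw [hw] at hl
  simp only [List.length_append, List.length_replicate, List.length_cons] at hl h3
  exact (h1.seq (h2.seq h3)).mono (by omega)

/-- The borrow turns initial zeros into ones. If `x > 0` it stops on a digit one, still to be
cleared; if `x = 0` it runs off the word. The symbol finally scanned thus doubles as a test for
zero. The width `p` is fixed because decrementing may create leading zeros. -/
theorem runs_loop_dec (t p x : ℕ) (hx : x < 2 ^ p) (l : List ℕ) (σ : Tapes) :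
    ∃ s w, (0 < x → bits p (x - 1) = List.replicate s 2 ++ 1 :: w) ∧
      ∃ r, (0 < x → r = 2 :: w) ∧ (x = 0 → r = []) ∧ s ≤ p ∧
        (loop [([(t, 1)], [(t, putR 2)])]).Runs
          (Function.update σ t (zip l (bits p x)))
          (Function.update σ t (zip (List.replicate s 2 ++ l) r)) (s + 1) := by
  have hp : ProperRules [([(t, 1)], [(t, putR 2)])] := by simp [ProperRules]
  induction p generalizing x l with
  | zero =>
    obtain rfl : x = 0 := by simpa using hx
    exact ⟨0, [], by simp, [], by simp, by simp, le_rfl, runs_loop_none hp (by simp [fire, bits])⟩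
  | succ p ih =>
    rcases Nat.mod_two_eq_zero_or_one x with h | h
    · obtain ⟨s, w, hw, r, hr, hr0, hs, hrun⟩ := ih (x / 2) (by rw [pow_succ] at hx; omega) (2 :: l)
      refine ⟨s + 1, w, fun h0 => ?_, r, fun h0 => hr (by omega), fun h0 => hr0 (by omega),
        by omega, ?_⟩
      · rw [bits, show (x - 1) % 2 = 1 by omega, show (x - 1) / 2 = x / 2 - 1 by omega,
          hw (by omega)]
        rfl
      · rw [replicate_append_cons] at hrun
        refine runs_loop_some hp ?_ hrun
        simp [fire, bits, h]
    · refine ⟨0, bits p (x / 2), fun h0 => ?_, bits (p + 1) x, fun h0 => ?_, fun h0 => by omega,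
        by omega, runs_loop_none hp ?_⟩
      · rw [bits, show (x - 1) % 2 = 0 by omega, show (x - 1) / 2 = x / 2 by omega]
        rfl
      · rw [bits, h]
      · simp [fire, bits, h]

/-! ### Erasing and copying -/

/-- Erases a word on tape `t`. -/
def erase (t : ℕ) : Frag := loop [([(t, 1)], [(t, putR 0)]), ([(t, 2)], [(t, putR 0)])]

theorem runs_erase (t : ℕ) (w : List ℕ) (hw : IsWord w) (σ : Tapes) (h : σ t = zip [] w) :
    (erase t).Runs σ (Function.update σ t blank) (w.length + 1) := by
  have hp : ProperRules [([(t, 1)], [(t, putR 0)]), ([(t, 2)], [(t, putR 0)])] := by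
    simp [ProperRules]
  suffices H : (erase t).Runs (Function.update σ t (zip [] w)) (Function.update σ t blank)
      (w.length + 1) by
    simpa [← h] using H
  clear h
  induction w with
  | nil => exact runs_loop_none hp (by simp [fire])
  | cons a w ih =>
    rw [isWord_cons] at hw
    refine runs_loop_some hp ?_ (ih hw.2)
    rcases hw.1 with rfl | rfl <;> simp [fire]

/-- Moves the head of tape `s` over a block of `1`s, printing `1`s on tape `t`. -/
def transfer (s t : ℕ) : Frag := loop [([(s, 1)], [(s, stepR), (t, putR 1)])]

theorem runs_transfer {s t : ℕ} (hst : s ≠ t) (k : ℕ) (l u : List ℕ) (σ : Tapes)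
    (hs : σ s = zip l (List.replicate k 1)) (ht : σ t = zip u []) :
    (transfer s t).Runs σ (Function.update (Function.update σ s (zip (List.replicate k 1 ++ l) []))
      t (zip (List.replicate k 1 ++ u) [])) (k + 1) := by
  have hp : ProperRules [([(s, 1)], [(s, stepR), (t, putR 1)])] := by simp [ProperRules]
  suffices H : ∀ l u, (transfer s t).Runs
      (Function.update (Function.update σ s (zip l (List.replicate k 1))) t (zip u []))
      (Function.update (Function.update σ s (zip (List.replicate k 1 ++ l) []))
      t (zip (List.replicate k 1 ++ u) [])) (k + 1) by
    simpa [← hs, ← ht] using H l u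
  clear hs ht l u
  induction k with
  | zero =>
    intro l u
    exact runs_loop_none hp (by simp [fire, Function.update_of_ne hst])
  | succ k ih =>
    intro l u
    have h := ih (1 :: l) (1 :: u)
    rw [replicate_append_cons, replicate_append_cons] at h
    refine runs_loop_some hp ?_ h
    simp only [fire, List.mem_singleton, forall_eq, Function.update_of_ne hst,
      Function.update_self, List.replicate_succ, zip_head_cons, if_true]
    rw [app_update_pair hst]
    simp

/-- Moves the head of tape `t` over a block of `1`s. -/
def walk (t : ℕ) : Frag := loop [([(t, 1)], [(t, stepR)])]

theorem runs_walk (t k : ℕ) (l : List ℕ) (σ : Tapes) (h : σ t = zip l (List.replicate k 1)) :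
    (walk t).Runs σ (Function.update σ t (zip (List.replicate k 1 ++ l) [])) (k + 1) := by
  have hp : ProperRules [([(t, 1)], [(t, stepR)])] := by simp [ProperRules]
  suffices H : ∀ l, (walk t).Runs (Function.update σ t (zip l (List.replicate k 1)))
      (Function.update σ t (zip (List.replicate k 1 ++ l) [])) (k + 1) by
    simpa [← h] using H l
  clear h l
  induction k with
  | zero => exact fun l => runs_loop_none hp (by simp [fire])
  | succ k ih =>
    intro l
    have h := ih (1 :: l)
    rw [replicate_append_cons] at h
    refine runs_loop_some hp ?_ h
    simp [fire, List.replicate_succ]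

/-- Copies a word from tape `t` to tape `u`, and marks the cells on tape `v`. -/
def copy (t u v : ℕ) : Frag :=
  loop [([(t, 1)], [(t, stepR), (u, putR 1), (v, putR 1)]),
    ([(t, 2)], [(t, stepR), (u, putR 2), (v, putR 1)])]

theorem runs_copy {t u v : ℕ} (h1 : t ≠ u) (h2 : t ≠ v) (h3 : u ≠ v) (w : List ℕ) (hw : IsWord w)
    (l x : List ℕ) (σ : Tapes) (ht : σ t = zip l w) (hu : σ u = zip x [])
    (hv : σ v = zip (List.replicate x.length 1) []) :
    (copy t u v).Runs σ (Function.update (Function.update (Function.update σ t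
      (zip (w.reverse ++ l) [])) u (zip (w.reverse ++ x) [])) v
      (zip (List.replicate (w.reverse ++ x).length 1) [])) (w.length + 1) := by
  have hp : ProperRules [([(t, 1)], [(t, stepR), (u, putR 1), (v, putR 1)]),
    ([(t, 2)], [(t, stepR), (u, putR 2), (v, putR 1)])] := by simp [ProperRules]
  suffices H : ∀ l x, (copy t u v).Runs (Function.update (Function.update (Function.update σ t
      (zip l w)) u (zip x [])) v (zip (List.replicate x.length 1) [])) (Function.update
      (Function.update (Function.update σ t (zip (w.reverse ++ l) [])) u (zip (w.reverse ++ x) []))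
      v (zip (List.replicate (w.reverse ++ x).length 1) [])) (w.length + 1) by
    have h := H l x
    rwa [← ht, Function.update_eq_self, ← hu, Function.update_eq_self, ← hv,
      Function.update_eq_self] at h
  clear ht hu hv l x
  induction w with
  | nil =>
    intro l x
    exact runs_loop_none hp (by simp [fire, Function.update_of_ne h1, Function.update_of_ne h2])
  | cons a w ih =>
    intro l x
    rw [isWord_cons] at hw
    have h := ih hw.2 (a :: l) (a :: x)
    simp only [List.reverse_cons, List.append_assoc, List.singleton_append]
    refine runs_loop_some hp ?_ h
    rcases hw.1 with rfl | rfl <;>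
    simp only [fire, List.mem_singleton, forall_eq, Function.update_of_ne h1,
      Function.update_of_ne h2, Function.update_self, zip_head_cons, if_true,
      app_update_triple h1 h2 h3] <;> simp [List.replicate_succ]

/-! ### Shifting and moving words -/

/-- Prepends a block of `1`s, as long as the one on tape `s`, to the word on tape `t`. -/
def shift (s t : ℕ) : Frag :=
  act [(t, stepL)] ⨟ loop [([(s, 1)], [(s, stepR), (t, putL 1)])] ⨟ act [(t, stepR)] ⨟ rewind s

/-- The least significant digit comes first and the symbol `1` is the digit zero, so prepending `k`
of them multiplies by `2 ^ k`; see `bits_mul_two_pow`. -/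
theorem runs_shift {s t : ℕ} (hst : s ≠ t) (k : ℕ) (w : List ℕ) (σ : Tapes)
    (hs : σ s = zip [] (List.replicate k 1)) (ht : σ t = zip [] w) :
    (shift s t).Runs σ (Function.update σ t (zip [] (List.replicate k 1 ++ w))) (2 * k + 6) := by
  have hp : ProperRules [([(s, 1)], [(s, stepR), (t, putL 1)])] := by simp [ProperRules]
  have H : ∀ l w, (loop [([(s, 1)], [(s, stepR), (t, putL 1)])]).Runs
      (Function.update (Function.update σ s (zip l (List.replicate k 1))) t (zip [] (0 :: w)))
      (Function.update (Function.update σ s (zip (List.replicate k 1 ++ l) [])) t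
        (zip [] (0 :: (List.replicate k 1 ++ w)))) (k + 1) := by
    clear hs ht w
    induction k with
    | zero => exact fun l w => runs_loop_none hp (by simp [fire, Function.update_of_ne hst])
    | succ k ih =>
      intro l w
      have h := ih (1 :: l) (1 :: w)
      rw [replicate_append_cons, replicate_append_cons] at h
      refine runs_loop_some hp ?_ h
      simp only [fire, List.mem_singleton, forall_eq, Function.update_of_ne hst,
        Function.update_self, List.replicate_succ, zip_head_cons, if_true]
      rw [app_update_pair hst]
      simp
  have h1 := runs_act [(t, stepL)] σ
  have h2 := H [] w
  have h3 := runs_act [(t, stepR)] (Function.update (Function.update σ s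
    (zip (List.replicate k 1) [])) t (zip [] (0 :: (List.replicate k 1 ++ w))))
  have h4 := runs_rewind s (List.replicate k 1) [] (isWord_ones k) (Function.update
    (Function.update σ s (zip (List.replicate k 1) [])) t (zip [] (List.replicate k 1 ++ w)))
    (by simp [Function.update_of_ne hst])
  rw [← hs, Function.update_eq_self, List.append_nil] at h2
  simp only [app_cons, app_nil, ht, act_stepL, zip_move_left_nil] at h1
  simp only [app_cons, app_nil, Function.update_self, act_stepR, zip_move_right_cons,
    zip_zero_left, Function.update_idem] at h3
  have e : Function.update (Function.update σ t (zip [] (List.replicate k 1 ++ w))) s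
      (zip [] (List.replicate k 1)) = Function.update σ t (zip [] (List.replicate k 1 ++ w)) :=
    Function.update_eq_self_iff.2 (by rw [Function.update_of_ne hst, hs])
  rw [Function.update_comm hst, Function.update_idem, List.reverse_replicate, List.append_nil,
    e] at h4
  rw [Function.update_comm hst (zip (List.replicate k 1) []) (zip [] (List.replicate k 1 ++ w)) σ]
    at h3
  simp only [List.length_replicate] at h4
  exact (h1.seq (h2.seq (h3.seq h4))).mono (by omega)

/-- Moves a word from tape `s` to the blank tape `t`. -/
def moveWord (s t : ℕ) : Frag :=
  loop [([(s, 1)], [(s, putR 0), (t, putR 1)]), ([(s, 2)], [(s, putR 0), (t, putR 2)])] ⨟ rewind t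

theorem runs_moveWord {s t : ℕ} (hst : s ≠ t) (w : List ℕ) (hw : IsWord w) (σ : Tapes)
    (hs : σ s = zip [] w) (ht : σ t = blank) :
    (moveWord s t).Runs σ (Function.update (Function.update σ s blank) t (zip [] w))
      (2 * w.length + 4) := by
  have hp : ProperRules [([(s, 1)], [(s, putR 0), (t, putR 1)]),
    ([(s, 2)], [(s, putR 0), (t, putR 2)])] := by simp [ProperRules]
  have H : ∀ u, (loop [([(s, 1)], [(s, putR 0), (t, putR 1)]),
      ([(s, 2)], [(s, putR 0), (t, putR 2)])]).Runs
      (Function.update (Function.update σ s (zip [] w)) t (zip u []))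
      (Function.update (Function.update σ s blank) t (zip (w.reverse ++ u) [])) (w.length + 1) := by
    clear hs ht
    induction w with
    | nil => exact fun u => runs_loop_none hp (by simp [fire, Function.update_of_ne hst])
    | cons a w ih =>
      intro u
      rw [isWord_cons] at hw
      have h := ih hw.2 (a :: u)
      rw [List.reverse_cons, List.append_assoc]
      refine runs_loop_some hp ?_ h
      rcases hw.1 with rfl | rfl <;>
      simp only [fire, List.mem_singleton, forall_eq, Function.update_of_ne hst,
        Function.update_self, zip_head_cons, if_true, app_update_pair hst] <;> simp
  have h2 := H []
  have h4 := runs_rewind t w.reverse [] (by simpa using hw) (Function.update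
    (Function.update σ s blank) t (zip w.reverse [])) (by simp)
  rw [← hs, Function.update_eq_self, Function.update_eq_self_iff.2 ht.symm,
    List.append_nil] at h2
  rw [Function.update_idem, List.reverse_reverse, List.append_nil] at h4
  simp only [List.length_reverse] at h4
  exact (h2.seq h4).mono (by omega)

/-- Removes the `1`s at the end of the word to the left of the head of tape `t`. -/
def trimEnd (t : ℕ) : Frag :=
  act [(t, stepL)] ⨟ loop [([(t, 1)], [(t, putL 0)])] ⨟ act [(t, stepR)]

/-- For empty `u` the default value of `headI` is `0`, the blank, which also stops the loop; so the
case of a number all of whose digits are zero is included. -/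
theorem runs_trimEnd (t k : ℕ) (u : List ℕ) (hu : u.headI ≠ 1) (σ : Tapes)
    (h : σ t = zip (List.replicate k 1 ++ u) []) :
    (trimEnd t).Runs σ (Function.update σ t (zip u [])) (k + 3) := by
  have hp : ProperRules [([(t, 1)], [(t, putL 0)])] := by simp [ProperRules]
  have H : (loop [([(t, 1)], [(t, putL 0)])]).Runs
      (Function.update σ t ((zip (List.replicate k 1 ++ u) []).move Dir.left))
      (Function.update σ t ((zip u []).move Dir.left)) (k + 1) := by
    clear h
    induction k with
    | zero =>
      refine runs_loop_none hp ?_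
      cases u <;> simp_all [fire]
    | succ k ih =>
      refine runs_loop_some hp ?_ ih
      simp [fire, List.replicate_succ]
  have h1 := runs_act [(t, stepL)] σ
  have h3 := runs_act [(t, stepR)] (Function.update σ t ((zip u []).move Dir.left))
  simp only [app_cons, app_nil, h, act_stepL] at h1
  simp only [app_cons, app_nil, Function.update_self, act_stepR, Tape.move_left_right,
    Function.update_idem] at h3
  exact (h1.seq (H.seq h3)).mono (by omega)

/-! ### Binary addition -/

theorem zip_bits_head (l : List ℕ) (p x : ℕ) :
    (zip l (bits p x)).head = if p = 0 then 0 else x % 2 + 1 := by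
  cases p <;> simp [bits]

/-- Beyond the end of the word both `p - 1` and `x / 2` stay `0`, so blanks behave like further
digits zero and no case distinction on lengths is needed later. -/
theorem zip_bits_move_right (l : List ℕ) {p x : ℕ} (hx : x < 2 ^ p) :
    ∃ a, (zip l (bits p x)).move Dir.right = zip (a :: l) (bits (p - 1) (x / 2)) := by
  cases p with
  | zero =>
    obtain rfl : x = 0 := by simpa using hx
    exact ⟨0, by simp [bits]⟩
  | succ p => exact ⟨_, zip_move_right_cons _ _ _⟩

theorem zip_bits_write_move_right (x : ℕ) (l : List ℕ) (p a : ℕ) :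
    ((zip l (bits p x)).write a).move Dir.right = zip (a :: l) (bits (p - 1) (x / 2)) := by
  cases p <;> simp [bits]

theorem div_two_lt {p x : ℕ} (hx : x < 2 ^ p) : x / 2 < 2 ^ (p - 1) := by
  cases p with
  | zero =>
    obtain rfl : x = 0 := by simpa using hx
    simp
  | succ p => rw [pow_succ] at hx; simp; omega

/-- One step of binary addition, for the symbols `x`, `y` and the carry `z`. -/
def addRule (s : ℕ × ℕ × ℕ) : Rule :=
  ([(8, s.1), (9, s.2.1), (10, s.2.2)],
    [(8, stepR), (9, putR ((s.1 / 2 + s.2.1 / 2 + s.2.2) % 2 + 1)),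
      (10, put ((s.1 / 2 + s.2.1 / 2 + s.2.2) / 2)), (11, putR 1)])

/-- The symbols for which the addition has to go on. -/
def addCases : List (ℕ × ℕ × ℕ) :=
  [(0, 0, 1), (0, 1, 1), (0, 2, 1), (1, 0, 0), (1, 1, 0), (1, 2, 0), (1, 0, 1), (1, 1, 1),
    (1, 2, 1), (2, 0, 0), (2, 1, 0), (2, 2, 0), (2, 0, 1), (2, 1, 1), (2, 2, 1)]

theorem mem_addCases {x y z : ℕ} (hx : x ≤ 2) (hy : y ≤ 2) (hz : z ≤ 1) (h : x = 0 → z = 1) :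
    (x, y, z) ∈ addCases := by
  interval_cases x <;> interval_cases y <;> interval_cases z <;> simp_all [addCases]

/-- The three scanned symbols determine the only rule that can match, so the order of the list is
irrelevant and membership can be decided once and for all. -/
theorem fire_addRule (l : List (ℕ × ℕ × ℕ)) (τ : Tapes) :
    fire (l.map addRule) τ =
      if ((τ 8).head, (τ 9).head, (τ 10).head) ∈ l then
        some (app (addRule ((τ 8).head, (τ 9).head, (τ 10).head)).2 τ) else none := by
  induction l with
  | nil => simp [fire]
  | cons s l ih =>
    obtain ⟨x, y, z⟩ := s
    simp only [List.map_cons, fire, ih, List.mem_cons, Prod.mk.injEq]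
    by_cases h : (τ 8).head = x ∧ (τ 9).head = y ∧ (τ 10).head = z
    · obtain ⟨rfl, rfl, rfl⟩ := h
      simp [addRule]
    · have h' : ¬ ∀ p ∈ (addRule (x, y, z)).1, (τ p.1).head = p.2 := by simpa [addRule] using h
      rw [if_neg h']
      simp only [h, false_or]

theorem properRules_add : ProperRules (addCases.map addRule) := by
  intro r hr
  obtain ⟨s, -, rfl⟩ := List.mem_map.1 hr
  simp [addRule]

/-- School addition that stops once the first summand is used up and no carry is left; the rest of
the second summand stays in place. The final tapes are described as `s` moves to the right from the
desired ones, so returning simply undoes these moves; tape 11 records `s` in unary. -/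
theorem runs_loop_add (a0 a1 a2 a3 a4 a5 a6 a7 : Tape ℕ) (σ : Tapes) (N : ℕ) :
    ∀ p q z x y : ℕ, 2 * p + q + z ≤ N → z ≤ 1 → x < 2 ^ p → y < 2 ^ q → ∀ l m r : List ℕ,
    ∃ s q', s ≤ max p q + 1 ∧ q' ≤ max p q + 1 ∧ (p = 0 → z = 0 → s = 0 ∧ q' = q) ∧
      x + y + z < 2 ^ q' ∧ (loop (addCases.map addRule)).Runs
        (a0 ◁ a1 ◁ a2 ◁ a3 ◁ a4 ◁ a5 ◁ a6 ◁ a7 ◁ zip l (bits p x) ◁ zip m (bits q y) ◁ zip [] [z] ◁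
          zip r [] ◁ σ)
        (a0 ◁ a1 ◁ a2 ◁ a3 ◁ a4 ◁ a5 ◁ a6 ◁ a7 ◁ (Tape.move Dir.right)^[s] (zip l (bits p x)) ◁
          (Tape.move Dir.right)^[s] (zip m (bits q' (x + y + z))) ◁ blank ◁
          zip (List.replicate s 1 ++ r) [] ◁ σ) (s + 1) := by
  -- The measure `2 * p + q + z` drops in every round: while `p > 0` the factor `2` outweighs a new
  -- carry, and afterwards either `q` or the last carry decreases.
  induction N with
  | zero =>
    intro p q z x y hN hz hx hy l m r
    obtain ⟨rfl, rfl, rfl⟩ : p = 0 ∧ q = 0 ∧ z = 0 := by omega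
    obtain rfl : x = 0 := by simpa using hx
    obtain rfl : y = 0 := by simpa using hy
    refine ⟨0, 0, by simp, by simp, by simp, by simp, ?_⟩
    simpa using runs_loop_none properRules_add (by rw [fire_addRule]; simp [bits, addCases])
  | succ N ih =>
    intro p q z x y hN hz hx hy l m r
    by_cases h0 : p = 0 ∧ z = 0
    · obtain ⟨rfl, rfl⟩ := h0
      obtain rfl : x = 0 := by simpa using hx
      refine ⟨0, q, by simp, by simp, by simp, by simpa using hy, ?_⟩
      simpa using runs_loop_none properRules_add (by rw [fire_addRule]; simp [bits, addCases])
    · have hc : (zip l (bits p x)).head / 2 = x % 2 := by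
        rw [zip_bits_head]
        split_ifs with h
        · subst h
          obtain rfl : x = 0 := by simpa using hx
          rfl
        · omega
      have hc' : (zip m (bits q y)).head / 2 = y % 2 := by
        rw [zip_bits_head]
        split_ifs with h
        · subst h
          obtain rfl : y = 0 := by simpa using hy
          rfl
        · omega
      have hm : ((zip l (bits p x)).head, (zip m (bits q y)).head, z) ∈ addCases := by
        refine mem_addCases ?_ ?_ hz fun h => ?_
        · rw [zip_bits_head]; split_ifs <;> omega
        · rw [zip_bits_head]; split_ifs <;> omega
        · rw [zip_bits_head] at h
          split_ifs at h
          · omega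
      -- The new carry; halving a symbol sends the blank and the digit zero to `0` and the digit one
      -- to `1`.
      set c := (x % 2 + y % 2 + z) / 2 with hcdef
      have hx0 : p = 0 → x = 0 := by rintro rfl; simpa using hx
      have hy0 : q = 0 → y = 0 := by rintro rfl; simpa using hy
      obtain ⟨a, ha⟩ := zip_bits_move_right l hx
      obtain ⟨s, q', hs, hq', hend, hlt, hrun⟩ := ih (p - 1) (q - 1) c (x / 2) (y / 2)
        (by omega) (by omega) (div_two_lt hx) (div_two_lt hy) (a :: l)
        (((x % 2 + y % 2 + z) % 2 + 1) :: m) (1 :: r)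
      have hsum : (x + y + z) / 2 = x / 2 + y / 2 + c := by omega
      have hsum' : (x + y + z) % 2 = (x % 2 + y % 2 + z) % 2 := by omega
      refine ⟨s + 1, q' + 1, ?_, ?_, fun h1 h2 => absurd ⟨h1, h2⟩ h0, ?_, ?_⟩
      -- If both words are exhausted, only a carry was left to be written. The clause for `p = 0`,
      -- `z = 0` then says that the recursion adds no further step, which saves the bound `max p q +
      -- 1`.
      · by_cases h : p = 0 ∧ q = 0
        · obtain ⟨rfl, rfl⟩ := h
          have h1 : x = 0 := by simpa using hx
          have h2 : y = 0 := by simpa using hy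
          have := (hend rfl (by omega)).1
          omega
        · omega
      · by_cases h : p = 0 ∧ q = 0
        · obtain ⟨rfl, rfl⟩ := h
          have h1 : x = 0 := by simpa using hx
          have h2 : y = 0 := by simpa using hy
          have := (hend rfl (by omega)).2
          omega
        · omega
      · rw [pow_succ]; omega
      · refine runs_loop_some properRules_add (σ' := a0 ◁ a1 ◁ a2 ◁ a3 ◁ a4 ◁ a5 ◁ a6 ◁ a7 ◁
          zip (a :: l) (bits (p - 1) (x / 2)) ◁
          zip (((x % 2 + y % 2 + z) % 2 + 1) :: m) (bits (q - 1) (y / 2)) ◁ zip [] [c] ◁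
          zip (1 :: r) [] ◁ σ) ?_ ?_
        · rw [fire_addRule, if_pos]
          · simp only [tcons_succ, tcons_zero, zip_head_cons, addRule, hc, hc', ← hcdef]
            simp [ha, zip_bits_write_move_right]
          · exact hm
        · rw [replicate_append_cons] at hrun
          rw [Function.iterate_succ_apply, Function.iterate_succ_apply, ha, bits, hsum, hsum',
            zip_move_right_cons]
          exact hrun

/-- Adds the number on tape 8 to the one on tape 9. -/
def add : Frag :=
  loop (addCases.map addRule) ⨟ act [(8, stepL), (9, stepL), (11, stepL)] ⨟
    loop [([(11, 1)], [(8, stepL), (9, stepL), (11, putL 0)])] ⨟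
    act [(8, stepR), (9, stepR), (11, stepR)]

theorem runs_loop_add_back (a0 a1 a2 a3 a4 a5 a6 a7 P A c : Tape ℕ) (σ : Tapes) (s : ℕ) :
    (loop [([(11, 1)], [(8, stepL), (9, stepL), (11, putL 0)])]).Runs
      (a0 ◁ a1 ◁ a2 ◁ a3 ◁ a4 ◁ a5 ◁ a6 ◁ a7 ◁
        ((Tape.move Dir.right)^[s] P).move Dir.left ◁
        ((Tape.move Dir.right)^[s] A).move Dir.left ◁ c ◁
        (zip (List.replicate s 1) []).move Dir.left ◁ σ)
      (a0 ◁ a1 ◁ a2 ◁ a3 ◁ a4 ◁ a5 ◁ a6 ◁ a7 ◁ P.move Dir.left ◁ A.move Dir.left ◁ c ◁ blank ◁ σ)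
      (s + 1) := by
  have hp : ProperRules [([(11, 1)], [(8, stepL), (9, stepL), (11, putL 0)])] := by
    simp [ProperRules]
  induction s with
  | zero => simpa using runs_loop_none hp (by simp [fire])
  | succ s ih =>
    refine runs_loop_some hp ?_ ih
    simp [fire, List.replicate_succ, -Function.iterate_succ, Function.iterate_succ_apply',
      Tape.move_right_left]

theorem runs_add (a0 a1 a2 a3 a4 a5 a6 a7 : Tape ℕ) (σ : Tapes) {p q x y : ℕ} (hx : x < 2 ^ p)
    (hy : y < 2 ^ q) : ∃ q' ≤ max p q + 1, x + y < 2 ^ q' ∧ add.Runs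
        (a0 ◁ a1 ◁ a2 ◁ a3 ◁ a4 ◁ a5 ◁ a6 ◁ a7 ◁ zip [] (bits p x) ◁ zip [] (bits q y) ◁ blank ◁
          blank ◁ σ)
        (a0 ◁ a1 ◁ a2 ◁ a3 ◁ a4 ◁ a5 ◁ a6 ◁ a7 ◁ zip [] (bits p x) ◁ zip [] (bits q' (x + y)) ◁
          blank ◁ blank ◁ σ) (2 * max p q + 6) := by
  obtain ⟨s, q', hs, hq', -, hlt, h1⟩ := runs_loop_add a0 a1 a2 a3 a4 a5 a6 a7 σ _ p q 0 x y le_rfl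
    (by omega) hx hy [] [] []
  refine ⟨q', hq', hlt, ?_⟩
  have h2 := runs_act [(8, stepL), (9, stepL), (11, stepL)] (a0 ◁ a1 ◁ a2 ◁ a3 ◁ a4 ◁ a5 ◁ a6 ◁ a7 ◁
    (Tape.move Dir.right)^[s] (zip [] (bits p x)) ◁
    (Tape.move Dir.right)^[s] (zip [] (bits q' (x + y + 0))) ◁ blank ◁
    zip (List.replicate s 1) [] ◁ σ)
  have h3 := runs_loop_add_back a0 a1 a2 a3 a4 a5 a6 a7 (zip [] (bits p x))
    (zip [] (bits q' (x + y))) blank σ s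
  have h4 := runs_act [(8, stepR), (9, stepR), (11, stepR)] (a0 ◁ a1 ◁ a2 ◁ a3 ◁ a4 ◁ a5 ◁ a6 ◁
    a7 ◁ (zip [] (bits p x)).move Dir.left ◁ (zip [] (bits q' (x + y))).move Dir.left ◁ blank ◁
    blank ◁ σ)
  simp only [app_cons, app_nil, act_stepL, act_stepR, tcons_zero, tcons_succ, update_tcons_zero,
    update_tcons_succ, Tape.move_left_right, List.append_nil, zip_zero_right, zip_move_right_nil,
    zip_zero_left, Nat.add_zero] at h1 h2 h3 h4
  exact (h1.seq (h2.seq (h3.seq h4))).mono (by omega)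

/-! ### Reading off a digit block -/

/-- Moves the head of tape `t` to the right, as far as the block of `1`s on tape `s` is long. -/
def skip (s t : ℕ) : Frag := loop [([(s, 1)], [(s, stepR), (t, stepR)])]

/-- Passing over `k` low digits is division by `2 ^ k`. -/
theorem runs_skip {s t : ℕ} (hst : s ≠ t) (k : ℕ) (σ : Tapes) {p x : ℕ} (hx : x < 2 ^ p)
    (hs : σ s = zip [] (List.replicate k 1)) (ht : σ t = zip [] (bits p x)) :
    ∃ A m, (skip s t).Runs σ
      (Function.update (Function.update σ s A) t (zip m (bits (p - k) (x / 2 ^ k)))) (k + 1) := by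
  have hp : ProperRules [([(s, 1)], [(s, stepR), (t, stepR)])] := by simp [ProperRules]
  suffices H : ∀ l m, ∃ A m', (skip s t).Runs (Function.update (Function.update σ s
      (zip l (List.replicate k 1))) t (zip m (bits p x)))
      (Function.update (Function.update σ s A) t (zip m' (bits (p - k) (x / 2 ^ k)))) (k + 1) by
    simpa [← hs, ← ht] using H [] []
  clear hs ht
  induction k generalizing p x with
  | zero =>
    intro l m
    exact ⟨zip l [], m, by
      simpa [skip] using runs_loop_none hp (by simp [fire, Function.update_of_ne hst])⟩
  | succ k ih =>
    intro l m
    obtain ⟨a, ha⟩ := zip_bits_move_right m hx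
    obtain ⟨A, m', h⟩ := ih (div_two_lt hx) (1 :: l) (a :: m)
    rw [Nat.div_div_eq_div_mul, ← pow_succ', show p - 1 - k = p - (k + 1) by omega] at h
    refine ⟨A, m', runs_loop_some hp ?_ h⟩
    simp only [fire, List.mem_singleton, forall_eq, Function.update_of_ne hst,
      Function.update_self, List.replicate_succ, zip_head_cons, if_true]
    rw [app_update_pair hst]
    simp [ha]

/-- Copies digits from tape 8 to tape 1, as many as there are `1`s on tape 7. -/
def readOff : Frag :=
  loop [([(7, 1), (8, 2)], [(1, putR 2), (7, stepR), (8, stepR)]),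
    ([(7, 1)], [(1, putR 1), (7, stepR), (8, stepR)])]

/-- The second rule does not look at tape 8, so a blank behind the number is copied as a digit zero
and exactly `k` digits are produced whatever `p` is. -/
theorem runs_readOff (a0 a2 a3 a4 a5 a6 : Tape ℕ) (σ : Tapes) (k : ℕ) {p x : ℕ} (hx : x < 2 ^ p)
    (u l m : List ℕ) : ∃ A B, readOff.Runs
      (a0 ◁ zip u [] ◁ a2 ◁ a3 ◁ a4 ◁ a5 ◁ a6 ◁ zip l (List.replicate k 1) ◁ zip m (bits p x) ◁ σ)
      (a0 ◁ zip ((bits k x).reverse ++ u) [] ◁ a2 ◁ a3 ◁ a4 ◁ a5 ◁ a6 ◁ A ◁ B ◁ σ) (k + 1) := by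
  have hp : ProperRules [([(7, 1), (8, 2)], [(1, putR 2), (7, stepR), (8, stepR)]),
    ([(7, 1)], [(1, putR 1), (7, stepR), (8, stepR)])] := by simp [ProperRules]
  induction k generalizing p x u l m with
  | zero => exact ⟨_, _, runs_loop_none hp (by simp [fire])⟩
  | succ k ih =>
    obtain ⟨a, ha⟩ := zip_bits_move_right m hx
    obtain ⟨A, B, h⟩ := ih (div_two_lt hx) ((x % 2 + 1) :: u) (1 :: l) (a :: m)
    refine ⟨A, B, ?_⟩
    rw [bits, List.reverse_cons, List.append_assoc]
    refine runs_loop_some hp ?_ h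
    have hh := zip_bits_head m p x
    rcases Nat.mod_two_eq_zero_or_one x with h2 | h2
    · have : (zip m (bits p x)).head ≠ 2 := by rw [hh, h2]; split_ifs <;> simp
      simp [fire, List.replicate_succ, this, h2, ha]
    · have hp0 : p ≠ 0 := by
        rintro rfl
        obtain rfl : x = 0 := by simpa using hx
        simp at h2
      have : (zip m (bits p x)).head = 2 := by rw [hh, h2, if_neg hp0]
      simp [fire, List.replicate_succ, this, h2, ha]

/-! ### Simulating a given machine -/

/-- The tapes of the list `l`, followed by `τ 0`, `τ 1`, … -/
def pre (l : List (Tape ℕ)) (τ : Tapes) : Tapes := l.foldr tcons τ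

theorem pre_length_add (l : List (Tape ℕ)) (τ : Tapes) (u : ℕ) : pre l τ (l.length + u) = τ u := by
  induction l with
  | nil => simp [pre]
  | cons a l ih =>
    rw [List.length_cons, Nat.add_right_comm]
    exact ih

theorem eq_pre (l : List (Tape ℕ)) (τ σ : Tapes) (h : ∀ u < l.length, σ u = pre l τ u) :
    σ = pre l fun u => σ (l.length + u) := by
  induction l generalizing σ with
  | nil => simp [pre]
  | cons a l ih =>
    have h1 := ih (fun u => σ (u + 1)) fun u hu => h (u + 1) (by simpa using hu)
    funext u
    cases u with
    | zero => exact h 0 (by simp)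
    | succ u =>
      rw [List.length_cons]
      refine (congrFun h1 u).trans ?_
      simp only [Nat.add_right_comm l.length 1]
      rfl

theorem pre_eq_of_lt (l : List (Tape ℕ)) (τ τ' : Tapes) {u : ℕ} (hu : u < l.length) :
    pre l τ u = pre l τ' u := by
  induction l generalizing u with
  | nil => simp at hu
  | cons a l ih =>
    cases u with
    | zero => rfl
    | succ u => exact ih (by simpa using hu)

theorem getElem?_flatMap_pair_even {α β : Type} (f g : α → β) (l : List α) (t : ℕ) :
    (l.flatMap fun a => [f a, g a])[2 * t]? = l[t]?.map f := by
  induction l generalizing t with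
  | nil => simp
  | cons a l ih =>
    cases t with
    | zero => simp
    | succ t => simpa [Nat.mul_succ] using ih t

theorem getElem?_flatMap_pair_odd {α β : Type} (f g : α → β) (l : List α) (t : ℕ) :
    (l.flatMap fun a => [f a, g a])[2 * t + 1]? = l[t]?.map g := by
  induction l generalizing t with
  | nil => simp
  | cons a l ih =>
    cases t with
    | zero => simp
    | succ t => simpa [Nat.mul_succ] using ih t

/-- The instruction `I` for the tapes `13`, `15`, `17`, …, in states shifted by `b`. It also marks
the visited cells of these tapes on the tapes `14`, `16`, `18`, … -/
def simInstr (b : ℕ) (I : Instruction) : Instruction where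
  state := b + I.state
  read := List.replicate 13 none ++ I.read.flatMap fun a => [a, none]
  next := b + I.next
  act := List.replicate 13 (none, none) ++ I.act.flatMap fun a => [a, (some 1, a.2)]

/-- The simulated tape `t` is tape `13 + 2 * t`. The low tapes and the marking tapes carry the
condition `none`, hence never influence the simulated machine. -/
theorem simInstr_applies {b : ℕ} {I : Instruction} {s : ℕ} {σ : Tapes} {c : Config}
    (hs : s = b + c.state) (hσ : ∀ t, σ (13 + 2 * t) = c.tape t) :
    (simInstr b I).Applies ⟨s, σ⟩ ↔ I.Applies c := by
  rw [Instruction.applies_iff, Instruction.applies_iff]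
  simp only [simInstr, hs, Nat.add_left_cancel_iff]
  refine and_congr_right fun _ => ⟨fun h t a ht => ?_, fun h u a hu => ?_⟩
  · rw [← hσ]
    refine h (13 + 2 * t) a ?_
    rw [List.getElem?_append_right (by simp), List.length_replicate, Nat.add_sub_cancel_left,
      getElem?_flatMap_pair_even (fun a => a) (fun _ => none), ht]
    rfl
  · rcases lt_or_ge u 13 with h13 | h13
    · rw [List.getElem?_append_left (by simpa using h13), List.getElem?_replicate, if_pos h13] at hu
      simp at hu
    · rw [List.getElem?_append_right (by simpa using h13), List.length_replicate] at hu
      obtain ⟨t, ht | ht⟩ : ∃ t, u = 13 + 2 * t ∨ u = 13 + (2 * t + 1) :=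
        ⟨(u - 13) / 2, by omega⟩
      · rw [ht, Nat.add_sub_cancel_left,
          getElem?_flatMap_pair_even (fun a => a) (fun _ => none)] at hu
        rw [ht, hσ]
        exact h t a (by simpa using hu)
      · rw [ht, Nat.add_sub_cancel_left,
          getElem?_flatMap_pair_odd (fun a => a) (fun _ => none)] at hu
        simp at hu

theorem simInstr_exec_low (b : ℕ) (I : Instruction) (c : Config) {u : ℕ} (hu : u < 13) :
    ((simInstr b I).exec c).tape u = c.tape u := by
  simp only [Instruction.exec, simInstr]
  rw [List.getElem?_append_left (by simpa using hu), List.getElem?_replicate, if_pos hu]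
  rfl

theorem simInstr_exec_even (b : ℕ) (I : Instruction) (c : Config) (t : ℕ) :
    ((simInstr b I).exec c).tape (13 + 2 * t) =
      match I.act[t]? with
      | none => c.tape (13 + 2 * t)
      | some a => actOnTape a (c.tape (13 + 2 * t)) := by
  simp only [Instruction.exec, simInstr]
  rw [List.getElem?_append_right (by simp), List.length_replicate, Nat.add_sub_cancel_left,
    getElem?_flatMap_pair_even (fun a => a) (fun a => (some 1, a.2))]
  cases I.act[t]? <;> rfl

theorem simInstr_exec_odd (b : ℕ) (I : Instruction) (c : Config) (t : ℕ) :
    ((simInstr b I).exec c).tape (14 + 2 * t) =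
      match I.act[t]? with
      | none => c.tape (14 + 2 * t)
      | some a => actOnTape (some 1, a.2) (c.tape (14 + 2 * t)) := by
  simp only [Instruction.exec, simInstr]
  rw [show 14 + 2 * t = 13 + (2 * t + 1) by omega, List.getElem?_append_right (by simp),
    List.length_replicate, Nat.add_sub_cancel_left,
    getElem?_flatMap_pair_odd (fun a => a) (fun a => (some 1, a.2))]
  cases I.act[t]? <;> rfl

/-- The second tape marks with `1` the cells of an interval, except perhaps the one under the head,
that contains all nonblank cells of the first tape. -/
def Marks (T S : Tape ℕ) (n : ℕ) : Prop :=
  ∃ l h r, T = zip l (h :: r) ∧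
    S.write 1 = zip (List.replicate l.length 1) (1 :: List.replicate r.length 1) ∧
    l.length + r.length ≤ n

theorem Marks.blank (n : ℕ) : Marks blank blank n :=
  ⟨[], 0, [], by simp, by simp, by simp⟩

theorem Marks.mono {T S : Tape ℕ} {n m : ℕ} (h : Marks T S n) (hnm : n ≤ m) : Marks T S m :=
  let ⟨l, x, r, h1, h2, h3⟩ := h
  ⟨l, x, r, h1, h2, h3.trans hnm⟩

/-- The cell under the head is marked before the head moves, so only the newly entered cell can lack
its mark, and the interval grows by at most one cell. -/
theorem Marks.act {T S : Tape ℕ} {n : ℕ} (h : Marks T S n) (a : Act) :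
    Marks (actOnTape a T) (actOnTape (some 1, a.2) S) (n + 1) := by
  obtain ⟨l, x, r, rfl, hS, hn⟩ := h
  obtain ⟨w, d⟩ := a
  obtain ⟨y, hy⟩ : ∃ y, actOnTape (w, d) (zip l (x :: r)) =
      match d with
      | none => zip l (y :: r)
      | some d => (zip l (y :: r)).move d := by
    cases w with
    | none => exact ⟨x, by cases d <;> rfl⟩
    | some w => exact ⟨w, by cases d <;> simp [actOnTape]⟩
  rw [hy]
  simp only [actOnTape, hS]
  rcases d with _ | d
  · exact ⟨l, y, r, rfl, by simp, by omega⟩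
  · cases d with
    | left =>
      cases l with
      | nil => exact ⟨[], 0, y :: r, by simp, by simp [List.replicate_succ], by simp at hn ⊢; omega⟩
      | cons z l =>
        exact ⟨l, z, y :: r, by simp, by simp [List.replicate_succ], by simp at hn ⊢; omega⟩
    | right =>
      cases r with
      | nil =>
        exact ⟨y :: l, 0, [], by simp, by simp [List.replicate_succ], by simp at hn ⊢; omega⟩
      | cons z r =>
        exact ⟨y :: l, z, r, by simp, by simp [List.replicate_succ], by simp at hn ⊢; omega⟩

/-- A bound for the states of a machine. -/
def stateBound (M : Machine) : ℕ := M.foldr (fun I s => I.state + I.next + s) 0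

/-- A bound for the tapes on which a machine acts. -/
def tapeBound (M : Machine) : ℕ := M.foldr (fun I s => I.act.length + s) 2

theorem le_stateBound {M : Machine} {I : Instruction} (hI : I ∈ M) :
    I.state ≤ stateBound M ∧ I.next ≤ stateBound M := by
  induction M with
  | nil => simp at hI
  | cons J M ih =>
    simp only [stateBound, List.foldr_cons] at ih ⊢
    rcases List.mem_cons.1 hI with rfl | h
    · omega
    · have := ih h; omega

theorem two_le_tapeBound (M : Machine) : 2 ≤ tapeBound M := by
  induction M with
  | nil => simp [tapeBound]
  | cons J M ih =>
    simp only [tapeBound, List.foldr_cons] at ih ⊢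
    omega

theorem le_tapeBound {M : Machine} {I : Instruction} (hI : I ∈ M) :
    I.act.length ≤ tapeBound M := by
  induction M with
  | nil => simp at hI
  | cons J M ih =>
    simp only [tapeBound, List.foldr_cons] at ih ⊢
    rcases List.mem_cons.1 hI with rfl | h
    · omega
    · have := ih h; omega

/-- Runs `M` on the tapes `13`, `15`, `17`, … until it halts. -/
def simulate (M : Machine) : Frag where
  size := stateBound M + 1
  code b := M.map (simInstr b) ++
    (List.range (stateBound M + 1)).map fun s => ⟨b + s, [], b + (stateBound M + 1), []⟩
  mem_range b I hI := by
    rcases List.mem_append.1 hI with h | h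
    · obtain ⟨J, hJ, rfl⟩ := List.mem_map.1 h
      have := (le_stateBound hJ).1
      simp only [simInstr]; omega
    · obtain ⟨s, hs, rfl⟩ := List.mem_map.1 h
      have := List.mem_range.1 hs
      simp only; omega

/-- The tapes `σ` represent the configuration `c` of a machine acting on `K` tapes. -/
structure Simulates (σ₀ σ : Tapes) (c : Config) (K n : ℕ) : Prop where
  low : ∀ u < 13, σ u = σ₀ u
  even : ∀ t, σ (13 + 2 * t) = c.tape t
  marks : ∀ t, Marks (σ (13 + 2 * t)) (σ (14 + 2 * t)) n
  high : ∀ t, K ≤ t → σ (13 + 2 * t) = blank ∧ σ (14 + 2 * t) = blank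

theorem Simulates.exec {σ₀ σ : Tapes} {c : Config} {K n : ℕ} (h : Simulates σ₀ σ c K n)
    (b s : ℕ) {I : Instruction} (hI : I.act.length ≤ K) :
    Simulates σ₀ ((simInstr b I).exec ⟨s, σ⟩).tape (I.exec c) K (n + 1) where
  low u hu := by rw [simInstr_exec_low b I _ hu]; exact h.low u hu
  even t := by
    rw [simInstr_exec_even]
    change (match I.act[t]? with
      | none => σ (13 + 2 * t)
      | some a => actOnTape a (σ (13 + 2 * t))) = _
    rw [h.even]
    rfl
  marks t := by
    rw [simInstr_exec_even, simInstr_exec_odd]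
    cases I.act[t]? with
    | none => exact (h.marks t).mono (by omega)
    | some a => exact (h.marks t).act a
  high t ht := by
    rw [simInstr_exec_even, simInstr_exec_odd, List.getElem?_eq_none (by omega)]
    exact h.high t ht

theorem find?_map_simInstr {M : Machine} {b s : ℕ} {σ : Tapes} {c : Config}
    (hs : s = b + c.state) (hσ : ∀ t, σ (13 + 2 * t) = c.tape t) :
    (M.map (simInstr b)).find? (fun I => decide (I.Applies ⟨s, σ⟩)) =
      (M.find? fun I => decide (I.Applies c)).map (simInstr b) := by
  rw [List.find?_map]
  congr 2
  funext I
  simp only [Function.comp, simInstr_applies hs hσ]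

/-- Halting of the simulated machine has to become a jump: when no translated instruction applies,
an unconditional one for its current state leads to the exit. -/
theorem find?_fallback {N b s : ℕ} (hs : s ≤ N) (x : ℕ) (σ : Tapes) :
    Machine.step ((List.range (N + 1)).map fun s => ⟨b + s, [], x, []⟩) ⟨b + s, σ⟩ =
      some ⟨x, σ⟩ := by
  unfold Machine.step
  cases h : List.find? (fun I => decide (I.Applies ⟨b + s, σ⟩))
      ((List.range (N + 1)).map fun s => (⟨b + s, [], x, []⟩ : Instruction)) with
  | none =>
    rw [List.find?_eq_none] at h
    exact absurd (by simp [applies_nil])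
      (h ⟨b + s, [], x, []⟩ (List.mem_map.2 ⟨s, List.mem_range.2 (by omega), rfl⟩))
  | some I =>
    obtain ⟨k, -, rfl⟩ := List.mem_map.1 (List.mem_of_find?_eq_some h)
    simp [exec_nil]

theorem simulate_step_some {M : Machine} {σ₀ σ : Tapes} {c c' : Config} {n : ℕ}
    (h : Simulates σ₀ σ c (tapeBound M) n) (hc : M.step c = some c') :
    ∃ σ', (∀ b, ((simulate M).code b).step ⟨b + c.state, σ⟩ = some ⟨b + c'.state, σ'⟩) ∧
      Simulates σ₀ σ' c' (tapeBound M) (n + 1) ∧ c.state ≤ stateBound M ∧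
      c'.state ≤ stateBound M := by
  unfold Machine.step at hc
  obtain ⟨I, hI, rfl⟩ := Option.map_eq_some_iff.1 hc
  have hmem := List.mem_of_find?_eq_some hI
  have happ : I.Applies c := by simpa using List.find?_some hI
  -- The resulting tapes do not depend on the position `b` of the code, so `0` serves as a
  -- representative.
  refine ⟨_, fun b => ?_, h.exec 0 0 (le_tapeBound hmem), ?_, ?_⟩
  · simp only [Machine.step, simulate, List.find?_append, find?_map_simInstr rfl h.even, hI]
    rfl
  · rw [← happ.1]; exact (le_stateBound hmem).1
  · exact (le_stateBound hmem).2

theorem simulate_step_none {M : Machine} {b : ℕ} {σ₀ σ : Tapes} {c : Config} {K n : ℕ}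
    (h : Simulates σ₀ σ c K n) (hc : M.step c = none) (hs : c.state ≤ stateBound M) :
    ((simulate M).code b).step ⟨b + c.state, σ⟩ = some ⟨b + (stateBound M + 1), σ⟩ := by
  unfold Machine.step at hc
  rw [Option.map_eq_none_iff] at hc
  rw [← find?_fallback (N := stateBound M) (b := b) hs]
  simp only [Machine.step, simulate, List.find?_append, find?_map_simInstr rfl h.even, hc]
  rfl

theorem runs_simulate_aux {M : Machine} {σ₀ : Tapes} {c' : Config} (hc' : M.step c' = none)
    (k : ℕ) : ∀ (σ : Tapes) (c : Config) (n : ℕ), Simulates σ₀ σ c (tapeBound M) n →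
      c.state ≤ stateBound M → M.run k c = some c' →
      ∃ σ', Simulates σ₀ σ' c' (tapeBound M) (n + k) ∧
        ∀ b L, (simulate M).Embeds b L →
          L.run (k + 1) ⟨b + c.state, σ⟩ = some ⟨b + (stateBound M + 1), σ'⟩ := by
  induction k with
  | zero =>
    intro σ c n h hs hr
    obtain rfl : c = c' := by simpa [Machine.run] using hr
    refine ⟨σ, h, fun b L hL => ?_⟩
    have h1 := hL ⟨b + c.state, σ⟩ (by simp) (by simp only [simulate]; omega)
    rw [simulate_step_none h hc' hs] at h1
    simp [Machine.run, h1]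
  | succ k ih =>
    intro σ c n h hs hr
    rw [Machine.run] at hr
    cases hstep : M.step c with
    | none => simp [hstep] at hr
    | some d =>
      rw [hstep, Option.bind_some] at hr
      obtain ⟨σ₁, hs₁, h₁, -, hd⟩ := simulate_step_some h hstep
      obtain ⟨σ', h', hrun⟩ := ih σ₁ d (n + 1) h₁ hd hr
      refine ⟨σ', by rwa [Nat.add_right_comm] at h', fun b L hL => ?_⟩
      have h2 := hL ⟨b + c.state, σ⟩ (by simp) (by simp only [simulate]; omega)
      rw [hs₁ b] at h2
      rw [Machine.run, h2]
      exact hrun b L hL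

/-! ### Cleaning up -/

/-- Erases tape `s` wherever tape `t` carries a `1`, and erases tape `t`. -/
def erasePair (s t : ℕ) : Frag := loop [([(t, 1)], [(s, putR 0), (t, putR 0)])]

theorem runs_erasePair {s t : ℕ} (hst : s ≠ t) (w : List ℕ) (σ : Tapes) (hs : σ s = zip [] w)
    (ht : σ t = zip [] (List.replicate w.length 1)) :
    (erasePair s t).Runs σ (Function.update (Function.update σ s blank) t blank)
      (w.length + 1) := by
  have hp : ProperRules [([(t, 1)], [(s, putR 0), (t, putR 0)])] := by simp [ProperRules]
  suffices H : (erasePair s t).Runs (Function.update (Function.update σ s (zip [] w)) t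
      (zip [] (List.replicate w.length 1)))
      (Function.update (Function.update σ s blank) t blank) (w.length + 1) by
    simpa [← hs, ← ht] using H
  clear hs ht
  induction w with
  | nil => exact runs_loop_none hp (by simp [fire])
  | cons a w ih =>
    refine runs_loop_some hp ?_ ih
    simp only [fire, List.mem_singleton, forall_eq, Function.update_self, List.length_cons,
      List.replicate_succ, zip_head_cons, if_true]
    rw [app_update_pair hst]
    simp

/-- Erases a tape together with the tape that marks its cells. -/
def cleanPair (s t : ℕ) : Frag := act [(t, put 1)] ⨟ rewindPair s t ⨟ erasePair s t

/-- After marking the cell under the head the marks form a gapless block covering everything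
nonblank on `s`. Both heads go to its left end, and one sweep erases both tapes. -/
theorem runs_cleanPair {s t : ℕ} (hst : s ≠ t) {n : ℕ} (σ : Tapes) (h : Marks (σ s) (σ t) n) :
    (cleanPair s t).Runs σ (Function.update (Function.update σ s blank) t blank) (2 * n + 6) := by
  obtain ⟨l, x, r, hT, hS, hn⟩ := h
  have h1 := runs_act [(t, put 1)] σ
  simp only [app_cons, app_nil, act_put, hS] at h1
  have h2 := runs_rewindPair hst l (x :: r) (Function.update σ t
    (zip (List.replicate l.length 1) (1 :: List.replicate r.length 1)))
    (by rw [Function.update_of_ne hst, hT]) (by simp [List.replicate_succ])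
  have h3 := runs_erasePair hst (l.reverse ++ x :: r)
    (σ := Function.update (Function.update (Function.update σ t
    (zip (List.replicate l.length 1) (1 :: List.replicate r.length 1))) s
    (zip [] (l.reverse ++ x :: r))) t (zip [] (List.replicate (l.length + (x :: r).length) 1)))
    (by rw [Function.update_of_ne hst, Function.update_self]) (by simp)
  have e : ∀ (A B C D : Tape ℕ) , Function.update (Function.update (Function.update (Function.update
      (Function.update σ t A) s B) t C) s blank) t blank =
      Function.update (Function.update σ s blank) t blank := fun A B C D => by
    funext u
    by_cases hu : u = t
    · subst hu; simp
    · by_cases hu' : u = s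
      · subst hu'; simp [Function.update_of_ne hu]
      · simp [Function.update_of_ne hu, Function.update_of_ne hu']
  rw [e _ _ _ blank] at h3
  refine (h1.seq (h2.seq h3)).mono ?_
  simp only [List.length_append, List.length_reverse, List.length_cons]
  omega

/-- The empty fragment. -/
def Frag.nil : Frag where
  size := 0
  code _ := []
  mem_range _ _ h := by simp at h

theorem runs_nil (σ : Tapes) : Frag.nil.Runs σ σ 0 := fun _ _ _ => ⟨0, le_rfl, rfl⟩

/-- Erases the tapes of `K` pairs. -/
def cleanAll : ℕ → Frag
  | 0 => Frag.nil
  | K + 1 => cleanAll K ⨟ cleanPair (13 + 2 * K) (14 + 2 * K)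

theorem runs_cleanAll (K n : ℕ) (σ : Tapes)
    (h : ∀ t < K, Marks (σ (13 + 2 * t)) (σ (14 + 2 * t)) n) :
    (cleanAll K).Runs σ (fun u => if 13 ≤ u ∧ u < 13 + 2 * K then blank else σ u)
      (K * (2 * n + 6)) := by
  induction K with
  | zero =>
    have e : (fun u => if 13 ≤ u ∧ u < 13 + 2 * 0 then blank else σ u) = σ := by
      funext u; rw [if_neg (by omega)]
    rw [e, Nat.zero_mul]
    exact runs_nil σ
  | succ K ih =>
    have h1 := ih fun t ht => h t (by omega)
    have h2 := runs_cleanPair (s := 13 + 2 * K) (t := 14 + 2 * K) (by omega) (n := n)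
      (fun u => if 13 ≤ u ∧ u < 13 + 2 * K then blank else σ u) (by
        rw [if_neg (by omega), if_neg (by omega)]
        exact h K (by omega))
    have e : Function.update (Function.update (fun u => if 13 ≤ u ∧ u < 13 + 2 * K then blank
        else σ u) (13 + 2 * K) blank) (14 + 2 * K) blank =
        fun u => if 13 ≤ u ∧ u < 13 + 2 * (K + 1) then blank else σ u := by
      funext u
      by_cases h14 : u = 14 + 2 * K
      · subst h14
        rw [Function.update_self, if_pos (by omega)]
      · rw [Function.update_of_ne h14]
        by_cases h13 : u = 13 + 2 * K
        · subst h13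
          rw [Function.update_self, if_pos (by omega)]
        · rw [Function.update_of_ne h13]
          refine if_congr ?_ rfl rfl
          omega
    rw [e] at h2
    rw [show (K + 1) * (2 * n + 6) = K * (2 * n + 6) + (2 * n + 6) from Nat.succ_mul _ _]
    exact h1.seq h2

/-! ### Calling a machine as a subroutine -/

/-- All tapes blank. -/
def blanks : Tapes := fun _ => blank

/-- The low tapes are allowed to be different (`l'`) when the cleaning starts, because the addition
takes place between the simulation, whose result it reads, and the cleaning. Tape `2` of `τ` is the
output tape of `M`, since every other tape of `τ` holds marks. -/
theorem exists_run_simulate {M : Machine} {w v : List ℕ} {T : ℕ} (hw : w ≠ [])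
    (h : M.OutputsWithin w v T) (l : List (Tape ℕ)) (hl : l.length = 13) :
    ∃ τ : Tapes, τ 2 = zip [] v ∧
      (simulate M).Runs (pre l (zip [] w ◁ zip [] (List.replicate w.length 1) ◁ blanks))
        (pre l τ) (T + 1) ∧
      ∀ l' : List (Tape ℕ), l'.length = 13 →
        (cleanAll (tapeBound M)).Runs (pre l' τ) (pre l' blanks)
          (tapeBound M * (2 * (w.length + T) + 6)) := by
  obtain ⟨c, run, hT, hc, hv⟩ := h
  have hT' : run.steps ≤ T := by exact_mod_cast hT
  have hrun : M.run run.steps (Config.init w) = some c := by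
    rw [← Machine.iterate_eq_run]; exact run.evals_in_steps
  set σ₀ := pre l (zip [] w ◁ zip [] (List.replicate w.length 1) ◁ blanks) with hσ₀
  have hval : ∀ u, σ₀ (13 + u) = (zip [] w ◁ zip [] (List.replicate w.length 1) ◁ blanks) u :=
    fun u => by rw [hσ₀, ← hl, pre_length_add]
  have h13 : σ₀ 13 = zip [] w := hval 0
  have h14 : σ₀ 14 = zip [] (List.replicate w.length 1) := hval 1
  have hbl : ∀ u, σ₀ (15 + u) = blank := fun u => by
    have := hval (u + 2)
    rwa [show 13 + (u + 2) = 15 + u by omega] at this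
  have hK := two_le_tapeBound M
  have hsim : Simulates σ₀ σ₀ (Config.init w) (tapeBound M) w.length := by
    refine ⟨fun _ _ => rfl, fun t => ?_, fun t => ?_, fun t ht => ?_⟩
    · cases t with
      | zero => exact h13
      | succ t =>
        rw [show 13 + 2 * (t + 1) = 15 + 2 * t by omega, hbl]
        rfl
    · cases t with
      | zero =>
        rw [Nat.mul_zero, Nat.add_zero, Nat.add_zero, h13, h14]
        obtain ⟨x, r, rfl⟩ := List.exists_cons_of_ne_nil hw
        exact ⟨[], x, r, rfl, by simp [List.replicate_succ], by simp⟩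
      | succ t =>
        rw [show 13 + 2 * (t + 1) = 15 + 2 * t by omega,
          show 14 + 2 * (t + 1) = 15 + (2 * t + 1) by omega, hbl, hbl]
        exact Marks.blank _
    · obtain ⟨t, rfl⟩ : ∃ s, t = s + 1 := ⟨t - 1, by omega⟩
      rw [show 13 + 2 * (t + 1) = 15 + 2 * t by omega,
        show 14 + 2 * (t + 1) = 15 + (2 * t + 1) by omega, hbl, hbl]
      exact ⟨rfl, rfl⟩
  obtain ⟨σ', hσ', hr⟩ := runs_simulate_aux hc run.steps σ₀ (Config.init w) w.length hsim
    (Nat.zero_le _) hrun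
  have hpre : σ' = pre l fun u => σ' (13 + u) := by
    have := eq_pre l (zip [] w ◁ zip [] (List.replicate w.length 1) ◁ blanks) σ'
      fun u hu => hσ'.low u (by omega)
    rwa [hl] at this
  refine ⟨fun u => σ' (13 + u), ?_, fun b L hL => ⟨run.steps + 1, by omega, ?_⟩,
    fun l' hl' => ?_⟩
  · exact (hσ'.even 1).trans hv
  · rw [← hpre]
    exact hr b L hL
  · have hu : ∀ u, pre l' (fun u => σ' (13 + u)) (13 + u) = σ' (13 + u) := fun u => by
      rw [← hl', pre_length_add, hl']
    have h1 := runs_cleanAll (tapeBound M) (w.length + T) (pre l' fun u => σ' (13 + u))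
      fun t _ => by
        rw [hu, show 14 + 2 * t = 13 + (2 * t + 1) by omega, hu,
          show 13 + (2 * t + 1) = 14 + 2 * t by omega]
        exact (hσ'.marks t).mono (by omega)
    convert h1 using 1
    funext u
    rcases lt_or_ge u 13 with h | h
    · rw [if_neg (by omega)]
      exact pre_eq_of_lt _ _ _ (by omega)
    · obtain ⟨u, rfl⟩ := Nat.exists_eq_add_of_le h
      rw [hu]
      have : pre l' blanks (13 + u) = blank := by rw [← hl', pre_length_add]; rfl
      rw [this]
      split_ifs with h'
      · rfl
      · have h2 := hσ'.high (u / 2) (by omega)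
        rcases Nat.mod_two_eq_zero_or_one u with hm | hm
        · rw [show 13 + u = 13 + 2 * (u / 2) by omega, h2.1]
        · rw [show 13 + u = 14 + 2 * (u / 2) by omega, h2.2]

theorem Frag.Runs.then {F G : Frag} {σ σ' σ'' : Tapes} {t T : ℕ} (hF : F.Runs σ σ' t)
    (ht : t ≤ T) (hG : G.Runs σ' σ'' (T - t)) : (F ⨟ G).Runs σ σ'' T :=
  (hF.seq hG).mono (by omega)

theorem blanks_eq_tcons : blanks = blank ◁ blanks := by
  funext u; cases u <;> rfl

/-! ### Writing the input of the simulated machine -/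

/-- Prints a separator on the input tape of the simulated machine. -/
def putSep : Frag := act [(13, putR 3), (14, putR 1)]

theorem runs_putSep (x : List ℕ) (σ : Tapes) (h13 : σ 13 = zip x [])
    (h14 : σ 14 = zip (List.replicate x.length 1) []) :
    putSep.Runs σ (Function.update (Function.update σ 13 (zip (3 :: x) [])) 14
      (zip (List.replicate (3 :: x).length 1) [])) 1 := by
  have h := runs_act [(13, putR 3), (14, putR 1)] σ
  simp only [app_cons, app_nil, act_putR, h13, h14, zip_write_nil, zip_move_right_cons] at h
  rwa [Function.update_comm (by simp)] at h

/-- Copies the number on tape `t` to the input tape of the simulated machine. -/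
def copyNumber (t : ℕ) : Frag := copy t 13 14 ⨟ rewind t

theorem runs_copyNumber {t : ℕ} (ht : t < 13) (k : ℕ) (x : List ℕ) (σ : Tapes)
    (h : σ t = zip [] (natWord k)) (h13 : σ 13 = zip x [])
    (h14 : σ 14 = zip (List.replicate x.length 1) []) :
    (copyNumber t).Runs σ (Function.update (Function.update σ 13
      (zip ((natWord k).reverse ++ x) [])) 14
      (zip (List.replicate ((natWord k).reverse ++ x).length 1) [])) (2 * k + 4) := by
  have hl := length_natWord_le k
  have h13' : t ≠ 13 := by omega
  have h14' : t ≠ 14 := by omega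
  have h1 := runs_copy h13' h14' (by simp) _ (isWord_natWord k) [] x σ h h13 h14
  rw [List.append_nil] at h1
  have h2 := runs_rewind t (natWord k).reverse [] (isWord_reverse.2 (isWord_natWord k))
    (Function.update (Function.update (Function.update σ t (zip (natWord k).reverse [])) 13
      (zip ((natWord k).reverse ++ x) [])) 14
      (zip (List.replicate ((natWord k).reverse ++ x).length 1) []))
    (by rw [Function.update_of_ne h14', Function.update_of_ne h13', Function.update_self])
  rw [List.append_nil, List.reverse_reverse, ← h, List.length_reverse] at h2
  have e : ∀ A B C : Tape ℕ, Function.update (Function.update (Function.update (Function.update σ t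
      A) 13 B) 14 C) t (σ t) = Function.update (Function.update σ 13 B) 14 C := fun A B C => by
    funext u
    by_cases hu : u = t
    · subst hu
      rw [Function.update_self, Function.update_of_ne h14', Function.update_of_ne h13']
    · rw [Function.update_of_ne hu]
      by_cases hu' : u = 14
      · subst hu'; rw [Function.update_self, Function.update_self]
      · rw [Function.update_of_ne hu', Function.update_of_ne hu']
        by_cases hu'' : u = 13
        · subst hu''; rw [Function.update_self, Function.update_self]
        · rw [Function.update_of_ne hu'', Function.update_of_ne hu'', Function.update_of_ne hu]
  rw [e] at h2
  exact (h1.seq h2).mono (by omega)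

/-- Writes the numbers on the tapes 2, 3 and 4 on the input tape of the simulated machine. -/
def writeInput : Frag :=
  copyNumber 2 ⨟ putSep ⨟ copyNumber 3 ⨟ putSep ⨟ copyNumber 4 ⨟ rewindPair 13 14

theorem length_tripleWord_le {n i j : ℕ} (hi : i ≤ n) (hj : j ≤ n) :
    (tripleWord n i j).length ≤ 3 * n + 2 := by
  have h1 := length_natWord_le n
  have h2 := length_natWord_le i
  have h3 := length_natWord_le j
  simp [tripleWord]; omega

/-- The companion tape 14 is filled along with tape 13, so that the input too is erased by the later
cleaning. -/
theorem runs_writeInput (a0 a1 a5 a6 a7 a8 a9 a10 a11 a12 : Tape ℕ) {n i j : ℕ} (hi : i ≤ n)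
    (hj : j ≤ n) : writeInput.Runs
      (a0 ◁ a1 ◁ zip [] (natWord n) ◁ zip [] (natWord i) ◁ zip [] (natWord j) ◁ a5 ◁ a6 ◁ a7 ◁ a8 ◁
        a9 ◁ a10 ◁ a11 ◁ a12 ◁ blank ◁ blank ◁ blanks)
      (a0 ◁ a1 ◁ zip [] (natWord n) ◁ zip [] (natWord i) ◁ zip [] (natWord j) ◁ a5 ◁ a6 ◁ a7 ◁ a8 ◁
        a9 ◁ a10 ◁ a11 ◁ a12 ◁ zip [] (tripleWord n i j) ◁
        zip [] (List.replicate (tripleWord n i j).length 1) ◁ blanks) (9 * n + 20) := by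
  have h1 := length_natWord_le n
  have h2 := length_natWord_le i
  have h3 := length_natWord_le j
  refine (runs_copyNumber (t := 2) (by simp) n [] _ rfl rfl rfl).then (by omega) ?_
  simp only [update_tcons_zero, update_tcons_succ]
  refine (runs_putSep _ _ rfl rfl).then (by omega) ?_
  simp only [update_tcons_zero, update_tcons_succ]
  refine (runs_copyNumber (t := 3) (by simp) i _ _ rfl rfl rfl).then (by omega) ?_
  simp only [update_tcons_zero, update_tcons_succ]
  refine (runs_putSep _ _ rfl rfl).then (by omega) ?_
  simp only [update_tcons_zero, update_tcons_succ]
  refine (runs_copyNumber (t := 4) (by simp) j _ _ rfl rfl rfl).then (by omega) ?_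
  simp only [update_tcons_zero, update_tcons_succ]
  generalize hL : (natWord j).reverse ++
    3 :: ((natWord i).reverse ++ 3 :: ((natWord n).reverse ++ [])) = L
  have hw : L.reverse = tripleWord n i j := by rw [← hL]; simp [tripleWord]
  have h := runs_rewindPair (s := 13) (t := 14) (by simp) L [] (a0 ◁ a1 ◁ zip [] (natWord n) ◁
    zip [] (natWord i) ◁ zip [] (natWord j) ◁ a5 ◁ a6 ◁ a7 ◁ a8 ◁ a9 ◁ a10 ◁ a11 ◁ a12 ◁
    zip L [] ◁ zip (List.replicate L.length 1) [] ◁ blanks) rfl rfl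
  simp only [update_tcons_zero, update_tcons_succ, hw, List.append_nil, List.length_nil,
    Nat.add_zero] at h
  have hlen := length_tripleWord_le hi hj
  rw [← hw, List.length_reverse] at hlen ⊢
  rw [← hw] at h
  exact h.mono (by omega)

/-! ### The loop over the multiplicities -/

/-- The inner round: the number on tape 8 is added to the one on tape 9 if `M` permits the current
multiplicity, and it is shifted by the number of `1`s on tape 12. -/
def innerBody (M : Machine) : Frag :=
  writeInput ⨟ simulate M ⨟ when 15 2 add ⨟ cleanAll (tapeBound M) ⨟ shift 12 8 ⨟ inc 4 ⨟
    act [(6, stepR)]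

/-- One inner round. Tapes 2, 3, 4 hold `n`, `i`, `j` in binary, tape 6 counts rounds in unary, tape
8 is the current summand, tape 9 the running sum, tapes 10 and 11 serve the addition, tape 12 is the
shift in unary, and the simulated machine lives from tape 13 on. -/
theorem runs_when_add {M : Machine} {n i j T v S p q x y : ℕ} (hi : i ≤ n)
    (hj : j ≤ n) (hM : M.OutputsWithin (tripleWord n i j) (natWord v) T) (hv : v = 0 ∨ v = 1)
    (a0 a1 a5 a7 : Tape ℕ) (hx : x < 2 ^ p) (hy : y < 2 ^ q) {l r : List ℕ} :
    ∃ q' ≤ max p q + 1, y + v * x < 2 ^ q' ∧ (innerBody M).Runs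
      (a0 ◁ a1 ◁ zip [] (natWord n) ◁ zip [] (natWord i) ◁ zip [] (natWord j) ◁ a5 ◁
        zip l (1 :: r) ◁ a7 ◁ zip [] (bits p x) ◁ zip [] (bits q y) ◁ blank ◁ blank ◁
        zip [] (List.replicate S 1) ◁ blanks)
      (a0 ◁ a1 ◁ zip [] (natWord n) ◁ zip [] (natWord i) ◁ zip [] (natWord (j + 1)) ◁ a5 ◁
        zip (1 :: l) r ◁ a7 ◁ zip [] (bits (S + p) (x * 2 ^ S)) ◁ zip [] (bits q' (y + v * x)) ◁
        blank ◁ blank ◁ zip [] (List.replicate S 1) ◁ blanks)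
      (11 * n + T + 2 * max p q + 2 * S + tapeBound M * (6 * n + 2 * T + 10) + 44) := by
  have hlen := length_tripleWord_le hi hj
  have hne : tripleWord n i j ≠ [] := by simp [tripleWord]
  obtain ⟨τ, hτ, hsim, hclean⟩ := exists_run_simulate hne hM
    [a0, a1, zip [] (natWord n), zip [] (natWord i), zip [] (natWord j), a5, zip l (1 :: r), a7,
      zip [] (bits p x), zip [] (bits q y), blank, blank, zip [] (List.replicate S 1)] rfl
  have hadd : ∃ q' ≤ max p q + 1, y + v * x < 2 ^ q' ∧ (when 15 2 add).Runs
      (a0 ◁ a1 ◁ zip [] (natWord n) ◁ zip [] (natWord i) ◁ zip [] (natWord j) ◁ a5 ◁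
        zip l (1 :: r) ◁ a7 ◁ zip [] (bits p x) ◁ zip [] (bits q y) ◁ blank ◁ blank ◁
        zip [] (List.replicate S 1) ◁ τ)
      (a0 ◁ a1 ◁ zip [] (natWord n) ◁ zip [] (natWord i) ◁ zip [] (natWord j) ◁ a5 ◁
        zip l (1 :: r) ◁ a7 ◁ zip [] (bits p x) ◁ zip [] (bits q' (y + v * x)) ◁ blank ◁ blank ◁
        zip [] (List.replicate S 1) ◁ τ) (2 * max p q + 7) := by
    -- Tape 15 is the output tape of `M`. The code of `0` is empty and that of `1` is `[2]`, so
    -- scanning a `2` is the test for `v = 1`.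
    rcases hv with rfl | rfl
    · refine ⟨q, by omega, by simpa using hy, ?_⟩
      have h : (when 15 2 add).Runs _ _ _ := runs_when_neg (t := 15) (a := 2) (F := add)
        (σ := a0 ◁ a1 ◁ zip [] (natWord n) ◁ zip [] (natWord i) ◁ zip [] (natWord j) ◁ a5 ◁
          zip l (1 :: r) ◁ a7 ◁ zip [] (bits p x) ◁ zip [] (bits q y) ◁ blank ◁ blank ◁
          zip [] (List.replicate S 1) ◁ τ) (by
            simp only [tcons_succ, hτ, natWord_zero, zip_head_nil]
            simp)
      simpa only [Nat.zero_mul, Nat.add_zero] using h.mono (by omega)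
    · obtain ⟨q', hq', hlt, hr⟩ := runs_add a0 a1 (zip [] (natWord n)) (zip [] (natWord i))
        (zip [] (natWord j)) a5 (zip l (1 :: r)) a7 (zip [] (List.replicate S 1) ◁ τ) hx hy
      refine ⟨q', hq', by rw [one_mul, add_comm]; exact hlt, ?_⟩
      rw [one_mul, add_comm y]
      exact runs_when_pos (by simp only [tcons_succ, hτ]; rfl) hr
  obtain ⟨q', hq', hlt, hadd⟩ := hadd
  refine ⟨q', hq', hlt, ?_⟩
  have hb : tapeBound M * (2 * ((tripleWord n i j).length + T) + 6) ≤
    tapeBound M * (6 * n + 2 * T + 10) := Nat.mul_le_mul_left _ (by omega)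
  generalize tapeBound M * (6 * n + 2 * T + 10) = Z at *
  conv in blanks => rw [blanks_eq_tcons, blanks_eq_tcons]
  refine (runs_writeInput a0 a1 a5 (zip l (1 :: r)) a7 _ _ _ _ _ hi hj).then (by omega) ?_
  refine hsim.then (by omega) ?_
  refine hadd.then (by omega) ?_
  refine (hclean [a0, a1, zip [] (natWord n), zip [] (natWord i), zip [] (natWord j), a5,
    zip l (1 :: r), a7, zip [] (bits p x), zip [] (bits q' (y + v * x)), blank, blank,
    zip [] (List.replicate S 1)] rfl).then (by omega) ?_
  simp only [pre, List.foldr_cons, List.foldr_nil]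
  refine (runs_shift (s := 12) (t := 8) (by simp) S (bits p x) _ rfl rfl).then (by omega) ?_
  simp only [update_tcons_zero, update_tcons_succ, ← bits_mul_two_pow]
  refine (runs_inc 4 j _ rfl).then (by omega) ?_
  simp only [update_tcons_zero, update_tcons_succ]
  have h := runs_act [(6, stepR)] (a0 ◁ a1 ◁ zip [] (natWord n) ◁ zip [] (natWord i) ◁
    zip [] (natWord (j + 1)) ◁ a5 ◁ zip l (1 :: r) ◁ a7 ◁ zip [] (bits (S + p) (x * 2 ^ S)) ◁
    zip [] (bits q' (y + v * x)) ◁ blank ◁ blank ◁ zip [] (List.replicate S 1) ◁ blanks)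
  simp only [app_cons, app_nil, act_stepR, tcons_zero, tcons_succ, update_tcons_zero,
    update_tcons_succ, zip_move_right_cons] at h
  exact h.mono (by omega)

/-- The sum over the multiplicities `j < k`. -/
def partialSum (c : ℕ → ℕ) (x S k : ℕ) : ℕ := ∑ j ∈ Finset.range k, c j * (x * 2 ^ (S * j))

/-- Invariant after `k` rounds: tape 8 holds `x * 2 ^ (S * k)` and tape 9 the sum over `j < k`. A
round lengthens the sum by at most `S + 1` digits, which gives the bound on `q`. There are `n + 1`
rounds because the multiplicity `0` is included. -/
theorem runs_innerLoop {M : Machine} {n i T S p x : ℕ} {c : ℕ → ℕ} (hi : i ≤ n)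
    (hM : ∀ j ≤ n, M.OutputsWithin (tripleWord n i j) (natWord (c j)) T)
    (hc : ∀ j ≤ n, c j = 0 ∨ c j = 1) (a0 a1 a5 a7 : Tape ℕ) (hx : x < 2 ^ p) :
    ∃ q ≤ p + (S + 1) * (n + 1), partialSum c x S (n + 1) < 2 ^ q ∧ ∃ z,
      (while_ 6 1 (innerBody M)).Runs
      (a0 ◁ a1 ◁ zip [] (natWord n) ◁ zip [] (natWord i) ◁ blank ◁ a5 ◁
        zip [] (List.replicate (n + 1) 1) ◁ a7 ◁ zip [] (bits p x) ◁ blank ◁ blank ◁ blank ◁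
        zip [] (List.replicate S 1) ◁ blanks)
      (a0 ◁ a1 ◁ zip [] (natWord n) ◁ zip [] (natWord i) ◁ zip [] (natWord (n + 1)) ◁ a5 ◁
        zip (List.replicate (n + 1) 1) [] ◁ a7 ◁ zip [] (bits (p + S * (n + 1)) z) ◁
        zip [] (bits q (partialSum c x S (n + 1))) ◁ blank ◁ blank ◁
        zip [] (List.replicate S 1) ◁ blanks)
      ((n + 1) * (11 * n + T + 2 * (p + (S + 1) * (n + 1)) + 2 * S +
        tapeBound M * (6 * n + 2 * T + 10) + 46) + 1) := by
  obtain ⟨σ', hr, q, hq, hlt, rfl⟩ := runs_while_invariant (t := 6) (a := 1) (N := n + 1)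
    (T := 11 * n + T + 2 * (p + (S + 1) * (n + 1)) + 2 * S +
      tapeBound M * (6 * n + 2 * T + 10) + 44) (F := innerBody M)
    (fun k σ => ∃ q ≤ p + (S + 1) * k, partialSum c x S k < 2 ^ q ∧
      σ = (a0 ◁ a1 ◁ zip [] (natWord n) ◁ zip [] (natWord i) ◁ zip [] (natWord k) ◁ a5 ◁
        zip (List.replicate k 1) (List.replicate (n + 1 - k) 1) ◁ a7 ◁
        zip [] (bits (p + S * k) (x * 2 ^ (S * k))) ◁
        zip [] (bits q (partialSum c x S k)) ◁ blank ◁ blank ◁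
        zip [] (List.replicate S 1) ◁ blanks))
    (by
      rintro k hk σ ⟨q, hq, hlt, rfl⟩
      obtain ⟨m, hm⟩ : ∃ m, n + 1 - k = m + 1 := ⟨n - k, by omega⟩
      have hm' : n + 1 - (k + 1) = m := by omega
      have hx' : x * 2 ^ (S * k) < 2 ^ (p + S * k) := by
        rw [pow_add]; exact Nat.mul_lt_mul_of_pos_right hx (by positivity)
      rw [hm, hm', List.replicate_succ]
      refine ⟨rfl, ?_⟩
      obtain ⟨q', hq', hlt', hrun⟩ := runs_when_add (S := S) hi (by omega) (hM k (by omega))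
        (hc k (by omega)) a0 a1 a5 a7 hx' hlt (l := List.replicate k 1) (r := List.replicate m 1)
      have e1 : partialSum c x S k + c k * (x * 2 ^ (S * k)) = partialSum c x S (k + 1) := by
        rw [partialSum, partialSum, Finset.sum_range_succ]
      have e2 : S + (p + S * k) = p + S * (k + 1) := by ring
      have e3 : x * 2 ^ (S * k) * 2 ^ S = x * 2 ^ (S * (k + 1)) := by
        rw [mul_assoc, ← pow_add, Nat.mul_succ]
      have e4 : p + (S + 1) * (k + 1) = p + (S + 1) * k + S + 1 := by ring
      have e5 : p + S * k ≤ p + (S + 1) * k := by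
        have : S * k ≤ (S + 1) * k := Nat.mul_le_mul_right k (Nat.le_succ S)
        omega
      have e6 : (S + 1) * k ≤ (S + 1) * (n + 1) := Nat.mul_le_mul_left _ (by omega)
      have e7 : S * k + S = S * (k + 1) := by ring
      rw [e1, e2, e3] at hrun
      rw [e1] at hlt'
      refine ⟨_, hrun.mono (by omega), q', by omega, hlt', ?_⟩
      rw [List.replicate_succ])
    (by rintro σ ⟨q, hq, hlt, rfl⟩; simp)
    (σ := a0 ◁ a1 ◁ zip [] (natWord n) ◁ zip [] (natWord i) ◁ blank ◁ a5 ◁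
        zip [] (List.replicate (n + 1) 1) ◁ a7 ◁ zip [] (bits p x) ◁ blank ◁ blank ◁ blank ◁
        zip [] (List.replicate S 1) ◁ blanks)
    ⟨0, by simp, by simp [partialSum], by simp [bits]⟩
  rw [Nat.sub_self] at hr
  exact ⟨q, hq, hlt, _, hr⟩

/-! ### The loop over the parts -/

/-- The outer round: the number on tape 8 is multiplied by the factor for the next part. -/
def outerBody (M : Machine) : Frag :=
  inc 3 ⨟ walk 12 ⨟ transfer 7 12 ⨟ rewind 7 ⨟ rewind 12 ⨟ while_ 6 1 (innerBody M) ⨟ rewind 6 ⨟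
    erase 4 ⨟ erase 8 ⨟ moveWord 9 8 ⨟ act [(5, stepR)]

/-- The shift on tape 12 is lengthened by `W` in each round, so for the part `i` it is `W * i`
without any multiplication. The bound `B` dominates all word lengths in the round and keeps the time
estimate uniform. -/
theorem runs_outerBody {M : Machine} {n i T S W B p x : ℕ} {c : ℕ → ℕ} (hi : i + 1 ≤ n)
    (hM : ∀ j ≤ n, M.OutputsWithin (tripleWord n (i + 1) j) (natWord (c j)) T)
    (hc : ∀ j ≤ n, c j = 0 ∨ c j = 1) (a0 a1 : Tape ℕ) (hx : x < 2 ^ p)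
    (hB : p + (S + W + 1) * (n + 1) ≤ B) {l r : List ℕ} :
    ∃ q ≤ p + (S + W + 1) * (n + 1), partialSum c x (S + W) (n + 1) < 2 ^ q ∧ (outerBody M).Runs
      (a0 ◁ a1 ◁ zip [] (natWord n) ◁ zip [] (natWord i) ◁ blank ◁ zip l (1 :: r) ◁
        zip [] (List.replicate (n + 1) 1) ◁ zip [] (List.replicate W 1) ◁ zip [] (bits p x) ◁
        blank ◁ blank ◁ blank ◁ zip [] (List.replicate S 1) ◁ blanks)
      (a0 ◁ a1 ◁ zip [] (natWord n) ◁ zip [] (natWord (i + 1)) ◁ blank ◁ zip (1 :: l) r ◁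
        zip [] (List.replicate (n + 1) 1) ◁ zip [] (List.replicate W 1) ◁
        zip [] (bits q (partialSum c x (S + W) (n + 1))) ◁ blank ◁ blank ◁ blank ◁
        zip [] (List.replicate (S + W) 1) ◁ blanks)
      ((n + 1) * (11 * n + T + 4 * B + tapeBound M * (6 * n + 2 * T + 10) + 46) + 10 * B + 4 * n +
        30) := by
  obtain ⟨q, hq, hlt, z, hr⟩ := runs_innerLoop (S := S + W) hi hM hc a0 a1 (zip l (1 :: r))
    (zip [] (List.replicate W 1)) hx
  refine ⟨q, hq, hlt, ?_⟩
  have hSB : S + W + n ≤ B := by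
    have h1 : (S + W + 1) * (n + 1) = (S + W) * n + (S + W) + n + 1 := by ring
    omega
  have hpB : p + (S + W) * (n + 1) ≤ B := by
    have h1 : (S + W + 1) * (n + 1) = (S + W) * (n + 1) + (n + 1) := by ring
    omega
  have hr := hr.mono (T' := (n + 1) * (11 * n + T + 4 * B +
    tapeBound M * (6 * n + 2 * T + 10) + 46) + 1)
    (Nat.add_le_add_right (Nat.mul_le_mul_left _ (by omega)) 1)
  generalize (n + 1) * (11 * n + T + 4 * B + tapeBound M * (6 * n + 2 * T + 10) + 46) = Z at *
  refine (runs_inc 3 i _ rfl).then (by omega) ?_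
  simp only [update_tcons_zero, update_tcons_succ]
  refine (runs_walk 12 S [] _ rfl).then (by omega) ?_
  simp only [update_tcons_zero, update_tcons_succ]
  refine (runs_transfer (s := 7) (t := 12) (by simp) W [] _ _ rfl rfl).then (by omega) ?_
  simp only [update_tcons_zero, update_tcons_succ, List.append_nil,
    List.replicate_append_replicate, Nat.add_comm W S]
  refine (runs_rewind 7 _ _ (isWord_ones W) _ rfl).then (by rw [List.length_replicate]; omega) ?_
  simp only [update_tcons_zero, update_tcons_succ, List.append_nil, List.reverse_replicate]
  refine (runs_rewind 12 _ _ (isWord_ones (S + W)) _ rfl).then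
    (by simp only [List.length_replicate]; omega) ?_
  simp only [update_tcons_zero, update_tcons_succ, List.append_nil, List.reverse_replicate]
  refine hr.then (by simp only [List.length_replicate]; omega) ?_
  refine (runs_rewind 6 _ _ (isWord_ones (n + 1)) _ rfl).then
    (by simp only [List.length_replicate]; omega) ?_
  simp only [update_tcons_zero, update_tcons_succ, List.append_nil, List.reverse_replicate]
  have hl := length_natWord_le (n + 1)
  refine (runs_erase 4 _ (isWord_natWord (n + 1)) _ rfl).then
    (by simp only [List.length_replicate]; omega) ?_
  simp only [update_tcons_zero, update_tcons_succ]
  refine (runs_erase 8 _ (isWord_bits _ _) _ rfl).then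
    (by simp only [List.length_replicate, length_bits]; omega) ?_
  simp only [update_tcons_zero, update_tcons_succ]
  refine (runs_moveWord (s := 9) (t := 8) (by simp) _ (isWord_bits _ _) _ rfl rfl).then
    (by simp only [List.length_replicate, length_bits]; omega) ?_
  simp only [update_tcons_zero, update_tcons_succ]
  have h := runs_act [(5, stepR)] (a0 ◁ a1 ◁ zip [] (natWord n) ◁ zip [] (natWord (i + 1)) ◁
    blank ◁ zip l (1 :: r) ◁ zip [] (List.replicate (n + 1) 1) ◁ zip [] (List.replicate W 1) ◁
    zip [] (bits q (partialSum c x (S + W) (n + 1))) ◁ blank ◁ blank ◁ blank ◁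
    zip [] (List.replicate (S + W) 1) ◁ blanks)
  simp only [app_cons, app_nil, act_stepR, tcons_zero, tcons_succ, update_tcons_zero,
    update_tcons_succ, zip_move_right_cons] at h
  exact h.mono (by simp only [List.length_replicate, length_bits]; omega)

/-- The product of the factors for the first parts, evaluated at `2 ^ W`. -/
def kronecker (g : ℕ → ℕ → ℕ) (n W : ℕ) : ℕ → ℕ
  | 0 => 1
  | i + 1 => partialSum (g (i + 1)) (kronecker g n W i) (W * i + W) (n + 1)

/-- A bound for the lengths of all binary numbers. -/
def lengthBound (n W : ℕ) : ℕ := 1 + n * ((W * n + 1) * (n + 1))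

theorem runs_outerLoop {M : Machine} {n T W : ℕ} {g : ℕ → ℕ → ℕ}
    (hM : ∀ i j, 1 ≤ i → i ≤ n → j ≤ n →
      M.OutputsWithin (tripleWord n i j) (natWord (g i j)) T)
    (hg : ∀ i j, 1 ≤ i → i ≤ n → j ≤ n → g i j = 0 ∨ g i j = 1) (a0 a1 : Tape ℕ) :
    ∃ p ≤ lengthBound n W, kronecker g n W n < 2 ^ p ∧ ∃ a5, (while_ 5 1 (outerBody M)).Runs
      (a0 ◁ a1 ◁ zip [] (natWord n) ◁ blank ◁ blank ◁ zip [] (List.replicate n 1) ◁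
        zip [] (List.replicate (n + 1) 1) ◁ zip [] (List.replicate W 1) ◁ zip [] [2] ◁
        blank ◁ blank ◁ blank ◁ blank ◁ blanks)
      (a0 ◁ a1 ◁ zip [] (natWord n) ◁ zip [] (natWord n) ◁ blank ◁ a5 ◁
        zip [] (List.replicate (n + 1) 1) ◁ zip [] (List.replicate W 1) ◁
        zip [] (bits p (kronecker g n W n)) ◁ blank ◁ blank ◁ blank ◁
        zip [] (List.replicate (W * n) 1) ◁ blanks)
      (n * ((n + 1) * (11 * n + T + 4 * lengthBound n W +
        tapeBound M * (6 * n + 2 * T + 10) + 46) + 10 * lengthBound n W + 4 * n + 32) + 1) := by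
  obtain ⟨σ', hr, p, hp, hlt, rfl⟩ := runs_while_invariant (t := 5) (a := 1) (N := n)
    (T := (n + 1) * (11 * n + T + 4 * lengthBound n W +
      tapeBound M * (6 * n + 2 * T + 10) + 46) + 10 * lengthBound n W + 4 * n + 30)
    (F := outerBody M)
    (fun k σ => ∃ p ≤ 1 + k * ((W * n + 1) * (n + 1)), kronecker g n W k < 2 ^ p ∧
      σ = (a0 ◁ a1 ◁ zip [] (natWord n) ◁ zip [] (natWord k) ◁ blank ◁
        zip (List.replicate k 1) (List.replicate (n - k) 1) ◁
        zip [] (List.replicate (n + 1) 1) ◁ zip [] (List.replicate W 1) ◁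
        zip [] (bits p (kronecker g n W k)) ◁ blank ◁ blank ◁ blank ◁
        zip [] (List.replicate (W * k) 1) ◁ blanks))
    (by
      rintro k hk σ ⟨p, hp, hlt, rfl⟩
      obtain ⟨m, hm⟩ : ∃ m, n - k = m + 1 := ⟨n - k - 1, by omega⟩
      have hm' : n - (k + 1) = m := by omega
      rw [hm, hm', List.replicate_succ]
      refine ⟨rfl, ?_⟩
      have h1 : W * k + W ≤ W * n := by
        rw [← Nat.mul_succ]; exact Nat.mul_le_mul_left _ hk
      have h2 : (W * k + W + 1) * (n + 1) ≤ (W * n + 1) * (n + 1) :=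
        Nat.mul_le_mul_right _ (by omega)
      have h3 : (k + 1) * ((W * n + 1) * (n + 1)) ≤ n * ((W * n + 1) * (n + 1)) :=
        Nat.mul_le_mul_right _ hk
      have h4 : (k + 1) * ((W * n + 1) * (n + 1)) =
        k * ((W * n + 1) * (n + 1)) + (W * n + 1) * (n + 1) := Nat.succ_mul _ _
      obtain ⟨q, hq, hlt', hrun⟩ := runs_outerBody (S := W * k) (W := W) (B := lengthBound n W)
        hk (fun j hj => hM (k + 1) j (by omega) hk hj) (fun j hj => hg (k + 1) j (by omega) hk hj)
        a0 a1 hlt (by unfold lengthBound; omega) (l := List.replicate k 1)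
        (r := List.replicate m 1)
      refine ⟨_, hrun, q, by omega, hlt', ?_⟩
      rw [List.replicate_succ, Nat.mul_succ]
      rfl)
    (by rintro σ ⟨p, hp, hlt, rfl⟩; simp)
    (σ := a0 ◁ a1 ◁ zip [] (natWord n) ◁ blank ◁ blank ◁ zip [] (List.replicate n 1) ◁
        zip [] (List.replicate (n + 1) 1) ◁ zip [] (List.replicate W 1) ◁ zip [] [2] ◁
        blank ◁ blank ◁ blank ◁ blank ◁ blanks)
    -- The empty product `1` is the word `[2]`, of width `1`.
    ⟨1, by simp, by simp [kronecker], by simp [kronecker, bits]⟩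
  exact ⟨p, hp, hlt, _, hr⟩

/-! ### The preparation -/

/-- Turns the binary number on tape 0 into a copy on tape 2 and blocks of `1`s on 5 and 6. -/
def toUnary : Frag :=
  loop [([(0, 1)], [(0, putR 2)])] ⨟ while_ 0 2 (act [(0, put 1)] ⨟ rewind 0 ⨟ inc 2 ⨟
    act [(5, putR 1), (6, putR 1)] ⨟ loop [([(0, 1)], [(0, putR 2)])])

/-- The number on tape 0 is counted down to zero, and each decrement adds one to the counter on tape
2 and one mark to tapes 5 and 6. -/
theorem runs_toUnary (n : ℕ) (a1 a3 a4 : Tape ℕ) (σ : Tapes) : ∃ a0, toUnary.Runs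
    (zip [] (natWord n) ◁ a1 ◁ blank ◁ a3 ◁ a4 ◁ blank ◁ blank ◁ σ)
    (a0 ◁ a1 ◁ zip [] (natWord n) ◁ a3 ◁ a4 ◁ zip (List.replicate n 1) [] ◁
      zip (List.replicate n 1) [] ◁ σ) (n * (4 * n + 16) + n + 2) := by
  obtain ⟨p, hn, hlt, hpn⟩ := natWord_eq_bits n
  obtain ⟨s, w, hw, r, hr, hr0, hs, hrun⟩ := runs_loop_dec 0 p n hlt []
    (zip [] (natWord n) ◁ a1 ◁ blank ◁ a3 ◁ a4 ◁ blank ◁ blank ◁ σ)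
  rw [← hn] at hrun
  simp only [update_tcons_zero, List.append_nil] at hrun
  obtain ⟨σ', h, s', r', hs', -, rfl⟩ := runs_while_invariant (t := 0) (a := 2) (N := n)
    (T := 4 * n + 14)
    (F := act [(0, put 1)] ⨟ rewind 0 ⨟ inc 2 ⨟ act [(5, putR 1), (6, putR 1)] ⨟
      loop [([(0, 1)], [(0, putR 2)])])
    -- The invariant holds in the middle of a decrement of `n - k`: the borrow has been propagated,
    -- and the head scans either the digit one to be cleared or, if nothing was left, a blank.
    (fun k τ => ∃ s r, s ≤ p ∧ (if n - k = 0 then r = [] else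
        ∃ w, r = 2 :: w ∧ bits p (n - k - 1) = List.replicate s 2 ++ 1 :: w) ∧
      τ = (zip (List.replicate s 2) r ◁ a1 ◁ zip [] (natWord k) ◁ a3 ◁ a4 ◁
        zip (List.replicate k 1) [] ◁ zip (List.replicate k 1) [] ◁ σ))
    (by
      rintro k hk τ ⟨s, r, hs, hsr, rfl⟩
      rw [if_neg (by omega)] at hsr
      obtain ⟨w, rfl, hw⟩ := hsr
      refine ⟨rfl, ?_⟩
      obtain ⟨s', w', hw', r', hr', hr0', hs', hrun'⟩ := runs_loop_dec 0 p (n - k - 1)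
        (by omega) [] (zip [] (bits p (n - k - 1)) ◁ a1 ◁ zip [] (natWord (k + 1)) ◁ a3 ◁ a4 ◁
          zip (List.replicate (k + 1) 1) [] ◁ zip (List.replicate (k + 1) 1) [] ◁ σ)
      simp only [update_tcons_zero, List.append_nil] at hrun'
      refine ⟨_, ?_, s', r', hs', ?_, rfl⟩
      · refine (runs_act _ _).then (by omega) ?_
        simp only [app_cons, app_nil, act_put, tcons_zero, update_tcons_zero, zip_write_cons]
        refine (runs_rewind 0 _ _ (isWord_twos s) _ rfl).then
          (by rw [List.length_replicate]; omega) ?_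
        simp only [update_tcons_zero, List.reverse_replicate, ← hw]
        refine (runs_inc 2 k _ rfl).then (by simp only [List.length_replicate]; omega) ?_
        simp only [update_tcons_zero, update_tcons_succ]
        refine (runs_act _ _).then (by simp only [List.length_replicate]; omega) ?_
        simp only [app_cons, app_nil, act_putR, tcons_zero, tcons_succ, update_tcons_zero,
          update_tcons_succ, zip_write_nil, zip_move_right_cons, ← List.replicate_succ]
        exact hrun'.mono (by simp only [List.length_replicate]; omega)
      · split_ifs with h0
        · exact hr0' (by omega)
        · exact ⟨w', hr' (by omega), hw' (by omega)⟩)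
    (by
      rintro τ ⟨s, r, hs, hsr, rfl⟩
      rw [if_pos (by omega)] at hsr
      simp [hsr])
    (σ := zip (List.replicate s 2) r ◁ a1 ◁ blank ◁ a3 ◁ a4 ◁ blank ◁ blank ◁ σ)
    ⟨s, r, hs, by
      split_ifs with h0
      · exact hr0 (by omega)
      · exact ⟨w, hr (by omega), hw (by omega)⟩, rfl⟩
  refine ⟨_, hrun.then (by omega) (h.mono ?_)⟩
  have : n * (4 * n + 14 + 2) = n * (4 * n + 16) := rfl
  omega

/-- Prepares the loops. -/
def prepare : Frag :=
  toUnary ⨟ act [(6, putR 1)] ⨟ rewind 5 ⨟ rewind 6 ⨟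
    while_ 5 1 (transfer 6 7 ⨟ rewind 6 ⨟ act [(5, stepR)]) ⨟ rewind 5 ⨟ rewind 7 ⨟
    act [(8, put 2)]

theorem runs_prepare (n : ℕ) (a1 a3 a4 : Tape ℕ) (σ : Tapes) : ∃ a0, prepare.Runs
    (zip [] (natWord n) ◁ a1 ◁ blank ◁ a3 ◁ a4 ◁ blank ◁ blank ◁ blank ◁ blank ◁ σ)
    (a0 ◁ a1 ◁ zip [] (natWord n) ◁ a3 ◁ a4 ◁ zip [] (List.replicate n 1) ◁
      zip [] (List.replicate (n + 1) 1) ◁ zip [] (List.replicate (n * (n + 1)) 1) ◁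
      zip [] [2] ◁ σ) (8 * n * n + 35 * n + 30) := by
  obtain ⟨a0, h0⟩ := runs_toUnary n a1 a3 a4 (blank ◁ blank ◁ σ)
  refine ⟨a0, ?_⟩
  have hloop := runs_while_family (t := 5) (a := 1) (N := n) (T := 2 * n + 8)
    (F := transfer 6 7 ⨟ rewind 6 ⨟ act [(5, stepR)])
    (fun k => a0 ◁ a1 ◁ zip [] (natWord n) ◁ a3 ◁ a4 ◁
      zip (List.replicate k 1) (List.replicate (n - k) 1) ◁ zip [] (List.replicate (n + 1) 1) ◁
      zip (List.replicate (k * (n + 1)) 1) [] ◁ blank ◁ σ)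
    (fun k hk => by
      obtain ⟨m, hm⟩ : ∃ m, n - k = m + 1 := ⟨n - k - 1, by omega⟩
      simp [hm, List.replicate_succ])
    (fun k hk => by
      obtain ⟨m, hm⟩ : ∃ m, n - k = m + 1 := ⟨n - k - 1, by omega⟩
      have hm' : n - (k + 1) = m := by omega
      rw [hm, hm']
      refine (runs_transfer (s := 6) (t := 7) (by simp) (n + 1) [] _ _ rfl rfl).then
        (by omega) ?_
      simp only [update_tcons_zero, update_tcons_succ, List.append_nil,
        List.replicate_append_replicate]
      refine (runs_rewind 6 _ _ (isWord_ones (n + 1)) _ rfl).then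
        (by rw [List.length_replicate]; omega) ?_
      simp only [update_tcons_zero, update_tcons_succ, List.append_nil, List.reverse_replicate]
      have h := runs_act [(5, stepR)] (a0 ◁ a1 ◁ zip [] (natWord n) ◁ a3 ◁ a4 ◁
        zip (List.replicate k 1) (List.replicate (m + 1) 1) ◁ zip [] (List.replicate (n + 1) 1) ◁
        zip (List.replicate (n + 1 + k * (n + 1)) 1) [] ◁ blank ◁ σ)
      rw [show n + 1 + k * (n + 1) = (k + 1) * (n + 1) by ring] at h ⊢
      simp only [app_cons, app_nil, act_stepR, tcons_zero, tcons_succ, update_tcons_zero,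
        update_tcons_succ, List.replicate_succ (n := m), zip_move_right_cons,
        ← List.replicate_succ (n := k)] at h ⊢
      exact h.mono (by simp only [List.length_replicate]; omega))
    (by simp)
  simp only [Nat.sub_self, Nat.sub_zero, Nat.zero_mul, List.replicate_zero] at hloop
  have e1 : n * (2 * n + 8 + 2) = 2 * (n * n) + 10 * n := by ring
  have e2 : n * (4 * n + 16) = 4 * (n * n) + 16 * n := by ring
  have e3 : n * (n + 1) = n * n + n := by ring
  have e4 : 8 * n * n = 8 * (n * n) := by ring
  rw [e1] at hloop
  rw [e2] at h0
  refine h0.then (by omega) ?_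
  refine (runs_act _ _).then (by omega) ?_
  simp only [app_cons, app_nil, act_putR, tcons_zero, tcons_succ, update_tcons_zero,
    update_tcons_succ, zip_write_nil, zip_move_right_cons, ← List.replicate_succ]
  refine (runs_rewind 5 _ _ (isWord_ones n) _ rfl).then (by rw [List.length_replicate]; omega) ?_
  simp only [update_tcons_zero, update_tcons_succ, List.append_nil, List.reverse_replicate]
  refine (runs_rewind 6 _ _ (isWord_ones (n + 1)) _ rfl).then
    (by simp only [List.length_replicate]; omega) ?_
  simp only [update_tcons_zero, update_tcons_succ, List.append_nil, List.reverse_replicate]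
  refine hloop.then (by simp only [List.length_replicate]; omega) ?_
  refine (runs_rewind 5 _ _ (isWord_ones n) _ rfl).then
    (by simp only [List.length_replicate]; omega) ?_
  simp only [update_tcons_zero, update_tcons_succ, List.append_nil, List.reverse_replicate]
  refine (runs_rewind 7 _ _ (isWord_ones (n * (n + 1))) _ rfl).then
    (by simp only [List.length_replicate]; omega) ?_
  simp only [update_tcons_zero, update_tcons_succ, List.append_nil, List.reverse_replicate]
  have h := runs_act [(8, put 2)] (a0 ◁ a1 ◁ zip [] (natWord n) ◁ a3 ◁ a4 ◁
    zip [] (List.replicate n 1) ◁ zip [] (List.replicate (n + 1) 1) ◁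
    zip [] (List.replicate (n * (n + 1)) 1) ◁ blank ◁ σ)
  simp only [app_cons, app_nil, act_put, tcons_zero, tcons_succ, update_tcons_zero,
    update_tcons_succ, zip_write_nil] at h
  exact h.mono (by simp only [List.length_replicate]; omega)

/-! ### The output -/

/-- Writes the digits selected by the tapes 7 and 12 of the number on tape 8 on tape 1. -/
def output : Frag := skip 12 8 ⨟ readOff ⨟ trimEnd 1 ⨟ rewind 1

theorem bits_mod (k x : ℕ) : bits k (x % 2 ^ k) = bits k x := by
  induction k generalizing x with
  | zero => rfl
  | succ k ih =>
    rw [bits, bits, pow_succ', Nat.mod_mul_right_div_self, ih]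
    congr 2
    exact Nat.mod_mul_right_mod _ _ _

/-- Skipping `S` digits and copying `W` gives a digit block of fixed width; leading zeros, at the
end of the word, are trimmed to get the canonical code. The last digit of a nonzero code is one, so
trimming stops in time. -/
theorem runs_output (a0 a2 a3 a4 a5 a6 a9 a10 a11 : Tape ℕ) (σ : Tapes) (S W : ℕ) {p x : ℕ}
    (hx : x < 2 ^ p) : ∃ σ' : Tapes, σ' 1 = zip [] (natWord (x / 2 ^ S % 2 ^ W)) ∧ output.Runs
      (a0 ◁ blank ◁ a2 ◁ a3 ◁ a4 ◁ a5 ◁ a6 ◁ zip [] (List.replicate W 1) ◁ zip [] (bits p x) ◁ a9 ◁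
        a10 ◁ a11 ◁ zip [] (List.replicate S 1) ◁ σ) σ' (S + 3 * W + 10) := by
  obtain ⟨A, m, h1⟩ := runs_skip (s := 12) (t := 8) (by simp) S (a0 ◁ blank ◁ a2 ◁ a3 ◁ a4 ◁ a5 ◁
    a6 ◁ zip [] (List.replicate W 1) ◁ zip [] (bits p x) ◁ a9 ◁ a10 ◁ a11 ◁
    zip [] (List.replicate S 1) ◁ σ) hx rfl rfl
  simp only [update_tcons_zero, update_tcons_succ] at h1
  have hx' : x / 2 ^ S < 2 ^ (p - S) := by
    rw [Nat.div_lt_iff_lt_mul (by positivity), ← pow_add]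
    exact hx.trans_le (Nat.pow_le_pow_right two_pos (by omega))
  obtain ⟨C, D, h2⟩ := runs_readOff a0 a2 a3 a4 a5 a6 (a9 ◁ a10 ◁ a11 ◁ A ◁ σ) W hx' [] [] m
  set y := x / 2 ^ S % 2 ^ W with hy
  obtain ⟨k, hk⟩ := bits_eq_natWord_append W y (Nat.mod_lt _ (by positivity))
  have hlen := congrArg List.length hk
  rw [length_bits, List.length_append, List.length_replicate] at hlen
  rw [← bits_mod W (x / 2 ^ S), ← hy, hk, List.append_nil, List.reverse_append, List.reverse_replicate] at h2
  have h3 := runs_trimEnd 1 k (natWord y).reverse (by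
    rcases Nat.eq_zero_or_pos y with h | h
    · rw [h]; simp
    · obtain ⟨u, hu⟩ := natWord_eq_append_two h
      rw [hu]; simp) (a0 ◁ zip (List.replicate k 1 ++ (natWord y).reverse) [] ◁ a2 ◁ a3 ◁ a4 ◁ a5 ◁
      a6 ◁ C ◁ D ◁ a9 ◁ a10 ◁ a11 ◁ A ◁ σ) rfl
  simp only [update_tcons_zero, update_tcons_succ] at h3
  have h4 := runs_rewind 1 (natWord y).reverse [] (isWord_reverse.2 (isWord_natWord y))
    (a0 ◁ zip (natWord y).reverse [] ◁ a2 ◁ a3 ◁ a4 ◁ a5 ◁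
      a6 ◁ C ◁ D ◁ a9 ◁ a10 ◁ a11 ◁ A ◁ σ) rfl
  simp only [update_tcons_zero, update_tcons_succ, List.reverse_reverse, List.append_nil,
    List.length_reverse] at h4
  exact ⟨_, rfl, (h1.seq (h2.seq (h3.seq h4))).mono (by omega)⟩

/-! ### The whole program -/

/-- The fragment that counts the partitions permitted by `M`. -/
def program (M : Machine) : Frag := prepare ⨟ while_ 5 1 (outerBody M) ⨟ output

/-- The running time of the program. -/
def programTime (K n T : ℕ) : ℕ :=
  8 * n * n + 35 * n + 30 + (n * ((n + 1) * (11 * n + T + 4 * lengthBound n (n * (n + 1)) +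
    K * (6 * n + 2 * T + 10) + 46) + 10 * lengthBound n (n * (n + 1)) + 4 * n + 32) + 1 +
    (n * (n + 1) * n + 3 * (n * (n + 1)) + 10))

theorem runs_program {M : Machine} {n T : ℕ} {g : ℕ → ℕ → ℕ}
    (hM : ∀ i j, 1 ≤ i → i ≤ n → j ≤ n →
      M.OutputsWithin (tripleWord n i j) (natWord (g i j)) T)
    (hg : ∀ i j, 1 ≤ i → i ≤ n → j ≤ n → g i j = 0 ∨ g i j = 1) :
    ∃ σ' : Tapes, σ' 1 = zip [] (natWord
        (kronecker g n (n * (n + 1)) n / 2 ^ (n * (n + 1) * n) % 2 ^ (n * (n + 1)))) ∧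
      (program M).Runs (Config.init (natWord n)).tape σ' (programTime (tapeBound M) n T) := by
  have e : (Config.init (natWord n)).tape = (zip [] (natWord n) ◁ blank ◁ blank ◁ blank ◁ blank ◁
      blank ◁ blank ◁ blank ◁ blank ◁ blank ◁ blank ◁ blank ◁ blank ◁ blanks) := by
    simp only [← blanks_eq_tcons]
    funext u
    cases u <;> rfl
  obtain ⟨a0, h1⟩ := runs_prepare n blank blank blank (blank ◁ blank ◁ blank ◁ blank ◁ blanks)
  obtain ⟨p, -, hlt, a5, h2⟩ := runs_outerLoop (W := n * (n + 1)) hM hg a0 blank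
  obtain ⟨σ', hσ', h3⟩ := runs_output a0 (zip [] (natWord n)) (zip [] (natWord n)) blank a5
    (zip [] (List.replicate (n + 1) 1)) blank blank blank blanks (n * (n + 1) * n) (n * (n + 1)) hlt
  exact ⟨σ', hσ', by rw [e]; exact h1.seq (h2.seq h3)⟩

/-- The machine that counts the partitions permitted by `M`. -/
def countingMachine (M : Machine) : Machine := (program M).code 0

/-- The exit state lies outside the range of the fragment, so a fragment run on its own halts there.
-/
theorem Frag.step_code_exit (F : Frag) (σ : Tapes) : (F.code 0).step ⟨0 + F.size, σ⟩ = none := by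
  unfold Machine.step
  rw [Option.map_eq_none_iff, List.find?_eq_none]
  intro I hI
  have h := F.mem_range 0 I hI
  simp only [decide_eq_true_eq]
  intro hI'
  have := hI'.1
  simp only at this
  omega

theorem Frag.Runs.outputsWithin {F : Frag} {w v : List ℕ} {σ' : Tapes} {T : ℕ}
    (h : F.Runs (Config.init w).tape σ' T) (hv : σ' 1 = zip [] v) :
    Machine.OutputsWithin (F.code 0) w v T := by
  obtain ⟨t, ht, hrun⟩ := h 0 (F.code 0) fun _ _ _ => rfl
  refine ⟨⟨0 + F.size, σ'⟩, ⟨t, ?_⟩, by exact_mod_cast ht, F.step_code_exit σ', hv⟩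
  rw [Machine.iterate_eq_run]
  exact hrun

theorem countingMachine_outputsWithin {M : Machine} {n T : ℕ} {g : ℕ → ℕ → ℕ}
    (hM : ∀ i j, 1 ≤ i → i ≤ n → j ≤ n →
      M.OutputsWithin (tripleWord n i j) (natWord (g i j)) T)
    (hg : ∀ i j, 1 ≤ i → i ≤ n → j ≤ n → g i j = 0 ∨ g i j = 1) :
    (countingMachine M).OutputsWithin (natWord n) (natWord
      (kronecker g n (n * (n + 1)) n / 2 ^ (n * (n + 1) * n) % 2 ^ (n * (n + 1))))
      (programTime (tapeBound M) n T : ℕ) := by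
  obtain ⟨σ', hσ', h⟩ := runs_program hM hg
  exact h.outputsWithin hσ'

/-! ### Computability -/

theorem primrec_instruction_mk {α : Type} [Primcodable α] {s : α → ℕ} {r : α → List (Option ℕ)}
    {nx : α → ℕ} {a : α → List (Option ℕ × Option Dir)} (hs : Primrec s) (hr : Primrec r)
    (hn : Primrec nx) (ha : Primrec a) : Primrec fun x => Instruction.mk (s x) (r x) (nx x) (a x) :=
  (Primrec.of_equiv_symm (e := Instruction.equivProd)).comp
    (hs.pair (hr.pair (hn.pair ha)))

theorem primrec_instruction_fields :
    Primrec Instruction.state ∧ Primrec Instruction.read ∧ Primrec Instruction.next ∧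
      Primrec Instruction.act := by
  have h : Primrec Instruction.equivProd := Primrec.of_equiv (e := Instruction.equivProd)
  exact ⟨Primrec.fst.comp h, Primrec.fst.comp (Primrec.snd.comp h),
    Primrec.fst.comp (Primrec.snd.comp (Primrec.snd.comp h)),
    Primrec.snd.comp (Primrec.snd.comp (Primrec.snd.comp h))⟩

/-- The size and the code of the fragment depend primitive recursively on the parameter. -/
def PrimrecFrag {α : Type} [Primcodable α] (F : α → Frag) : Prop :=
  (Primrec fun x => (F x).size) ∧ Primrec₂ fun x b => (F x).code b

theorem PrimrecFrag.comp {α β : Type} [Primcodable α] [Primcodable β] {F : β → Frag} {f : α → β}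
    (hF : PrimrecFrag F) (hf : Primrec f) : PrimrecFrag fun x => F (f x) :=
  ⟨hF.1.comp hf, hF.2.comp (hf.comp Primrec.fst) Primrec.snd⟩

section
variable {α : Type} [Primcodable α]

theorem PrimrecFrag.seq {F G : α → Frag} (hF : PrimrecFrag F) (hG : PrimrecFrag G) :
    PrimrecFrag fun x => F x ⨟ G x :=
  ⟨Primrec.nat_add.comp hF.1 hG.1, Primrec.list_append.comp hF.2
    (hG.2.comp Primrec.fst (Primrec.nat_add.comp Primrec.snd (hF.1.comp Primrec.fst)))⟩

theorem primrec_keyBound {β : Type} [Primcodable β] :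
    Primrec fun l : List (ℕ × β) => keyBound l := by
  have h : Primrec₂ fun (_ : List (ℕ × β)) (p : (ℕ × β) × ℕ) => p.1.1 + p.2 + 1 :=
    Primrec.succ.comp (Primrec.nat_add.comp
      (Primrec.fst.comp (Primrec.fst.comp Primrec.snd)) (Primrec.snd.comp Primrec.snd))
  exact Primrec.list_foldr Primrec.id (Primrec.const 0) h

/-- Expresses `lookup` through operations whose primitive recursiveness is at hand. -/
theorem lookup_eq_getElem? {β : Type} (l : List (ℕ × β)) (t : ℕ) :
    l.lookup t = l[l.findIdx fun p => p.1 == t]?.map Prod.snd := by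
  induction l with
  | nil => rfl
  | cons p l ih =>
    rw [List.lookup_cons, List.findIdx_cons, ih]
    by_cases h : p.1 = t
    · simp [h]
    · have h1 : (t == p.1) = false := by simpa using fun h' => h h'.symm
      have h2 : (p.1 == t) = false := by simpa using h
      simp [h1, h2]

theorem primrec_lookup {β : Type} [Primcodable β] :
    Primrec₂ fun (l : List (ℕ × β)) (t : ℕ) => l.lookup t := by
  have h : Primrec₂ fun (l : List (ℕ × β)) (t : ℕ) =>
      l[l.findIdx fun p => p.1 == t]?.map Prod.snd :=
    Primrec.option_map (Primrec.list_getElem?.comp Primrec.fst (Primrec.list_findIdx Primrec.fst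
      (Primrec.beq.comp (Primrec.fst.comp Primrec.snd) (Primrec.snd.comp Primrec.fst))))
      (Primrec.snd.comp Primrec.snd)
  exact h.of_eq fun l t => (lookup_eq_getElem? l t).symm

theorem primrec_reads : Primrec reads :=
  Primrec.list_map (Primrec.list_range.comp primrec_keyBound) primrec_lookup

theorem primrec_acts : Primrec acts :=
  Primrec.list_map (Primrec.list_range.comp primrec_keyBound)
    (Primrec.option_getD.comp primrec_lookup (Primrec.const (none, none)))

theorem primrecFrag_act {l : α → List (ℕ × Act)} (hl : Primrec l) :
    PrimrecFrag fun x => act (l x) :=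
  ⟨Primrec.const 1, Primrec.list_cons.comp (primrec_instruction_mk Primrec.snd (Primrec.const [])
    (Primrec.succ.comp Primrec.snd) (primrec_acts.comp (hl.comp Primrec.fst)))
    (Primrec.const [])⟩

theorem primrecFrag_loop {rs : α → List Rule} (hl : Primrec rs) :
    PrimrecFrag fun x => loop (rs x) :=
  ⟨Primrec.const 1, Primrec.list_append.comp
    (Primrec.list_map (hl.comp Primrec.fst) (primrec_instruction_mk (Primrec.snd.comp Primrec.fst)
      (primrec_reads.comp (Primrec.fst.comp Primrec.snd)) (Primrec.snd.comp Primrec.fst)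
      (primrec_acts.comp (Primrec.snd.comp Primrec.snd))))
    (Primrec.list_cons.comp (primrec_instruction_mk Primrec.snd (Primrec.const [])
      (Primrec.succ.comp Primrec.snd) (Primrec.const [])) (Primrec.const []))⟩

theorem PrimrecFrag.when {t a : ℕ} {F : α → Frag} (hF : PrimrecFrag F) :
    PrimrecFrag fun x => when t a (F x) :=
  ⟨Primrec.succ.comp hF.1, Primrec.list_append.comp
    (Primrec.list_cons.comp (primrec_instruction_mk Primrec.snd (Primrec.const _)
      (Primrec.succ.comp Primrec.snd) (Primrec.const []))
    (Primrec.list_cons.comp (primrec_instruction_mk Primrec.snd (Primrec.const [])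
      (Primrec.nat_add.comp (Primrec.succ.comp Primrec.snd) (hF.1.comp Primrec.fst))
      (Primrec.const [])) (Primrec.const [])))
    (hF.2.comp Primrec.fst (Primrec.succ.comp Primrec.snd))⟩

theorem PrimrecFrag.while {t a : ℕ} {F : α → Frag} (hF : PrimrecFrag F) :
    PrimrecFrag fun x => while_ t a (F x) :=
  ⟨Primrec.succ.comp (Primrec.succ.comp hF.1), Primrec.list_append.comp
    (Primrec.list_cons.comp (primrec_instruction_mk Primrec.snd (Primrec.const _)
      (Primrec.succ.comp Primrec.snd) (Primrec.const []))
    (Primrec.list_cons.comp (primrec_instruction_mk Primrec.snd (Primrec.const [])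
      (Primrec.nat_add.comp Primrec.snd
        (Primrec.succ.comp (Primrec.succ.comp (hF.1.comp Primrec.fst))))
      (Primrec.const [])) (Primrec.const [])))
    (Primrec.list_append.comp (hF.2.comp Primrec.fst (Primrec.succ.comp Primrec.snd))
      (Primrec.list_cons.comp (primrec_instruction_mk
        (Primrec.nat_add.comp (Primrec.succ.comp Primrec.snd) (hF.1.comp Primrec.fst))
        (Primrec.const []) Primrec.snd (Primrec.const [])) (Primrec.const [])))⟩

theorem primrecFrag_actConst (l : List (ℕ × Act)) : PrimrecFrag fun _ : α => act l :=
  primrecFrag_act (Primrec.const l)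

theorem primrecFrag_loopConst (rs : List Rule) : PrimrecFrag fun _ : α => loop rs :=
  primrecFrag_loop (Primrec.const rs)

theorem primrecFrag_rewind (t : ℕ) : PrimrecFrag fun _ : α => rewind t :=
  (primrecFrag_actConst _).seq ((primrecFrag_loopConst _).seq (primrecFrag_actConst _))

theorem primrecFrag_inc (t : ℕ) : PrimrecFrag fun _ : α => inc t :=
  (primrecFrag_loopConst _).seq ((primrecFrag_actConst _).seq (primrecFrag_rewind t))

theorem primrecFrag_rewindPair {s t : α → ℕ} (hs : Primrec s) (ht : Primrec t) :
    PrimrecFrag fun x => rewindPair (s x) (t x) := by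
  have h : ∀ c : Act, Primrec fun x => [(s x, c), (t x, c)] := fun c =>
    Primrec.list_cons.comp (hs.pair (Primrec.const c))
      (Primrec.list_cons.comp (ht.pair (Primrec.const c)) (Primrec.const []))
  exact (primrecFrag_act (h stepL)).seq ((primrecFrag_loop (Primrec.list_cons.comp (Primrec.pair
    (Primrec.list_cons.comp (ht.pair (Primrec.const 1)) (Primrec.const [])) (h stepL))
    (Primrec.const []))).seq (primrecFrag_act (h stepR)))

theorem primrecFrag_cleanPair {s t : α → ℕ} (hs : Primrec s) (ht : Primrec t) :
    PrimrecFrag fun x => cleanPair (s x) (t x) :=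
  (primrecFrag_act (Primrec.list_cons.comp (ht.pair (Primrec.const _)) (Primrec.const []))).seq
    ((primrecFrag_rewindPair hs ht).seq (primrecFrag_loop (Primrec.list_cons.comp (Primrec.pair
      (Primrec.list_cons.comp (ht.pair (Primrec.const 1)) (Primrec.const []))
      (Primrec.list_cons.comp (hs.pair (Primrec.const _))
        (Primrec.list_cons.comp (ht.pair (Primrec.const _)) (Primrec.const []))))
      (Primrec.const []))))

end

theorem size_cleanAll (K : ℕ) : (cleanAll K).size = 5 * K := by
  induction K with
  | zero => rfl
  | succ K ih =>
    change (cleanAll K).size + 5 = _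
    omega

/-- Every `cleanPair` occupies five states, so the recursion over fragments unrolls into a `flatMap`
with explicit offsets, which is visibly primitive recursive in `K`. -/
theorem code_cleanAll (K b : ℕ) : (cleanAll K).code b = (List.range K).flatMap fun t =>
    (cleanPair (13 + 2 * t) (14 + 2 * t)).code (b + 5 * t) := by
  induction K with
  | zero => rfl
  | succ K ih =>
    rw [List.range_succ, List.flatMap_append, ← ih]
    simp only [cleanAll, Frag.seq, size_cleanAll, List.flatMap_cons, List.flatMap_nil,
      List.append_nil]

theorem primrecFrag_cleanAll : PrimrecFrag cleanAll := by
  refine ⟨(Primrec.nat_mul.comp (Primrec.const 5) Primrec.id).of_eq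
    fun K => (size_cleanAll K).symm, ?_⟩
  have h2 : Primrec fun t : ℕ => 2 * t := Primrec.nat_mul.comp (Primrec.const 2) Primrec.id
  have h : PrimrecFrag fun t => cleanPair (13 + 2 * t) (14 + 2 * t) :=
    primrecFrag_cleanPair (Primrec.nat_add.comp (Primrec.const 13) h2)
      (Primrec.nat_add.comp (Primrec.const 14) h2)
  have h3 : Primrec₂ fun K b => (List.range K).flatMap fun t =>
      (cleanPair (13 + 2 * t) (14 + 2 * t)).code (b + 5 * t) :=
    Primrec.list_flatMap (Primrec.list_range.comp Primrec.fst)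
      (h.2.comp Primrec.snd (Primrec.nat_add.comp (Primrec.snd.comp Primrec.fst)
        (Primrec.nat_mul.comp (Primrec.const 5) Primrec.snd)))
  exact h3.of_eq fun K b => (code_cleanAll K b).symm

theorem primrec_stateBound : Primrec stateBound := by
  have h : Primrec₂ fun (_ : Machine) (p : Instruction × ℕ) => p.1.state + p.1.next + p.2 :=
    Primrec.nat_add.comp
      (Primrec.nat_add.comp
        (primrec_instruction_fields.1.comp (Primrec.fst.comp Primrec.snd))
        (primrec_instruction_fields.2.2.1.comp (Primrec.fst.comp Primrec.snd)))
      (Primrec.snd.comp Primrec.snd)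
  exact Primrec.list_foldr Primrec.id (Primrec.const 0) h

theorem primrec_tapeBound : Primrec tapeBound := by
  have h : Primrec₂ fun (_ : Machine) (p : Instruction × ℕ) => p.1.act.length + p.2 :=
    Primrec.nat_add.comp
      (Primrec.list_length.comp
        (primrec_instruction_fields.2.2.2.comp (Primrec.fst.comp Primrec.snd)))
      (Primrec.snd.comp Primrec.snd)
  exact Primrec.list_foldr Primrec.id (Primrec.const 2) h

theorem primrec_simInstr : Primrec₂ simInstr :=
  primrec_instruction_mk
    (Primrec.nat_add.comp Primrec.fst (primrec_instruction_fields.1.comp Primrec.snd))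
    (Primrec.list_append.comp (Primrec.const _)
      (Primrec.list_flatMap (primrec_instruction_fields.2.1.comp Primrec.snd)
        (Primrec.list_cons.comp Primrec.snd (Primrec.const _))))
    (Primrec.nat_add.comp Primrec.fst (primrec_instruction_fields.2.2.1.comp Primrec.snd))
    (Primrec.list_append.comp (Primrec.const _)
      (Primrec.list_flatMap (primrec_instruction_fields.2.2.2.comp Primrec.snd)
        (Primrec.list_cons.comp Primrec.snd
          (Primrec.list_cons.comp
            ((Primrec.const _).pair (Primrec.snd.comp Primrec.snd)) (Primrec.const _)))))

theorem primrecFrag_simulate : PrimrecFrag simulate := by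
  have hs : Primrec fun M => stateBound M + 1 := Primrec.succ.comp primrec_stateBound
  exact ⟨hs, Primrec.list_append.comp
    (Primrec.list_map Primrec.fst (primrec_simInstr.comp (Primrec.snd.comp Primrec.fst)
      Primrec.snd))
    (Primrec.list_map (Primrec.list_range.comp (hs.comp Primrec.fst))
      (primrec_instruction_mk (Primrec.nat_add.comp (Primrec.snd.comp Primrec.fst) Primrec.snd)
        (Primrec.const []) (Primrec.nat_add.comp (Primrec.snd.comp Primrec.fst)
          (hs.comp (Primrec.fst.comp Primrec.fst))) (Primrec.const [])))⟩

theorem primrecFrag_copyNumber (t : ℕ) : PrimrecFrag fun _ : Machine => copyNumber t :=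
  (primrecFrag_loopConst _).seq (primrecFrag_rewind t)

theorem primrecFrag_writeInput : PrimrecFrag fun _ : Machine => writeInput :=
  (primrecFrag_copyNumber 2).seq ((primrecFrag_actConst _).seq ((primrecFrag_copyNumber 3).seq
    ((primrecFrag_actConst _).seq ((primrecFrag_copyNumber 4).seq
      (primrecFrag_rewindPair (Primrec.const _) (Primrec.const _))))))

theorem primrecFrag_add : PrimrecFrag fun _ : Machine => add :=
  (primrecFrag_loopConst _).seq ((primrecFrag_actConst _).seq
    ((primrecFrag_loopConst _).seq (primrecFrag_actConst _)))

theorem primrecFrag_shift (s t : ℕ) : PrimrecFrag fun _ : Machine => shift s t :=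
  (primrecFrag_actConst _).seq ((primrecFrag_loopConst _).seq
    ((primrecFrag_actConst _).seq (primrecFrag_rewind s)))

theorem primrecFrag_innerBody : PrimrecFrag innerBody :=
  primrecFrag_writeInput.seq (primrecFrag_simulate.seq (primrecFrag_add.when.seq
    ((primrecFrag_cleanAll.comp primrec_tapeBound).seq ((primrecFrag_shift 12 8).seq
      ((primrecFrag_inc 4).seq (primrecFrag_actConst _))))))

theorem primrecFrag_outerBody : PrimrecFrag outerBody :=
  (primrecFrag_inc 3).seq ((primrecFrag_loopConst _).seq ((primrecFrag_loopConst _).seq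
    ((primrecFrag_rewind 7).seq ((primrecFrag_rewind 12).seq (primrecFrag_innerBody.while.seq
      ((primrecFrag_rewind 6).seq ((primrecFrag_loopConst _).seq ((primrecFrag_loopConst _).seq
        (((primrecFrag_loopConst _).seq (primrecFrag_rewind 8)).seq
          (primrecFrag_actConst _))))))))))

theorem primrecFrag_toUnary : PrimrecFrag fun _ : Machine => toUnary :=
  (primrecFrag_loopConst _).seq ((primrecFrag_actConst _).seq ((primrecFrag_rewind 0).seq
    ((primrecFrag_inc 2).seq ((primrecFrag_actConst _).seq (primrecFrag_loopConst _))))).while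

theorem primrecFrag_prepare : PrimrecFrag fun _ : Machine => prepare :=
  primrecFrag_toUnary.seq ((primrecFrag_actConst _).seq ((primrecFrag_rewind 5).seq
    ((primrecFrag_rewind 6).seq (((primrecFrag_loopConst _).seq ((primrecFrag_rewind 6).seq
      (primrecFrag_actConst _))).while.seq ((primrecFrag_rewind 5).seq
        ((primrecFrag_rewind 7).seq (primrecFrag_actConst _)))))))

theorem primrecFrag_output : PrimrecFrag fun _ : Machine => output :=
  (primrecFrag_loopConst _).seq ((primrecFrag_loopConst _).seq
    (((primrecFrag_actConst _).seq ((primrecFrag_loopConst _).seq (primrecFrag_actConst _))).seq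
      (primrecFrag_rewind 1)))

theorem primrecFrag_program : PrimrecFrag program :=
  primrecFrag_prepare.seq (primrecFrag_outerBody.while.seq primrecFrag_output)

theorem computable_countingMachine : Computable countingMachine :=
  (primrecFrag_program.2.comp Primrec.id (Primrec.const 0)).to_comp

/-! ### The generating polynomial -/

open Polynomial in
/-- The polynomial `∑ j ≤ n, h(j) X ^ (i j)`. -/
noncomputable def multiplicitySeries (h : ℕ → ℕ) (n i : ℕ) : ℕ[X] :=
  ∑ j ∈ Finset.range (n + 1), C (h j) * X ^ (i * j)

theorem coeff_multiplicitySeries (h : ℕ → ℕ) (n i k : ℕ) :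
    (multiplicitySeries h n i).coeff k =
      ∑ j ∈ Finset.range (n + 1), if k = i * j then h j else 0 := by
  simp [multiplicitySeries, Polynomial.finsetSum_coeff, Polynomial.coeff_X_pow]

theorem coeff_multiplicitySeries_mul (h : ℕ → ℕ) {n i j : ℕ} (hi : 1 ≤ i) (hj : j ≤ n) :
    (multiplicitySeries h n i).coeff (j * i) = h j := by
  rw [coeff_multiplicitySeries, Finset.sum_eq_single j]
  · rw [if_pos (mul_comm j i)]
  · intro k _ hk
    rw [mul_comm, if_neg]
    exact fun e => hk (Nat.eq_of_mul_eq_mul_left hi e).symm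
  · intro hj'
    exact absurd (Finset.mem_range.2 (by omega)) hj'

theorem dvd_of_coeff_multiplicitySeries_ne_zero {h : ℕ → ℕ} {n i k : ℕ}
    (hk : (multiplicitySeries h n i).coeff k ≠ 0) : i ∣ k := by
  rw [coeff_multiplicitySeries] at hk
  obtain ⟨j, -, hj⟩ := Finset.exists_ne_zero_of_sum_ne_zero hk
  by_contra hd
  exact hj (if_neg fun e => hd ⟨j, e⟩)

/-- Take `l i / i` as the multiplicity of `i`; divisibility makes the sizes add up to `n` again. -/
theorem exists_partition_of_forall_dvd {n : ℕ} {l : ℕ →₀ ℕ}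
    (hl : l ∈ (Finset.Icc 1 n).finsuppAntidiag n) (hd : ∀ i, i ∣ l i) :
    ∃ p : n.Partition, p.toFinsuppAntidiag = l := by
  obtain ⟨h1, h2⟩ := Finset.mem_finsuppAntidiag.1 hl
  have hpos (i : ℕ) (h : l i ≠ 0) : 0 < i :=
    (Finset.mem_Icc.1 (h2 (Finsupp.mem_support_iff.2 h))).1
  have hne (i : ℕ) : l i ≠ 0 ↔ l i / i ≠ 0 := by
    refine ⟨fun h e => ?_, fun h e => h (by rw [e, Nat.zero_div])⟩
    exact h (by rw [← Nat.div_mul_cancel (hd i), e, zero_mul])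
  refine ⟨Nat.Partition.mk (Finsupp.mk l.support (fun i => l i / i) fun i => by
    rw [Finsupp.mem_support_iff]; exact hne i).toMultiset ?_ ?_, ?_⟩
  · intro i hi
    refine hpos i ?_
    simpa using hi
  · refine Eq.trans ?_ h1
    suffices ∑ x ∈ l.support, l x / x * x = ∑ x ∈ Finset.Icc 1 n, l x by simpa [Finsupp.sum]
    exact Finset.sum_subset_zero_on_sdiff h2 (by simp) fun x _ => Nat.div_mul_cancel (hd x)
  · ext x
    simpa [Nat.Partition.toFinsuppAntidiag] using Nat.div_mul_cancel (hd x)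

theorem count_parts_le {n : ℕ} (p : n.Partition) (i : ℕ) : p.parts.count i ≤ n :=
  calc p.parts.count i ≤ p.parts.card := Multiset.count_le_card _ _
    _ ≤ p.parts.sum := by
      simpa using Multiset.card_nsmul_le_sum (s := p.parts) (a := 1) fun x hx => p.parts_pos hx
    _ = n := p.parts_sum

theorem coeff_prod_multiplicitySeries (g : ℕ → ℕ → ℕ) (n : ℕ) :
    (∏ i ∈ Finset.Icc 1 n, multiplicitySeries (g i) n i).coeff n =
      ∑ p : n.Partition, ∏ i ∈ Finset.Icc 1 n, g i (p.parts.count i) := by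
  -- In power series the coefficient of a product is a sum over `finsuppAntidiag`, into which
  -- partitions embed by sending `i` to `i` times its multiplicity.
  rw [← Polynomial.coeff_coe, ← Polynomial.coeToPowerSeries.ringHom_apply, map_prod,
    PowerSeries.coeff_prod]
  symm
  refine Finset.sum_of_injOn Nat.Partition.toFinsuppAntidiag
    (Nat.Partition.toFinsuppAntidiag_injective n).injOn
    (fun p _ => p.toFinsuppAntidiag_mem_finsuppAntidiag) ?_ ?_
  -- A term outside the image vanishes: otherwise `i ∣ l i` for all `i`, and `l` comes from a
  -- partition.
  · intro l hl hl'
    by_contra hne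
    replace hne := Finset.prod_ne_zero_iff.1 hne
    refine hl' ?_
    obtain ⟨p, hp⟩ := exists_partition_of_forall_dvd hl fun i => by
      by_cases hi : i ∈ Finset.Icc 1 n
      · have := hne i hi
        rw [Polynomial.coeToPowerSeries.ringHom_apply, Polynomial.coeff_coe] at this
        exact dvd_of_coeff_multiplicitySeries_ne_zero this
      · have : l i = 0 := by
          by_contra h
          exact hi ((Finset.mem_finsuppAntidiag.1 hl).2 (Finsupp.mem_support_iff.2 h))
        rw [this]
        exact dvd_zero i
    exact ⟨p, by simp, hp⟩
  · intro p _
    refine Finset.prod_congr rfl fun i hi => ?_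
    have hi1 := (Finset.mem_Icc.1 hi).1
    rw [Polynomial.coeToPowerSeries.ringHom_apply, Polynomial.coeff_coe]
    exact (coeff_multiplicitySeries_mul _ hi1 (count_parts_le p i)).symm

theorem partitionCount_eq_coeff {g : ℕ → ℕ → ℕ → ℕ} {n : ℕ}
    (hg : ∀ i j : ℕ, 1 ≤ i → i ≤ n → j ≤ n → g n i j = 0 ∨ g n i j = 1) :
    partitionCount g n = (∏ i ∈ Finset.Icc 1 n, multiplicitySeries (g n i) n i).coeff n := by
  classical
  rw [coeff_prod_multiplicitySeries, partitionCount, Nat.card_eq_fintype_card,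
    Fintype.card_subtype, Finset.card_filter]
  refine Finset.sum_congr rfl fun p _ => ?_
  split_ifs with h
  · exact (Finset.prod_eq_one h).symm
  · push Not at h
    obtain ⟨i, hi, h⟩ := h
    have hi' := Finset.mem_Icc.1 hi
    exact (Finset.prod_eq_zero hi ((hg _ _ hi'.1 hi'.2 (count_parts_le p i)).resolve_right h)).symm

/-! ### Kronecker substitution -/

theorem eval_multiplicitySeries (h : ℕ → ℕ) (n i x : ℕ) :
    (multiplicitySeries h n i).eval x = ∑ j ∈ Finset.range (n + 1), h j * x ^ (i * j) := by
  simp [multiplicitySeries, Polynomial.eval_finsetSum]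

theorem kronecker_eq_eval (g : ℕ → ℕ → ℕ) (n W k : ℕ) :
    kronecker g n W k =
      (∏ i ∈ Finset.Icc 1 k, multiplicitySeries (g i) n i).eval (2 ^ W) := by
  induction k with
  | zero => simp [kronecker]
  | succ k ih =>
    rw [Finset.prod_Icc_succ_top (by omega), Polynomial.eval_mul, ← ih, eval_multiplicitySeries,
      kronecker, partialSum, Finset.mul_sum]
    refine Finset.sum_congr rfl fun j _ => ?_
    rw [← pow_mul]
    ring_nf

/-- Coefficients below `B` are the base `B` digits of the value at `B`. Splitting off the constant
term shows that dividing the value by `B` is passing to `divX`. -/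
theorem eval_div_pow_mod {p : Polynomial ℕ} {B : ℕ} (hp : ∀ k, p.coeff k < B) (n : ℕ) :
    p.eval B / B ^ n % B = p.coeff n := by
  induction n generalizing p with
  | zero =>
    conv_lhs => rw [← Polynomial.divX_mul_X_add p]
    simp [Nat.mod_eq_of_lt (hp 0)]
  | succ n ih =>
    have hB : 0 < B := (Nat.zero_le _).trans_lt (hp 0)
    have h : p.eval B / B = p.divX.eval B := by
      conv_lhs => rw [← Polynomial.divX_mul_X_add p]
      simp [Nat.add_div_of_dvd_right, hB, Nat.div_eq_of_lt (hp 0)]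
    rw [pow_succ', ← Nat.div_div_eq_div_mul, h,
      ih fun k => by rw [Polynomial.coeff_divX]; exact hp _, Polynomial.coeff_divX]

theorem coeff_le_eval_one (p : Polynomial ℕ) (k : ℕ) : p.coeff k ≤ p.eval 1 := by
  rw [Polynomial.eval_eq_sum_range]
  by_cases hk : k ∈ Finset.range (p.natDegree + 1)
  · simpa using Finset.single_le_sum (f := fun i => p.coeff i) (fun _ _ => Nat.zero_le _) hk
  · rw [Polynomial.coeff_eq_zero_of_natDegree_lt]
    · exact Nat.zero_le _
    · simpa using hk

/-- A natural coefficient is at most the value at `1`, where each of the `n` factors is at most `n +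
1`. This is what fixes `W = n * (n + 1)`; for `n = 0` the strict inequality fails. -/
theorem coeff_prod_multiplicitySeries_lt {g : ℕ → ℕ → ℕ} {n : ℕ} (hn : 1 ≤ n)
    (hg : ∀ i j : ℕ, 1 ≤ i → i ≤ n → j ≤ n → g i j = 0 ∨ g i j = 1) (k : ℕ) :
    (∏ i ∈ Finset.Icc 1 n, multiplicitySeries (g i) n i).coeff k < 2 ^ (n * (n + 1)) := by
  refine (coeff_le_eval_one _ k).trans_lt ?_
  rw [Polynomial.eval_prod]
  calc ∏ i ∈ Finset.Icc 1 n, (multiplicitySeries (g i) n i).eval 1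
      ≤ ∏ _i ∈ Finset.Icc 1 n, (n + 1) := by
        refine Finset.prod_le_prod' fun i hi => ?_
        have hi' := Finset.mem_Icc.1 hi
        rw [eval_multiplicitySeries]
        refine (Finset.sum_le_card_nsmul _ _ 1 fun j hj => ?_).trans (by simp)
        have hj' := Finset.mem_range.1 hj
        rcases hg i j hi'.1 hi'.2 (by omega) with h | h <;> simp [h]
    _ = (n + 1) ^ n := by simp
    _ < (2 ^ (n + 1)) ^ n := Nat.pow_lt_pow_left Nat.lt_two_pow_self (by omega)
    _ = 2 ^ (n * (n + 1)) := by rw [← pow_mul, mul_comm]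

theorem kronecker_digit {g : ℕ → ℕ → ℕ → ℕ} {n : ℕ} (hn : 1 ≤ n)
    (hg : ∀ i j : ℕ, 1 ≤ i → i ≤ n → j ≤ n → g n i j = 0 ∨ g n i j = 1) :
    kronecker (g n) n (n * (n + 1)) n / 2 ^ (n * (n + 1) * n) % 2 ^ (n * (n + 1)) =
      partitionCount g n := by
  rw [kronecker_eq_eval, pow_mul _ (n * (n + 1)) n,
    eval_div_pow_mod (coeff_prod_multiplicitySeries_lt hn hg), partitionCount_eq_coeff hg]

/-! ### Running times -/

theorem Machine.OutputsWithin.mono {M : Machine} {w v : List ℕ} {S T : ℝ}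
    (h : M.OutputsWithin w v S) (hST : S ≤ T) : M.OutputsWithin w v T := by
  obtain ⟨c, run, ht, h⟩ := h
  exact ⟨c, run, ht.trans hST, h⟩

/-- The sequence is bounded by a polynomial. -/
def PolyBounded (u : ℕ → ℕ) : Prop :=
  ∃ C D : ℕ, ∀ n, u n ≤ C * (n + 1) ^ D

theorem PolyBounded.const (a : ℕ) : PolyBounded fun _ => a :=
  ⟨a, 0, by simp⟩

theorem PolyBounded.id : PolyBounded fun n => n :=
  ⟨1, 1, by simp⟩

theorem PolyBounded.add {u v : ℕ → ℕ} (hu : PolyBounded u) (hv : PolyBounded v) :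
    PolyBounded fun n => u n + v n := by
  obtain ⟨C, D, hu⟩ := hu
  obtain ⟨C', D', hv⟩ := hv
  refine ⟨C + C', D + D', fun n => ?_⟩
  have h1 := Nat.pow_le_pow_right n.succ_pos (Nat.le_add_right D D')
  have h2 := Nat.pow_le_pow_right n.succ_pos (Nat.le_add_left D' D)
  calc u n + v n ≤ C * (n + 1) ^ D + C' * (n + 1) ^ D' := add_le_add (hu n) (hv n)
    _ ≤ C * (n + 1) ^ (D + D') + C' * (n + 1) ^ (D + D') :=
      add_le_add (Nat.mul_le_mul_left _ h1) (Nat.mul_le_mul_left _ h2)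
    _ = (C + C') * (n + 1) ^ (D + D') := (add_mul _ _ _).symm

theorem PolyBounded.mul {u v : ℕ → ℕ} (hu : PolyBounded u) (hv : PolyBounded v) :
    PolyBounded fun n => u n * v n := by
  obtain ⟨C, D, hu⟩ := hu
  obtain ⟨C', D', hv⟩ := hv
  refine ⟨C * C', D + D', fun n => ?_⟩
  calc u n * v n ≤ C * (n + 1) ^ D * (C' * (n + 1) ^ D') := Nat.mul_le_mul (hu n) (hv n)
    _ = C * C' * (n + 1) ^ (D + D') := by ring

theorem PolyBounded.programTime {T : ℕ → ℕ} (hT : PolyBounded T) (K : ℕ) :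
    PolyBounded fun n => programTime K n (T n) := by
  have c (a : ℕ) := PolyBounded.const a
  have i := PolyBounded.id
  have i1 := i.add (c 1)
  have w := i.mul i1
  have l : PolyBounded fun n => lengthBound n (n * (n + 1)) :=
    (c 1).add (i.mul (((w.mul i).add (c 1)).mul i1))
  exact ((((c 8).mul i).mul i).add ((c 35).mul i) |>.add (c 30)).add
    (((i.mul ((((i1.mul ((((((c 11).mul i).add hT).add ((c 4).mul l)).add
      ((c K).mul ((((c 6).mul i).add ((c 2).mul hT)).add (c 10)))).add (c 46))).add
        ((c 10).mul l)).add ((c 4).mul i)).add (c 32))).add (c 1)).add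
          (((w.mul i).add ((c 3).mul w)).add (c 10)))

/-- Both logarithms are at least `log 2 > 1 / 2`. This lets constants be absorbed and exponents
raised. -/
theorem one_le_complexity (f : ℕ → ℤ) {n : ℕ} (hn : 1 ≤ n) : 1 ≤ complexity f n := by
  have hn' : (1 : ℝ) ≤ n := by exact_mod_cast hn
  have h1 : Real.log 2 ≤ Real.log (1 + n) := Real.log_le_log (by norm_num) (by linarith)
  have h2 : Real.log 2 ≤ Real.log (2 + |(f n : ℝ)|) :=
    Real.log_le_log (by norm_num) (by linarith [abs_nonneg (f n : ℝ)])
  have := Real.log_two_gt_d9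
  unfold complexity
  linarith

theorem rpow_le_mul_complexity {f : ℕ → ℕ} {n : ℕ} {A c : ℝ} (hn : 1 ≤ n) (hA : 0 < A)
    (h : Real.exp ((n : ℝ) ^ c) ≤ A * f n) :
    (n : ℝ) ^ c ≤ (|Real.log A| + 1) * complexity (fun k => (f k : ℤ)) n := by
  have hm := one_le_complexity (fun k => (f k : ℤ)) hn
  have hf : (0 : ℝ) ≤ f n := Nat.cast_nonneg _
  have h1 : (n : ℝ) ^ c ≤ Real.log A + Real.log (2 + f n) := by
    rw [← Real.log_mul hA.ne' (by positivity), Real.le_log_iff_exp_le (by positivity)]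
    nlinarith
  have h2 : Real.log (2 + f n) ≤ complexity (fun k => (f k : ℤ)) n := by
    have : 0 ≤ Real.log (1 + (n : ℝ)) := Real.log_nonneg (by simp)
    simp only [complexity, Int.cast_natCast, Nat.abs_cast]
    linarith
  have h3 := le_abs_self (Real.log A)
  nlinarith [abs_nonneg (Real.log A)]

theorem exists_succ_le_mul_complexity_pow {f : ℕ → ℕ} {X : Set ℕ} {c : ℝ}
    (hX : ∀ n ∈ X, 1 ≤ n) (hc : 0 < c)
    (hf : (fun n : ℕ => Real.exp ((n : ℝ) ^ c)) =O[Filter.atTop ⊓ Filter.principal X]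
      fun n : ℕ => (f n : ℝ)) :
    ∃ B e : ℕ, ∀ n ∈ X, (n + 1 : ℝ) ≤ B * complexity (fun k => (f k : ℤ)) n ^ e := by
  obtain ⟨A, hA, h⟩ := hf.exists_pos
  obtain ⟨N, hN⟩ := Filter.eventually_atTop.1 (Filter.eventually_inf_principal.1 h.bound)
  set Q : ℝ := |Real.log A| + 1
  have hQ : 0 < Q := by positivity
  obtain ⟨B, hB⟩ := exists_nat_ge (2 * Q ^ c⁻¹)
  -- `B` serves `n ≥ N`, where `n + 1 ≤ 2 * n` and `n ≤ (Q * m) ^ c⁻¹`; `N` serves the finitely many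
  -- smaller `n`. Rounding `c⁻¹` up is harmless since `m ≥ 1`.
  refine ⟨B + N, ⌈c⁻¹⌉₊, fun n hn => ?_⟩
  have hn1 := hX n hn
  have hn1' : (1 : ℝ) ≤ n := by exact_mod_cast hn1
  set m := complexity (fun k => (f k : ℤ)) n with hm_def
  have hm : 1 ≤ m := one_le_complexity _ hn1
  have hme : 1 ≤ m ^ ⌈c⁻¹⌉₊ := one_le_pow₀ hm
  rcases le_or_gt N n with hNn | hNn
  · have h1 : (n : ℝ) ^ c ≤ Q * m := rpow_le_mul_complexity hn1 hA (by
      simpa using hN n hNn hn)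
    have h2 : (n : ℝ) ≤ Q ^ c⁻¹ * m ^ ⌈c⁻¹⌉₊ :=
      calc (n : ℝ) = ((n : ℝ) ^ c) ^ c⁻¹ := (Real.rpow_rpow_inv (by positivity) hc.ne').symm
        _ ≤ (Q * m) ^ c⁻¹ := Real.rpow_le_rpow (by positivity) h1 (by positivity)
        _ = Q ^ c⁻¹ * m ^ c⁻¹ := Real.mul_rpow hQ.le (by linarith)
        _ ≤ Q ^ c⁻¹ * m ^ ((⌈c⁻¹⌉₊ : ℕ) : ℝ) := by
          gcongr
          exact Nat.le_ceil _
        _ = Q ^ c⁻¹ * m ^ ⌈c⁻¹⌉₊ := by rw [Real.rpow_natCast]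
    calc (n + 1 : ℝ) ≤ 2 * n := by linarith
      _ ≤ 2 * Q ^ c⁻¹ * m ^ ⌈c⁻¹⌉₊ := by linarith
      _ ≤ B * m ^ ⌈c⁻¹⌉₊ := by gcongr
      _ ≤ _ := by gcongr; simp
  · have h3 : (n + 1 : ℝ) ≤ N := by exact_mod_cast hNn
    calc (n + 1 : ℝ) ≤ N * 1 := by linarith
      _ ≤ N * m ^ ⌈c⁻¹⌉₊ := by gcongr
      _ ≤ _ := by gcongr; simp

theorem intWord_natCast (n : ℕ) : intWord (n : ℤ) = natWord n := by
  simp [intWord]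

theorem isPIOAlgorithmOn_countingMachine {M : Machine} {g : ℕ → ℕ → ℕ → ℕ} {X : Set ℕ} {c : ℝ}
    (hg : ∀ n i j : ℕ, 1 ≤ i → i ≤ n → j ≤ n → g n i j = 0 ∨ g n i j = 1)
    (hX : ∀ n ∈ X, 1 ≤ n) (hc : 0 < c)
    (hf : (fun n : ℕ => Real.exp ((n : ℝ) ^ c)) =O[Filter.atTop ⊓ Filter.principal X]
      fun n : ℕ => (partitionCount g n : ℝ))
    (hM : ComputesInPolySteps M g) :
    IsPIOAlgorithmOn (countingMachine M) (fun n => (partitionCount g n : ℤ)) X := by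
  obtain ⟨a, d, hM⟩ := hM
  obtain ⟨C, D, hT⟩ := PolyBounded.programTime (T := fun n => a * (n + 1) ^ d)
    ⟨a, d, fun _ => le_rfl⟩ (tapeBound M)
  obtain ⟨B, e, hB⟩ := exists_succ_le_mul_complexity_pow hX hc hf
  -- Substituting `n + 1 ≤ B * m ^ e` into `C * (n + 1) ^ D`; the two summands `1` only make the
  -- constants positive.
  refine ⟨C * B ^ D + 1, e * D + 1, Nat.succ_pos _, Nat.succ_pos _, fun n hn => ?_⟩
  have hm := one_le_complexity (fun n => (partitionCount g n : ℤ)) (hX n hn)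
  have h := countingMachine_outputsWithin (T := a * (n + 1) ^ d)
    (fun i j hi hin hj => (hM n i j hi hin hj).mono (by push_cast; rw [add_comm])) (hg n)
  rw [kronecker_digit (hX n hn) (hg n)] at h
  rw [intWord_natCast]
  refine h.mono ?_
  have hBn := hB n hn
  set m := complexity (fun n => (partitionCount g n : ℤ)) n
  calc (programTime (tapeBound M) n (a * (n + 1) ^ d) : ℝ) ≤ C * (n + 1) ^ D := by
        exact_mod_cast hT n
    _ ≤ C * (B * m ^ e) ^ D := by gcongr
    _ = C * B ^ D * m ^ (e * D) := by rw [mul_pow, ← pow_mul, mul_assoc]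
    _ ≤ (C * B ^ D + 1) * m ^ (e * D + 1) := by
        gcongr
        · linarith
        · omega
    _ = _ := by push_cast; rfl

end EffectiveCount

theorem mainTheorem5 :
    (∀ g : ℕ → ℕ → ℕ → ℕ,
      (∀ n i j : ℕ, 1 ≤ i → i ≤ n → j ≤ n → g n i j = 0 ∨ g n i j = 1) →
      ∀ n : ℕ, 1 ≤ n →
        EffectiveCount.partitionCount g n =
          (∏ i ∈ Finset.Icc 1 n, ∑ j ∈ Finset.range (n + 1),
            Polynomial.C (g n i j) * Polynomial.X ^ (i * j)).coeff n) ∧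
    ∃ Φ : EffectiveCount.Machine → EffectiveCount.Machine, Computable Φ ∧
      ∀ (g : ℕ → ℕ → ℕ → ℕ) (X : Set ℕ) (c : ℝ),
        (∀ n i j : ℕ, 1 ≤ i → i ≤ n → j ≤ n → g n i j = 0 ∨ g n i j = 1) →
        (∃ M : EffectiveCount.Machine, EffectiveCount.ComputesInPolySteps M g) →
        (∀ n ∈ X, 1 ≤ n) →
        0 < c →
        ((fun n : ℕ => Real.exp ((n : ℝ) ^ c)) =O[Filter.atTop ⊓ Filter.principal X]
          fun n : ℕ => (EffectiveCount.partitionCount g n : ℝ)) →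
        EffectiveCount.IsPIOFunctionOn (fun n => (EffectiveCount.partitionCount g n : ℤ)) X ∧
        ∀ M : EffectiveCount.Machine, EffectiveCount.ComputesInPolySteps M g →
          EffectiveCount.IsPIOAlgorithmOn (Φ M)
            (fun n => (EffectiveCount.partitionCount g n : ℤ)) X := by
  refine ⟨fun g hg n _ => EffectiveCount.partitionCount_eq_coeff (hg n),
    EffectiveCount.countingMachine, EffectiveCount.computable_countingMachine, ?_⟩
  rintro g X c hg ⟨M, hM⟩ hX hc hf
  exact ⟨⟨_, EffectiveCount.isPIOAlgorithmOn_countingMachine hg hX hc hf hM⟩,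
    fun M' hM' => EffectiveCount.isPIOAlgorithmOn_countingMachine hg hX hc hf hM'⟩
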